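/- Let $n,r\ge 0$ be integers. Let $\Lambda(n,r)$ be the set of $\lambda\in\mathbb Z_{\ge0}^n$ with $\sum_i\lambda_i=r$, and $\Lambda^\bullet(n,r)\subseteq\Lambda(n,r)$ the subset of those $\lambda$ such that $\lambda_i=0$ implies $\lambda_j=0$ for all $j>i$. **The algebra.** Let $H_r(q)$ be the Hecke algebra over $\mathbb Z[q]$ with generators $T_1,\dots,T_{r-1}$ and relations $T_i^2=(q-1)T_i+q$, $T_iT_j=T_jT_i$ for $|i-j|>1$, $T_iT_{i+1}T_i=T_{i+1}T_iT_{i+1}$; let $T_w$ be the product of the $T_i$ along a reduced word of $w\in\mathfrak S_r$, and $x_\lambda=\sum_{w\in\mathfrak S_\lambda}T_w$ for the Young subgroup $\mathfrak S_\lambda$. Put $S_q(n,r)=\operatorname{End}_{H_r(q)}\bigl(\bigoplus_{\lambda\in\Lambda(n,r)}x_\lambda H_r(q)\bigr)$ (endomorphisms of a right module) and $\mathbf S_0(n,r)=\mathbb C\otimes_{\mathbb Z}\bigl(\mathbb Z[q]/(q)\otimes_{\mathbb Z[q]}S_q(n,r)\bigr)$. **The standard basis.** Let $M_n(r)$ be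 the set of $n\times n$ matrices of nonnegative integers with sum of entries $r$, and $\mathrm{ro}(A),\mathrm{co}(A)$ the vectors of row and column sums. For $A\in M_n(r)$ with $\lambda=\mathrm{ro}(A)$, $\mu=\mathrm{co}(A)$ let $D_A\subseteq\mathfrak S_r$ be the $(\mathfrak S_\lambda,\mathfrak S_\mu)$-double coset of the $w$ with $|R_i^\lambda\cap wR_j^\mu|=a_{ij}$ for all $i,j$, where $R^\lambda_i=\{x:\lambda_1+\dots+\lambda_{i-1}<x\le\lambda_1+\dots+\lambda_i\}$, and let $\phi_A\in S_q(n,r)$ be given by $\phi_A(x_\nu h)=\delta_{\nu\mu}\sum_{w\in D_A}T_wh\in x_\lambda H_r(q)$. The standard basis element $e_A\in\mathbf S_0(n,r)$ is the image of $\sum_{C\preceq A}\phi_C$, where $C\preceq A$ means that $\mathrm{ro}(C)=\mathrm{ro}(A)$, $\mathrm{co}(C)=\mathrm{co}(A)$ and $\sum_{k\le i,l\le j}c_{kl}\ge\sum_{k\le i,l\le j}a_{kl}$ for all $i,j$ (that is, the $\mathrm{GL}_r(\mathbb C)$-orbit of pairs of $n$-step flags labelled by $C$ is in the closure of the one labelled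 by $A$). With $D_\lambda=\operatorname{diag}(\lambda)$ and the matrix units $E_{ab}$, put $k_\lambda=e_{D_\lambda}$, $e_i=\sum_\lambda e_{D_\lambda-E_{i+1,i+1}+E_{i,i+1}}$ and $f_i=\sum_\lambda e_{D_\lambda-E_{i,i}+E_{i+1,i}}$ for $1\le i\le n-1$, the sums being over the $\lambda\in\Lambda(n,r)$ with $\lambda_{i+1}>0$, respectively $\lambda_i>0$. **The modules $P_\lambda$.** Let $\lambda\in\Lambda(n,r)$. A strong composition $\alpha$ of $n$ (all parts positive) cuts $\lambda$ into consecutive blocks of lengths $\alpha_1,\alpha_2,\dots$; let $\max(\lambda)$ be the set of those $\alpha$ for which each block either equals $(0)$ or has nonzero first and last entries. A matrix is *open* if there are no $i<i'$, $j<j'$ with $a_{ij}\ne0$ and $a_{i'j'}\neq0$; $A$ is *open on columns* with respect to $\alpha$ if for every $v$ the matrix obtained from $A$ by replacing all columns outside the $v$-th block of $\alpha$ by zero is open. Let $B^{\lambda,\alpha}$ be the set of the $e_A$ with $\mathrm{co}(A)=\lambda$ and $A$ open on columns with respect to $\alpha$, and $$B^\lambda=\{e_A:\mathrm{co}(A)=\lambda\}\setminus\bigcup_{\alpha\in\max(\lambda),\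 \alpha\ne(1,\dots,1)}B^{\lambda,\alpha}.$$ $P_\lambda$ is the $\mathbb C$-vector space with basis $B^\lambda$ and the $\mathbf S_0(n,r)$-action in which, for $b\in\{e_i,f_i,k_\mu\}$ and $e_A\in B^\lambda$, the vector $b\cdot e_A$ is the product $be_A$ formed in $\mathbf S_0(n,r)$ if that product lies in $B^\lambda$, and $0$ otherwise. **The modules $S_\lambda$.** A matrix $A$ of nonnegative integers is *column block diagonal* if $a_{ij}>0$ implies $a_{i'j'}=0$ for all $i'\le i$, $j'>j$. For $\lambda\in\Lambda^\bullet(n,r)$ let $\mathrm{CB}(\lambda)$ be the set of $n\times n$ column block diagonal matrices with column sum vector $\lambda$, $\beta^\lambda=\{e_A:A\in\mathrm{CB}(\lambda)\}$, let $N_\lambda\subseteq P_\lambda$ be the $\mathbb C$-span of $B^\lambda\setminus\beta^\lambda$, and $S_\lambda=P_\lambda/N_\lambda$. **Theorem.** For each $\lambda\in\Lambda^\bullet(n,r)$ the above formulas define exactly one $\mathbf S_0(n,r)$-module structure on $P_\lambda$ (compatible with its complex structure), $\beta^\lambda\subseteq B^\lambda$, $N_\lambda$ is an $\mathbf S_0(n,r)$-submodule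 of $P_\lambda$, and the classes of the $e_A$, $A\in\mathrm{CB}(\lambda)$, form a $\mathbb C$-basis of $S_\lambda$ indexed by $\mathrm{CB}(\lambda)$. Moreover $\{S_\lambda\mid\lambda\in\Lambda^\bullet(n,r)\}$ is a complete set of representatives of the isomorphism classes of simple $\mathbf S_0(n,r)$-modules: every $S_\lambda$ is simple, $S_\lambda\cong S_\mu$ only if $\lambda=\mu$, and every simple left $\mathbf S_0(n,r)$-module is isomorphic to some $S_\lambda$. -/

import Mathlib

open scoped TensorProduct DirectSum Polynomial MulOpposite

noncomputable section

namespace ZeroSchur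

/-! ### Weak compositions -/

/-- `Λ(n, r)`: weak compositions of `r` of length `n`. -/
abbrev WComp (n r : ℕ) : Type := {l : Fin n → ℕ // ∑ i, l i = r}

instance (n r : ℕ) : Fintype (WComp n r) :=
  Fintype.subtype (Finset.piAntidiag Finset.univ r) (by intro l; simp)

/-- Membership in `Λ•(n, r)`: after a zero part, all parts are zero. -/
def IsBullet {n r : ℕ} (l : WComp n r) : Prop :=
  ∀ i j : Fin n, i < j → l.1 i = 0 → l.1 j = 0

/-- `Λ•(n, r)`. -/
abbrev BulletComp (n r : ℕ) : Type := {l : WComp n r // IsBullet l}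

/-! ### The Hecke algebra of type `A` -/

/-- Defining relations of the Hecke algebra `H_r` with parameter `q`; the generator with index
`i : Fin (r - 1)` belongs to the transposition of the (0-based) letters `i` and `i + 1`. -/
inductive HeckeRel (R : Type) [CommRing R] (q : R) (r : ℕ) :
    FreeAlgebra R (Fin (r - 1)) → FreeAlgebra R (Fin (r - 1)) → Prop
  | quadratic (i : Fin (r - 1)) :
      HeckeRel R q r (FreeAlgebra.ι R i * FreeAlgebra.ι R i)
        ((q - 1) • FreeAlgebra.ι R i + algebraMap R _ q)
  | comm (i j : Fin (r - 1)) (h : (i : ℕ) + 1 < j) :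
      HeckeRel R q r (FreeAlgebra.ι R i * FreeAlgebra.ι R j)
        (FreeAlgebra.ι R j * FreeAlgebra.ι R i)
  | braid (i j : Fin (r - 1)) (h : (i : ℕ) + 1 = j) :
      HeckeRel R q r (FreeAlgebra.ι R i * FreeAlgebra.ι R j * FreeAlgebra.ι R i)
        (FreeAlgebra.ι R j * FreeAlgebra.ι R i * FreeAlgebra.ι R j)

/-- The Hecke algebra of the symmetric group on `r` letters, over `R`, with parameter `q`. -/
def Hecke (R : Type) [CommRing R] (q : R) (r : ℕ) : Type := RingQuot (HeckeRel R q r)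

instance (R : Type) [CommRing R] (q : R) (r : ℕ) : Ring (Hecke R q r) :=
  inferInstanceAs (Ring (RingQuot (HeckeRel R q r)))

instance (R : Type) [CommRing R] (q : R) (r : ℕ) : Algebra R (Hecke R q r) :=
  inferInstanceAs (Algebra R (RingQuot (HeckeRel R q r)))

/-- The quotient map from the free algebra. -/
def Hecke.mk (R : Type) [CommRing R] (q : R) (r : ℕ) :
    FreeAlgebra R (Fin (r - 1)) →ₐ[R] Hecke R q r :=
  RingQuot.mkAlgHom R (HeckeRel R q r)

/-- The generator `T_i`. -/
def heckeGen (R : Type) [CommRing R] (q : R) (r : ℕ) (i : Fin (r - 1)) : Hecke R q r :=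
  Hecke.mk R q r (FreeAlgebra.ι R i)

/-- The simple transposition `s_i`. -/
def simpleTransp (r : ℕ) (i : Fin (r - 1)) : Equiv.Perm (Fin r) :=
  Equiv.swap ⟨i, by omega⟩ ⟨i + 1, by omega⟩

/-- `l` is a reduced word of `w`: its product is `w` and no shorter word has product `w`. -/
def IsReducedWord {r : ℕ} (w : Equiv.Perm (Fin r)) (l : List (Fin (r - 1))) : Prop :=
  (l.map (simpleTransp r)).prod = w ∧
    ∀ l' : List (Fin (r - 1)), (l'.map (simpleTransp r)).prod = w → l.length ≤ l'.length

theorem exists_word {r : ℕ} (w : Equiv.Perm (Fin r)) :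
    ∃ l : List (Fin (r - 1)), (l.map (simpleTransp r)).prod = w := by
  cases r with
  | zero => exact ⟨[], Subsingleton.elim _ _⟩
  | succ m =>
    have h : w ∈ Submonoid.closure
        (Set.range fun i : Fin m => Equiv.swap i.castSucc i.succ) := by
      rw [Equiv.Perm.mclosure_swap_castSucc_succ]; trivial
    induction h using Submonoid.closure_induction with
    | mem x hx =>
      obtain ⟨i, rfl⟩ := hx
      exact ⟨[i], by simp [simpleTransp]; rfl⟩
    | one => exact ⟨[], rfl⟩
    | mul x y _ _ hx hy =>
      obtain ⟨a, rfl⟩ := hx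
      obtain ⟨b, rfl⟩ := hy
      exact ⟨a ++ b, by simp⟩

theorem exists_reducedWord {r : ℕ} (w : Equiv.Perm (Fin r)) :
    ∃ l : List (Fin (r - 1)), IsReducedWord w l := by
  classical
  have h : ∃ k, ∃ l : List (Fin (r - 1)),
      (l.map (simpleTransp r)).prod = w ∧ l.length = k := by
    obtain ⟨l, hl⟩ := exists_word w
    exact ⟨_, l, hl, rfl⟩
  obtain ⟨l, hl, hk⟩ := Nat.find_spec h
  exact ⟨l, hl, fun l' hl' => hk ▸ Nat.find_min' h ⟨l', hl', rfl⟩⟩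

/-- A chosen reduced word of `w`. -/
def reducedWord {r : ℕ} (w : Equiv.Perm (Fin r)) : List (Fin (r - 1)) :=
  (exists_reducedWord w).choose

/-- `T_w`, the product of the generators along a reduced word of `w`. -/
def heckeT (R : Type) [CommRing R] (q : R) {r : ℕ} (w : Equiv.Perm (Fin r)) : Hecke R q r :=
  ((reducedWord w).map (heckeGen R q r)).prod

/-! ### Young subgroups and the `q`-Schur algebra -/

/-- The `i`-th block `{λ_1 + ⋯ + λ_{i-1} + 1, …, λ_1 + ⋯ + λ_i}` of `{1, …, r}`, with letters
shifted to start from `0`. -/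
def block {n r : ℕ} (l : WComp n r) (i : Fin n) : Finset (Fin r) :=
  Finset.univ.filter fun x =>
    ∑ k ∈ Finset.Iio i, l.1 k ≤ (x : ℕ) ∧ (x : ℕ) < ∑ k ∈ Finset.Iic i, l.1 k

/-- The Young subgroup of `l`, as a finite set of permutations: those preserving every block. -/
def young {n r : ℕ} (l : WComp n r) : Finset (Equiv.Perm (Fin r)) :=
  Finset.univ.filter fun w => ∀ i, ∀ x ∈ block l i, w x ∈ block l i

/-- `x_λ`, the sum of `T_w` over the Young subgroup of `λ`. -/
def xElt (R : Type) [CommRing R] (q : R) {n r : ℕ} (l : WComp n r) : Hecke R q r :=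
  ∑ w ∈ young l, heckeT R q w

/-- The right ideal `x_λ H_r`. -/
abbrev xIdeal (R : Type) [CommRing R] (q : R) {n r : ℕ} (l : WComp n r) :
    Submodule (Hecke R q r)ᵐᵒᵖ (Hecke R q r) :=
  Submodule.span (Hecke R q r)ᵐᵒᵖ {xElt R q l}

/-- `x_λ` as an element of `x_λ H_r`. -/
def xGen (R : Type) [CommRing R] (q : R) {n r : ℕ} (l : WComp n r) : xIdeal R q l :=
  ⟨xElt R q l, Submodule.mem_span_singleton_self _⟩

/-- The `q`-Schur algebra: endomorphisms of the right `H_r`-module `⨁_λ x_λ H_r`. -/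
abbrev QSchur (R : Type) [CommRing R] (q : R) (n r : ℕ) : Type :=
  Module.End (Hecke R q r)ᵐᵒᵖ (⨁ l : WComp n r, xIdeal R q l)

instance (R : Type) [CommRing R] (q : R) (n r : ℕ) : Ring (QSchur R q n r) :=
  (@Module.End.instRing (Hecke R q r)ᵐᵒᵖ (⨁ l : WComp n r, xIdeal R q l) _ _ _ :)

/-! ### The `0`-Schur algebra -/

/-- `S_q(n, r)` over `ℤ[q]`. -/
abbrev GenericSchur (n r : ℕ) : Type := QSchur ℤ[X] (Polynomial.X : ℤ[X]) n r

/-- `S_0(n, r) = ℤ[q]/(q) ⊗ S_q(n, r)`. -/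
def ZSchur (n r : ℕ) : Type :=
  (ℤ[X] ⧸ Ideal.span {(Polynomial.X : ℤ[X])}) ⊗[ℤ[X]] GenericSchur n r

instance (n r : ℕ) : Ring (ZSchur n r) :=
  inferInstanceAs
    (Ring ((ℤ[X] ⧸ Ideal.span {(Polynomial.X : ℤ[X])}) ⊗[ℤ[X]] GenericSchur n r))

/-- The specialisation map `S_q(n, r) → S_0(n, r)`. -/
def ZSchur.of {n r : ℕ} (φ : GenericSchur n r) : ZSchur n r :=
  (1 : ℤ[X] ⧸ Ideal.span {(Polynomial.X : ℤ[X])}) ⊗ₜ[ℤ[X]] φ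

/-- The `ℂ`-algebra `𝐒₀(n, r) = ℂ ⊗ S_0(n, r)`. -/
abbrev CSchur (n r : ℕ) : Type := ℂ ⊗[ℤ] ZSchur n r

/-! ### The standard basis -/

/-- `M_n(r)`: the `n × n` matrices of natural numbers with sum of entries `r`. -/
abbrev Mat (n r : ℕ) : Type := {A : Matrix (Fin n) (Fin n) ℕ // ∑ i, ∑ j, A i j = r}

/-- The row sum vector. -/
def ro {n r : ℕ} (A : Mat n r) : WComp n r := ⟨fun i => ∑ j, A.1 i j, A.2⟩

/-- The column sum vector. -/
def co {n r : ℕ} (A : Mat n r) : WComp n r :=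
  ⟨fun j => ∑ i, A.1 i j, by rw [Finset.sum_comm]; exact A.2⟩

/-- The matrix `|R_i^λ ∩ w R_j^μ|` which classifies the double coset `𝔖_λ w 𝔖_μ`. -/
def relMatrix {n r : ℕ} (l m : WComp n r) (w : Equiv.Perm (Fin r)) :
    Matrix (Fin n) (Fin n) ℕ :=
  Matrix.of fun i j => (block l i ∩ (block m j).image w).card

/-- The sum of `T_w` over the double coset `𝔖_{ro A} w 𝔖_{co A}` with matrix `A`. -/
def dcSum (R : Type) [CommRing R] (q : R) {n r : ℕ} (A : Mat n r) : Hecke R q r :=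
  ∑ w ∈ Finset.univ.filter (fun w => relMatrix (ro A) (co A) w = A.1), heckeT R q w

/-- `φ` is the Dipper–James element of `A`: the endomorphism with
`φ (x_ν h) = δ_{ν, co A} (∑_{w ∈ D_A} T_w) h`, of values in the summand `x_{ro A} H_r`, where `D_A`
is the double coset with matrix `A`. -/
def IsDJ (R : Type) [CommRing R] (q : R) {n r : ℕ} (A : Mat n r) (φ : QSchur R q n r) : Prop :=
  ∀ ν κ : WComp n r,
    ((φ (DirectSum.of (fun l : WComp n r => xIdeal R q l) ν (xGen R q ν)) κ : xIdeal R q κ) :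
      Hecke R q r) = if ν = co A ∧ κ = ro A then dcSum R q A else 0

theorem IsDJ.unique {R : Type} [CommRing R] {q : R} {n r : ℕ} {A : Mat n r}
    {φ ψ : QSchur R q n r} (h : IsDJ R q A φ) (h' : IsDJ R q A ψ) : φ = ψ := by
  refine DirectSum.linearMap_ext _ fun ν => ?_
  ext ⟨y, hy⟩ : 1
  obtain ⟨a, rfl⟩ := Submodule.mem_span_singleton.1 hy
  have e : (⟨a • xElt R q ν, hy⟩ : xIdeal R q ν) = a • xGen R q ν := rfl
  rw [e, map_smul, map_smul]
  congr 1
  refine DFinsupp.ext fun κ => Subtype.ext ?_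
  exact (h ν κ).trans (h' ν κ).symm

open Classical in
/-- The Dipper–James basis element of `A`: the unique endomorphism with `IsDJ`. -/
def djElt (R : Type) [CommRing R] (q : R) {n r : ℕ} (A : Mat n r) : QSchur R q n r :=
  if h : ∃ φ, IsDJ R q A φ then h.choose else 0

/-- `C ≼ A`: the `GL(V)`-orbit of pairs of `n`-step flags labelled by `C` lies in the closure of
the orbit labelled by `A`. The sum of the entries in the upper left `i × j` corner is the dimension
of the intersection of the `i`-th step of the first flag and the `j`-th step of the second. -/
def OrbitLE {n r : ℕ} (C A : Mat n r) : Prop :=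
  ro C = ro A ∧ co C = co A ∧ ∀ i j : Fin n,
    ∑ k ∈ Finset.Iic i, ∑ l ∈ Finset.Iic j, A.1 k l ≤
      ∑ k ∈ Finset.Iic i, ∑ l ∈ Finset.Iic j, C.1 k l

theorem finite_mat (n r : ℕ) : Finite (Mat n r) := by
  refine Finite.of_injective
    (fun (A : Mat n r) (i j : Fin n) => (⟨A.1 i j, ?_⟩ : Fin (r + 1))) ?_
  · have h1 : A.1 i j ≤ ∑ j', A.1 i j' :=
      Finset.single_le_sum (f := fun j' => A.1 i j') (fun _ _ => Nat.zero_le _)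
        (Finset.mem_univ j)
    have h2 : ∑ j', A.1 i j' ≤ ∑ i', ∑ j', A.1 i' j' :=
      Finset.single_le_sum (f := fun i' => ∑ j', A.1 i' j') (fun _ _ => Nat.zero_le _)
        (Finset.mem_univ i)
    have h3 := A.2
    omega
  · intro A B h
    apply Subtype.ext
    ext i j
    exact congrArg Fin.val (congrFun (congrFun h i) j)

instance (n r : ℕ) : Fintype (Mat n r) :=
  haveI := finite_mat n r
  Fintype.ofFinite _

open Classical in
/-- The standard basis element `e_A` of `𝐒₀(n, r)`: the sum, at `q = 0`, of the Dipper–James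
elements of all orbits in the closure of the orbit of `A`. -/
def e {n r : ℕ} (A : Mat n r) : CSchur n r :=
  ∑ C ∈ Finset.univ.filter (fun C : Mat n r => OrbitLE C A),
    (1 : ℂ) ⊗ₜ[ℤ] ZSchur.of (djElt ℤ[X] Polynomial.X C)

open Classical in
/-- `e_A` for an arbitrary matrix, `0` when the sum of entries is not `r`. -/
def eMat {n : ℕ} (r : ℕ) (A : Matrix (Fin n) (Fin n) ℕ) : CSchur n r :=
  if h : ∑ i, ∑ j, A i j = r then e ⟨A, h⟩ else 0

/-- `k_λ = e_{diag λ}`. -/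
def kElt {n r : ℕ} (l : WComp n r) : CSchur n r := eMat r (Matrix.diagonal l.1)

/-- `e_{i,λ}`, for consecutive `i`, `i' = i + 1`; zero if `λ_{i+1} = 0`. -/
def eiElt {n r : ℕ} (i i' : Fin n) (l : WComp n r) : CSchur n r :=
  if 0 < l.1 i' then
    eMat r (Matrix.diagonal l.1 - Matrix.single i' i' 1 + Matrix.single i i' 1)
  else 0

/-- `f_{i,λ}`, for consecutive `i`, `i' = i + 1`; zero if `λ_i = 0`. -/
def fiElt {n r : ℕ} (i i' : Fin n) (l : WComp n r) : CSchur n r :=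
  if 0 < l.1 i then
    eMat r (Matrix.diagonal l.1 - Matrix.single i i 1 + Matrix.single i' i 1)
  else 0

/-- The generators `e_i`, `f_i` (`1 ≤ i ≤ n - 1`) and `k_μ` (`μ ∈ Λ(n, r)`) of `𝐒₀(n, r)`. -/
def generators (n r : ℕ) : Set (CSchur n r) :=
  {b | (∃ i i' : Fin n, (i : ℕ) + 1 = i' ∧ b = ∑ l : WComp n r, eiElt i i' l) ∨
    (∃ i i' : Fin n, (i : ℕ) + 1 = i' ∧ b = ∑ l : WComp n r, fiElt i i' l) ∨
    ∃ m : WComp n r, b = kElt m}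

/-! ### The projective indecomposable modules `P_λ` -/

/-- The strong composition `a` of `n` is maximal with respect to `l`: every block of `l` cut out by
`a` is `(0)` or has nonzero first and last entries. -/
def IsMaximal {n r : ℕ} (l : WComp n r) (a : Composition n) : Prop :=
  ∀ v : Fin a.length,
    let first := a.embedding v ⟨0, a.blocks_pos' v v.2⟩
    let last := a.embedding v
      ⟨a.blocksFun v - 1, Nat.sub_lt (a.blocks_pos' v v.2) Nat.one_pos⟩
    (a.blocksFun v = 1 ∧ l.1 first = 0) ∨ (l.1 first ≠ 0 ∧ l.1 last ≠ 0)

/-- Every `2 × 2` submatrix has a zero on its diagonal. -/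
def IsOpenMatrix {n : ℕ} (A : Matrix (Fin n) (Fin n) ℕ) : Prop :=
  ∀ i i' j j' : Fin n, i < i' → j < j' → A i j = 0 ∨ A i' j' = 0

/-- `A(α; v)`: the columns of `A` in the `v`-th block of `α`, all other columns being zero. -/
def colPart {n : ℕ} (A : Matrix (Fin n) (Fin n) ℕ) (a : Composition n) (v : Fin a.length) :
    Matrix (Fin n) (Fin n) ℕ :=
  Matrix.of fun i j => if a.index j = v then A i j else 0

/-- `B^{λ,α}`: the `e_A` with `co A = λ` and `A` open on columns with respect to `α`. -/
def openSet {n r : ℕ} (l : WComp n r) (a : Composition n) : Set (CSchur n r) :=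
  {x | ∃ A : Mat n r, co A = l ∧ (∀ v, IsOpenMatrix (colPart A.1 a v)) ∧ x = e A}

/-- `B^λ`. -/
def BSet {n r : ℕ} (l : WComp n r) : Set (CSchur n r) :=
  {x | ∃ A : Mat n r, co A = l ∧ x = e A} \
    ⋃ a ∈ {a : Composition n | IsMaximal l a ∧ a ≠ Composition.ones n}, openSet l a

/-- The `ℂ`-vector space with basis `B^λ`. -/
abbrev PSpace {n r : ℕ} (l : WComp n r) : Type := BSet l →₀ ℂ

/-- The representation `ρ` of `𝐒₀(n, r)` on the span of `B^λ` is the one defining `P_λ`: for a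
generator `b` and `e_A ∈ B^λ`, the vector `b · e_A` is the product of `b` and `e_A` in `𝐒₀(n, r)` if
this product is in `B^λ`, and `0` otherwise. -/
def IsPAction {n r : ℕ} (l : WComp n r) (ρ : CSchur n r →ₐ[ℂ] Module.End ℂ (PSpace l)) : Prop :=
  ∀ b ∈ generators n r, ∀ x : BSet l,
    (∀ h : b * (x : CSchur n r) ∈ BSet l,
      ρ b (Finsupp.single x 1) = Finsupp.single ⟨b * (x : CSchur n r), h⟩ 1) ∧
    (b * (x : CSchur n r) ∉ BSet l → ρ b (Finsupp.single x 1) = 0)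

/-- The span of `B^λ` as a left `𝐒₀(n, r)`-module through `ρ`. -/
def PMod {n r : ℕ} (l : WComp n r) (_ρ : CSchur n r →ₐ[ℂ] Module.End ℂ (PSpace l)) : Type :=
  PSpace l

section PMod

variable {n r : ℕ} (l : WComp n r) (ρ : CSchur n r →ₐ[ℂ] Module.End ℂ (PSpace l))

instance : AddCommGroup (PMod l ρ) := inferInstanceAs (AddCommGroup (PSpace l))

instance : Module ℂ (PMod l ρ) := inferInstanceAs (Module ℂ (PSpace l))


/-- The action `a • m = ρ a m`. -/
instance : Module (CSchur n r) (PMod l ρ) :=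
  Module.compHom (PSpace l) ρ.toRingHom

instance : IsScalarTower ℂ (CSchur n r) (PMod l ρ) where
  smul_assoc c a m := by
    change ρ (c • a) m = c • ρ a m
    rw [map_smul]; rfl

/-- The basis vector of `P_λ` belonging to `x ∈ B^λ`. -/
def pBasis (x : BSet l) : PMod l ρ := (Finsupp.single x 1 : PSpace l)

end PMod

/-! ### Column block diagonal matrices -/

/-- Column block diagonal: if `a_{ij} > 0` then `a_{i'j'} = 0` for all `i' ≤ i` and `j' > j`. -/
def IsColumnBlockDiagonal {n : ℕ} (A : Matrix (Fin n) (Fin n) ℕ) : Prop :=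
  ∀ i j : Fin n, 0 < A i j → ∀ i' j' : Fin n, i' ≤ i → j < j' → A i' j' = 0

/-- The set of column block diagonal matrices with column sum vector `λ`. -/
abbrev CB {n r : ℕ} (l : WComp n r) : Type :=
  {A : Mat n r // IsColumnBlockDiagonal A.1 ∧ co A = l}

/-- `β^λ`. -/
def betaSet {n r : ℕ} (l : WComp n r) : Set (CSchur n r) :=
  Set.range fun A : CB l => e A.1

/-- The `ℂ`-span of `B^λ \ β^λ` in `P_λ`. -/
def NSpan {n r : ℕ} (l : WComp n r) (ρ : CSchur n r →ₐ[ℂ] Module.End ℂ (PSpace l)) :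
    Submodule ℂ (PMod l ρ) :=
  Submodule.span ℂ (pBasis l ρ '' {x : BSet l | (x : CSchur n r) ∉ betaSet l})

end ZeroSchur

end

/-! At q = 0 the product of a generator with a standard basis element is again a standard basis
element or zero, so that the module theory becomes combinatorics of matrices.

The algebra is realised by matrices over the 0-Hecke algebra, indexed by pairs of compositions
(`evC`, `evC_mul`); this works because x_κ is idempotent at q = 0 (`xElt_mul_xElt`). An element of
x_κ H is determined by its coefficients at the shortest representatives of the cosets of the Young
subgroup (`xElt_mul_eq`), and the order `OrbitLE` is a comparison of corner sums with counts of
letters. Comparing these counts (`Up.orbitLE_iff`, `Down.orbitLE_iff`) shows that e_i moves a unit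
of the last nonzero entry of row i+1 up to row i, and f_i a unit of the first nonzero entry of row i
down to row i+1 (`Up.eiGen_mul`, `Down.fiGen_mul`). Such moves produce every matrix from a diagonal
one (`move_induction`), so the e_i, f_i and k_λ generate the algebra.

A set of matrices closed under moves spans a left ideal (`MoveClosed.mul_mem`). The matrices outside
B^λ form such a set, and so do those outside CB(λ). The quotient of the regular module by the first
span is P_λ, and N_λ is the image of the second. Thus S_λ is cyclic on the class of the diagonal
matrix D_λ, and the annihilator of this class is spanned by the e_A with A outside CB(λ).

Let λ be in Λ•. A column block diagonal matrix is determined by its row and column sums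
(`CB_unique`), so the k_μ isolate single basis vectors of S_λ. Its units lie on or below the
diagonal and can be raised to it (`exists_mul_e_eq_diagM`), which recovers the generator: S_λ is
simple. The weights of S_λ have partial sums at most those of λ, so isomorphic modules have the same
λ.

Conversely, let M be simple and λ a weight of M of maximal height. Every e_i kills the λ-weight
space, and f_i e_i k_λ = k_λ whenever λ_i = 0 < λ_{i+1}; hence λ is in Λ•. The main point is
`e_smul_eq_zero_of_ne_diagM`: if C ≠ D_λ has row and column sums λ, then e_C kills M. Each such C
lies above the matrix of some f_i e_i k_λ, and left multiplication is monotone on labels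
(`exists_mul_map`); for a maximal counterexample B this yields e_B a e_B M = 0 for all a, against
simplicity. It follows that e_A kills a λ-weight vector v for all A outside CB(λ), so the
annihilator of the generator of S_λ kills v, and M is isomorphic to S_λ. -/

noncomputable section

namespace ZeroSchur

/-! ### Inversions of permutations -/

section Perm

variable {r : ℕ}

/-- The smaller letter moved by the `i`-th simple transposition. -/
def lo (i : Fin (r - 1)) : Fin r := ⟨i, by omega⟩

/-- The larger letter moved by the `i`-th simple transposition. -/
def hi (i : Fin (r - 1)) : Fin r := ⟨i + 1, by omega⟩

theorem simpleTransp_eq (i : Fin (r - 1)) : simpleTransp r i = Equiv.swap (lo i) (hi i) := rfl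

@[simp] theorem val_lo (i : Fin (r - 1)) : (lo i : ℕ) = i := rfl

@[simp] theorem val_hi (i : Fin (r - 1)) : (hi i : ℕ) = i + 1 := rfl

theorem lo_lt_hi (i : Fin (r - 1)) : lo i < hi i := Fin.lt_def.2 (by simp)

@[simp] theorem simpleTransp_lo (i : Fin (r - 1)) : simpleTransp r i (lo i) = hi i :=
  Equiv.swap_apply_left _ _

@[simp] theorem simpleTransp_hi (i : Fin (r - 1)) : simpleTransp r i (hi i) = lo i :=
  Equiv.swap_apply_right _ _

@[simp] theorem simpleTransp_inv (i : Fin (r - 1)) :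
    (simpleTransp r i)⁻¹ = simpleTransp r i := Equiv.swap_inv _ _

@[simp] theorem simpleTransp_mul_self (i : Fin (r - 1)) :
    simpleTransp r i * simpleTransp r i = 1 := Equiv.swap_mul_self _ _

@[simp] theorem simpleTransp_mul_cancel_left (i : Fin (r - 1)) (w : Equiv.Perm (Fin r)) :
    simpleTransp r i * (simpleTransp r i * w) = w := by
  rw [← mul_assoc, simpleTransp_mul_self, one_mul]

@[simp] theorem simpleTransp_mul_cancel_right (i : Fin (r - 1)) (w : Equiv.Perm (Fin r)) :
    w * simpleTransp r i * simpleTransp r i = w := by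
  rw [mul_assoc, simpleTransp_mul_self, mul_one]

@[simp] theorem simpleTransp_apply_self (i : Fin (r - 1)) (x : Fin r) :
    simpleTransp r i (simpleTransp r i x) = x := Equiv.swap_apply_self _ _ _

theorem simpleTransp_val (i : Fin (r - 1)) (x : Fin r) :
    (simpleTransp r i x : ℕ) =
      if (x : ℕ) = i then (i : ℕ) + 1 else if (x : ℕ) = i + 1 then (i : ℕ) else x := by
  rw [simpleTransp_eq, Equiv.swap_apply_def]
  simp only [Fin.ext_iff, val_lo, val_hi]
  split_ifs <;> simp

theorem simpleTransp_lt {i : Fin (r - 1)} {a b : Fin r} (h : a < b)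
    (hne : ¬ (a = lo i ∧ b = hi i)) : simpleTransp r i a < simpleTransp r i b := by
  rw [Fin.lt_def] at h ⊢
  simp only [Fin.ext_iff, val_lo, val_hi] at hne
  rw [simpleTransp_val, simpleTransp_val]
  split_ifs <;> omega

theorem simpleTransp_comm {i j : Fin (r - 1)} (h : (i : ℕ) + 1 < j) :
    simpleTransp r i * simpleTransp r j = simpleTransp r j * simpleTransp r i := by
  ext x
  simp only [Equiv.Perm.mul_apply, simpleTransp_val]
  split_ifs <;> omega

theorem simpleTransp_braid {i j : Fin (r - 1)} (h : (i : ℕ) + 1 = j) :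
    simpleTransp r i * (simpleTransp r j * simpleTransp r i) =
      simpleTransp r j * (simpleTransp r i * simpleTransp r j) := by
  ext x
  simp only [Equiv.Perm.mul_apply, simpleTransp_val, ← h]
  have e1 : (i : ℕ) + 1 + 1 ≠ i := by omega
  by_cases h1 : (x : ℕ) = i
  · simp [h1, e1, e1.symm]
  by_cases h2 : (x : ℕ) = i + 1
  · simp [h2, e1, e1.symm]
  by_cases h3 : (x : ℕ) = i + 1 + 1
  · simp [h3, e1, e1.symm]
  simp [h1, h2, h3]

/-- `i` is a left ascent of `w`. -/
def Asc (w : Equiv.Perm (Fin r)) (i : Fin (r - 1)) : Prop := w⁻¹ (lo i) < w⁻¹ (hi i)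

instance (w : Equiv.Perm (Fin r)) (i : Fin (r - 1)) : Decidable (Asc w i) :=
  inferInstanceAs (Decidable (_ < _))

theorem inv_simpleTransp_mul_apply (w : Equiv.Perm (Fin r)) (i : Fin (r - 1)) (x : Fin r) :
    (simpleTransp r i * w)⁻¹ x = w⁻¹ (simpleTransp r i x) := by
  rw [mul_inv_rev, simpleTransp_inv, Equiv.Perm.mul_apply]

theorem not_asc_iff {w : Equiv.Perm (Fin r)} {i : Fin (r - 1)} :
    ¬ Asc w i ↔ w⁻¹ (hi i) < w⁻¹ (lo i) := by
  rw [Asc, not_lt, le_iff_lt_or_eq, or_iff_left]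
  intro h
  exact (lo_lt_hi i).ne' (w⁻¹.injective h)

theorem asc_simpleTransp_mul {w : Equiv.Perm (Fin r)} {i : Fin (r - 1)} :
    Asc (simpleTransp r i * w) i ↔ ¬ Asc w i := by
  rw [not_asc_iff, Asc, inv_simpleTransp_mul_apply, inv_simpleTransp_mul_apply]
  simp

/-- The inversions of `w⁻¹`. -/
def invSet (w : Equiv.Perm (Fin r)) : Finset (Fin r × Fin r) :=
  Finset.univ.filter fun p => p.1 < p.2 ∧ w⁻¹ p.2 < w⁻¹ p.1

/-- The number of inversions. -/
def inv (w : Equiv.Perm (Fin r)) : ℕ := (invSet w).card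

/-- Inversions are recorded as pairs of values, so left multiplication by s_i carries them along by
applying s_i to both letters. Only the pair of letters exchanged by s_i changes its order, and it
becomes the one new inversion. -/
theorem inv_simpleTransp_mul_of_asc {w : Equiv.Perm (Fin r)} {i : Fin (r - 1)} (h : Asc w i) :
    inv (simpleTransp r i * w) = inv w + 1 := by
  have hset : invSet (simpleTransp r i * w) = insert (lo i, hi i)
      ((invSet w).map ((simpleTransp r i).prodCongr (simpleTransp r i)).toEmbedding) := by
    ext ⟨a, b⟩
    simp only [invSet, Finset.mem_filter, Finset.mem_univ, true_and, Finset.mem_insert,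
      Finset.mem_map_equiv, Prod.mk.injEq, inv_simpleTransp_mul_apply]
    have hs : (((simpleTransp r i).prodCongr (simpleTransp r i)).symm (a, b)) =
        (simpleTransp r i a, simpleTransp r i b) := rfl
    rw [hs]
    by_cases hab : a = lo i ∧ b = hi i
    · obtain ⟨rfl, rfl⟩ := hab
      simpa only [simpleTransp_lo, simpleTransp_hi, lo_lt_hi, true_and, true_or, iff_true, Asc] using h
    · constructor
      · rintro ⟨h1, h2⟩
        exact Or.inr ⟨simpleTransp_lt h1 hab, h2⟩
      · rintro (h1 | ⟨h1, h2⟩)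
        · exact absurd h1 hab
        · refine ⟨?_, h2⟩
          by_cases hab' : simpleTransp r i a = lo i ∧ simpleTransp r i b = hi i
          · rw [hab'.1, hab'.2] at h2
            exact absurd h2 (lt_asymm h)
          · simpa using simpleTransp_lt h1 hab'
  rw [inv, hset, Finset.card_insert_of_notMem, Finset.card_map, inv]
  simp only [invSet, Finset.mem_map_equiv, Finset.mem_filter, not_and]
  intro _ h1
  change simpleTransp r i (lo i) < simpleTransp r i (hi i) at h1
  simp only [simpleTransp_lo, simpleTransp_hi] at h1
  exact absurd h1 (lt_asymm (lo_lt_hi i))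

theorem inv_of_not_asc {w : Equiv.Perm (Fin r)} {i : Fin (r - 1)} (h : ¬ Asc w i) :
    inv w = inv (simpleTransp r i * w) + 1 := by
  have := inv_simpleTransp_mul_of_asc (asc_simpleTransp_mul.2 h)
  rwa [simpleTransp_mul_cancel_left] at this

theorem strictMono_of_simple {α : Type*} [Preorder α] {f : Fin r → α}
    (h : ∀ i : Fin (r - 1), f (lo i) < f (hi i)) : StrictMono f := by
  cases r with
  | zero => exact fun a => a.elim0
  | succ m => exact Fin.strictMono_iff_lt_succ.2 fun i => h i

theorem perm_eq_one_of_strictMono {w : Equiv.Perm (Fin r)} (h : StrictMono w) : w = 1 := by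
  have := Subsingleton.elim
    (StrictMono.orderIsoOfSurjective w h w.surjective) (OrderIso.refl (Fin r))
  ext x
  exact congrArg Fin.val (DFunLike.congr_fun this x)

theorem exists_not_asc {w : Equiv.Perm (Fin r)} (h : w ≠ 1) : ∃ i, ¬ Asc w i := by
  by_contra! hc
  exact h (inv_eq_one.1 (perm_eq_one_of_strictMono (strictMono_of_simple hc)))

@[simp] theorem inv_one : inv (1 : Equiv.Perm (Fin r)) = 0 := by
  rw [inv, Finset.card_eq_zero, invSet, Finset.filter_eq_empty_iff]
  rintro p - ⟨h1, h2⟩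
  simp only [_root_.inv_one, Equiv.Perm.one_apply] at h2
  exact lt_asymm h1 h2

/-- The permutation which is the product of a word in the simple transpositions. -/
def wordProd (l : List (Fin (r - 1))) : Equiv.Perm (Fin r) := (l.map (simpleTransp r)).prod

@[simp] theorem wordProd_nil : wordProd ([] : List (Fin (r - 1))) = 1 := rfl

@[simp] theorem wordProd_cons (i : Fin (r - 1)) (l : List (Fin (r - 1))) :
    wordProd (i :: l) = simpleTransp r i * wordProd l := by simp [wordProd]

theorem inv_wordProd_le (l : List (Fin (r - 1))) : inv (wordProd l) ≤ l.length := by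
  induction l with
  | nil => simp
  | cons i l ih =>
    rw [wordProd_cons, List.length_cons]
    by_cases h : Asc (wordProd l) i
    · rw [inv_simpleTransp_mul_of_asc h]; omega
    · have := inv_of_not_asc h; omega

theorem exists_word_length_eq_inv (w : Equiv.Perm (Fin r)) :
    ∃ l, wordProd l = w ∧ l.length = inv w := by
  induction hk : inv w generalizing w with
  | zero =>
    refine ⟨[], ?_, rfl⟩
    by_contra hne
    obtain ⟨i, hi⟩ := exists_not_asc (Ne.symm hne)
    have := inv_of_not_asc hi
    omega
  | succ k ih =>
    have hne : w ≠ 1 := by rintro rfl; simp at hk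
    obtain ⟨i, hi⟩ := exists_not_asc hne
    obtain ⟨l, hl, hlen⟩ := ih (simpleTransp r i * w) (by have := inv_of_not_asc hi; omega)
    exact ⟨i :: l, by simp [hl], by simp [hlen]⟩

theorem isReducedWord_iff {w : Equiv.Perm (Fin r)} {l : List (Fin (r - 1))} :
    IsReducedWord w l ↔ wordProd l = w ∧ l.length = inv w := by
  constructor
  · rintro ⟨h1, h2⟩
    obtain ⟨l', hl', hlen⟩ := exists_word_length_eq_inv w
    have h3 := h2 l' hl'
    have h4 := inv_wordProd_le l
    rw [show wordProd l = w from h1] at h4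
    exact ⟨h1, by omega⟩
  · rintro ⟨h1, h2⟩
    refine ⟨h1, fun l' hl' => ?_⟩
    rw [h2, ← show wordProd l' = w from hl']
    exact inv_wordProd_le l'

theorem not_asc_of_reduced_cons {i : Fin (r - 1)} {l : List (Fin (r - 1))}
    (h : (i :: l).length = inv (wordProd (i :: l))) :
    ¬ Asc (wordProd (i :: l)) i ∧ l.length = inv (wordProd l) := by
  rw [List.length_cons, wordProd_cons] at h
  have h1 := inv_wordProd_le l
  have h2 : Asc (wordProd l) i := by
    by_contra h3
    have := inv_of_not_asc h3
    omega
  rw [inv_simpleTransp_mul_of_asc h2] at h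
  refine ⟨?_, by omega⟩
  rw [wordProd_cons, asc_simpleTransp_mul, not_not]
  exact h2

/-- Descents to two commuting simple transpositions. -/
theorem not_asc_simpleTransp_mul_of_far {w : Equiv.Perm (Fin r)} {i j : Fin (r - 1)}
    (h : (i : ℕ) + 1 < j) : Asc (simpleTransp r i * w) j ↔ Asc w j := by
  have h1 : simpleTransp r i (lo j) = lo j := by
    apply Fin.ext
    rw [simpleTransp_val, val_lo, if_neg (by omega), if_neg (by omega)]
  have h2 : simpleTransp r i (hi j) = hi j := by
    apply Fin.ext
    rw [simpleTransp_val, val_hi, if_neg (by omega), if_neg (by omega)]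
  rw [Asc, Asc, inv_simpleTransp_mul_apply, inv_simpleTransp_mul_apply, h1, h2]

theorem hi_eq_lo {i j : Fin (r - 1)} (h : (i : ℕ) + 1 = j) : hi i = lo j := Fin.ext h

theorem simpleTransp_hi_of_succ {i j : Fin (r - 1)} (h : (i : ℕ) + 1 = j) :
    simpleTransp r i (hi j) = hi j := by
  apply Fin.ext
  rw [simpleTransp_val, val_hi, if_neg (by omega), if_neg (by omega)]

theorem simpleTransp_lo_of_succ {i j : Fin (r - 1)} (h : (i : ℕ) + 1 = j) :
    simpleTransp r j (lo i) = lo i := by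
  apply Fin.ext
  rw [simpleTransp_val, val_lo, if_neg (by omega), if_neg (by omega)]

end Perm

/-! ### The standard basis of the Hecke algebra -/

section Hecke

variable {R : Type} [CommRing R] {q : R} {r : ℕ}

theorem heckeGen_mul_self (i : Fin (r - 1)) :
    heckeGen R q r i * heckeGen R q r i =
      (q - 1) • heckeGen R q r i + algebraMap R (Hecke R q r) q := by
  have := RingQuot.mkAlgHom_rel R (HeckeRel.quadratic (R := R) (q := q) i)
  rw [map_mul, map_add, map_smul, AlgHom.commutes] at this
  exact this

theorem heckeGen_comm {i j : Fin (r - 1)} (h : (i : ℕ) + 1 < j) :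
    heckeGen R q r i * heckeGen R q r j = heckeGen R q r j * heckeGen R q r i := by
  have := RingQuot.mkAlgHom_rel R (HeckeRel.comm (R := R) (q := q) i j h)
  rw [map_mul, map_mul] at this
  exact this

theorem heckeGen_braid {i j : Fin (r - 1)} (h : (i : ℕ) + 1 = j) :
    heckeGen R q r i * heckeGen R q r j * heckeGen R q r i =
      heckeGen R q r j * heckeGen R q r i * heckeGen R q r j := by
  have := RingQuot.mkAlgHom_rel R (HeckeRel.braid (R := R) (q := q) i j h)
  rw [map_mul, map_mul, map_mul, map_mul] at this
  exact this

variable (R q) in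
/-- The product of the generators along a word. -/
def heckeWord (l : List (Fin (r - 1))) : Hecke R q r := (l.map (heckeGen R q r)).prod

@[simp] theorem heckeWord_nil : heckeWord R q ([] : List (Fin (r - 1))) = 1 := rfl

@[simp] theorem heckeWord_cons (i : Fin (r - 1)) (l : List (Fin (r - 1))) :
    heckeWord R q (i :: l) = heckeGen R q r i * heckeWord R q l := by simp [heckeWord]

/-- Matsumoto's theorem: the product of the generators along a reduced word depends only on the
permutation. -/
theorem heckeWord_eq {l l' : List (Fin (r - 1))} (h : wordProd l = wordProd l')
    (hl : l.length = inv (wordProd l)) (hl' : l'.length = inv (wordProd l')) :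
    heckeWord R q l = heckeWord R q l' := by
  obtain ⟨k, hk⟩ : ∃ k, k = l.length := ⟨_, rfl⟩
  induction k using Nat.strong_induction_on generalizing l l' with
  | _ k ih =>
  -- the case of two different first letters, in increasing order
  have key : ∀ (i j : Fin (r - 1)) (a b : List (Fin (r - 1))), (i : ℕ) < j →
      (i :: a).length = k → wordProd (i :: a) = wordProd (j :: b) →
      (i :: a).length = inv (wordProd (i :: a)) → (j :: b).length = inv (wordProd (j :: b)) →
      heckeWord R q (i :: a) = heckeWord R q (j :: b) := by
    intro i j a b hij hka hab ha hb
    obtain ⟨hai, haa⟩ := not_asc_of_reduced_cons ha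
    obtain ⟨hbj, hbb⟩ := not_asc_of_reduced_cons hb
    rw [← hab] at hbj
    set w := wordProd (i :: a) with hw
    have hwa : wordProd a = simpleTransp r i * w := by rw [hw, wordProd_cons]; simp
    have hwb : wordProd b = simpleTransp r j * w := by rw [hab, wordProd_cons]; simp
    have hia := inv_of_not_asc hai
    have hib := inv_of_not_asc hbj
    rw [List.length_cons] at ha hka
    rw [← hwa] at hia
    rw [← hwb] at hib
    -- Both i and j are descents of w, so w has a reduced word starting with the longest element of
    -- the subgroup generated by s_i and s_j: s_i s_j c if they commute, s_i s_j s_i c otherwise.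
    -- The induction hypothesis compares either given word with such a word, and one defining
    -- relation joins the two.
    by_cases hfar : (i : ℕ) + 1 < j
    · have hd : ¬ Asc (wordProd a) j := by rwa [hwa, not_asc_simpleTransp_mul_of_far hfar]
      have hinv := inv_of_not_asc hd
      obtain ⟨c, hc, hcl⟩ := exists_word_length_eq_inv (simpleTransp r j * wordProd a)
      have hc1 : wordProd a = wordProd (j :: c) := by rw [wordProd_cons, hc]; simp
      have hc2 : wordProd b = wordProd (i :: c) := by
        rw [wordProd_cons, hc, hwa, hwb, ← mul_assoc, simpleTransp_comm hfar, mul_assoc]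
        simp
      have e1 := ih a.length (by omega) hc1 haa
        (by rw [← hc1, List.length_cons, hcl, hinv]) rfl
      have e2 := ih b.length (by omega) hc2 hbb
        (by rw [← hc2, List.length_cons, hcl]; omega) rfl
      rw [heckeWord_cons, heckeWord_cons, e1, e2, heckeWord_cons, heckeWord_cons, ← mul_assoc,
        ← mul_assoc, heckeGen_comm hfar]
    · have hadj : (i : ℕ) + 1 = j := by omega
      rw [not_asc_iff] at hai hbj
      rw [hi_eq_lo hadj] at hai
      have hd : ¬ Asc (wordProd a) j := by
        rw [not_asc_iff, hwa, inv_simpleTransp_mul_apply, inv_simpleTransp_mul_apply,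
          simpleTransp_hi_of_succ hadj, ← hi_eq_lo hadj, simpleTransp_hi]
        exact hbj.trans hai
      have hinv := inv_of_not_asc hd
      have hd2 : ¬ Asc (simpleTransp r j * wordProd a) i := by
        rw [not_asc_iff, hwa, inv_simpleTransp_mul_apply, inv_simpleTransp_mul_apply,
          inv_simpleTransp_mul_apply, inv_simpleTransp_mul_apply, simpleTransp_lo_of_succ hadj,
          hi_eq_lo hadj, simpleTransp_lo, simpleTransp_hi_of_succ hadj, simpleTransp_lo,
          hi_eq_lo hadj]
        exact hbj
      have hinv2 := inv_of_not_asc hd2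
      obtain ⟨c, hc, hcl⟩ :=
        exists_word_length_eq_inv (simpleTransp r i * (simpleTransp r j * wordProd a))
      have hc1 : wordProd a = wordProd (j :: i :: c) := by simp [hc]
      have hc2 : wordProd b = wordProd (i :: j :: c) := by
        rw [wordProd_cons, wordProd_cons, hc, hwa, hwb]
        have hbr := simpleTransp_braid hadj
        calc simpleTransp r j * w
            = simpleTransp r i * (simpleTransp r i * (simpleTransp r j * w)) := by simp
          _ = _ := by
            congr 1
            have : simpleTransp r j * (simpleTransp r i * (simpleTransp r j *
                (simpleTransp r i * w))) = simpleTransp r i * (simpleTransp r j * w) := by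
              calc _ = simpleTransp r j * (simpleTransp r i * simpleTransp r j) *
                    (simpleTransp r i * w) := by simp only [mul_assoc]
                _ = _ := by rw [← hbr]; simp [mul_assoc]
            exact this.symm
      have e1 := ih a.length (by omega) hc1 haa
        (by rw [← hc1, List.length_cons, List.length_cons, hcl]; omega) rfl
      have e2 := ih b.length (by omega) hc2 hbb
        (by rw [← hc2, List.length_cons, List.length_cons, hcl]; omega) rfl
      rw [heckeWord_cons, heckeWord_cons, e1, e2]
      simp only [heckeWord_cons, ← mul_assoc]
      rw [heckeGen_braid hadj]
  have hlen : l.length = l'.length := by rw [hl, hl', h]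
  match l, l' with
  | [], [] => rfl
  | [], j :: b => simp at hlen
  | i :: a, [] => simp at hlen
  | i :: a, j :: b =>
    rcases lt_trichotomy (i : ℕ) j with hij | hij | hij
    · exact key i j a b hij hk.symm h hl hl'
    · obtain rfl := Fin.ext hij
      rw [heckeWord_cons, heckeWord_cons]
      congr 1
      refine ih a.length (by rw [hk]; simp) ?_ (not_asc_of_reduced_cons hl).2
        (not_asc_of_reduced_cons hl').2 rfl
      rw [wordProd_cons, wordProd_cons] at h
      exact mul_left_cancel h
    · exact (key j i b a hij (by rw [hk, hlen]) h.symm hl' hl).symm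

theorem heckeT_eq_heckeWord {w : Equiv.Perm (Fin r)} {l : List (Fin (r - 1))}
    (h : wordProd l = w) (hl : l.length = inv w) : heckeT R q w = heckeWord R q l := by
  obtain ⟨h1, h2⟩ := isReducedWord_iff.1 (exists_reducedWord w).choose_spec
  exact heckeWord_eq (h1.trans h.symm) (h2.trans (congrArg inv h1.symm)) (by rw [h, hl])

@[simp] theorem heckeT_one : heckeT R q (1 : Equiv.Perm (Fin r)) = 1 :=
  heckeT_eq_heckeWord (l := []) rfl (by simp)

theorem heckeGen_mul_heckeT_of_asc {w : Equiv.Perm (Fin r)} {i : Fin (r - 1)} (h : Asc w i) :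
    heckeGen R q r i * heckeT R q w = heckeT R q (simpleTransp r i * w) := by
  obtain ⟨l, hl, hlen⟩ := exists_word_length_eq_inv w
  rw [heckeT_eq_heckeWord hl hlen, ← heckeWord_cons]
  refine (heckeT_eq_heckeWord ?_ ?_).symm
  · rw [wordProd_cons, hl]
  · rw [inv_simpleTransp_mul_of_asc h, List.length_cons, hlen]

theorem heckeGen_mul_heckeT_of_not_asc {w : Equiv.Perm (Fin r)} {i : Fin (r - 1)}
    (h : ¬ Asc w i) : heckeGen R q r i * heckeT R q w =
      (q - 1) • heckeT R q w + q • heckeT R q (simpleTransp r i * w) := by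
  have h1 := heckeGen_mul_heckeT_of_asc (R := R) (q := q) (asc_simpleTransp_mul.2 h)
  rw [simpleTransp_mul_cancel_left] at h1
  rw [← h1, ← mul_assoc, heckeGen_mul_self, add_mul, smul_mul_assoc, ← Algebra.smul_def]

theorem heckeT_simpleTransp (i : Fin (r - 1)) :
    heckeT R q (simpleTransp r i) = heckeGen R q r i := by
  have h : Asc (1 : Equiv.Perm (Fin r)) i := by
    simpa [Asc] using lo_lt_hi i
  simpa using (heckeGen_mul_heckeT_of_asc (R := R) (q := q) h).symm

/-- Induction on elements of the Hecke algebra. -/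
theorem hecke_induction {p : Hecke R q r → Prop} (hgen : ∀ i, p (heckeGen R q r i))
    (hR : ∀ c, p (algebraMap R _ c)) (hadd : ∀ x y, p x → p y → p (x + y))
    (hmul : ∀ x y, p x → p y → p (x * y)) (x : Hecke R q r) : p x := by
  obtain ⟨y, rfl⟩ := RingQuot.mkAlgHom_surjective R (HeckeRel R q r) x
  induction y using FreeAlgebra.induction with
  | grade0 c =>
    rw [AlgHom.commutes]
    exact hR c
  | grade1 i => exact hgen i
  | mul a b ha hb => rw [map_mul]; exact hmul _ _ ha hb
  | add a b ha hb => rw [map_add]; exact hadd _ _ ha hb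

theorem span_heckeT : Submodule.span R (Set.range (heckeT R q (r := r))) = ⊤ := by
  rw [eq_top_iff]
  intro x _
  have hstab : ∀ x : Hecke R q r, ∀ y ∈ Submodule.span R (Set.range (heckeT R q (r := r))),
      x * y ∈ Submodule.span R (Set.range (heckeT R q (r := r))) := by
    intro x
    induction x using hecke_induction with
    | hgen i =>
      intro y hy
      induction hy using Submodule.span_induction with
      | mem y hy =>
        obtain ⟨w, rfl⟩ := hy
        by_cases h : Asc w i
        · rw [heckeGen_mul_heckeT_of_asc h]
          exact Submodule.subset_span ⟨_, rfl⟩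
        · rw [heckeGen_mul_heckeT_of_not_asc h]
          exact add_mem (Submodule.smul_mem _ _ (Submodule.subset_span ⟨_, rfl⟩))
            (Submodule.smul_mem _ _ (Submodule.subset_span ⟨_, rfl⟩))
      | zero => rw [mul_zero]; exact zero_mem _
      | add a b _ _ ha hb => rw [mul_add]; exact add_mem ha hb
      | smul c a _ ha => rw [mul_smul_comm]; exact Submodule.smul_mem _ _ ha
    | hR c => intro y hy; rw [← Algebra.smul_def]; exact Submodule.smul_mem _ _ hy
    | hadd a b ha hb => intro y hy; rw [add_mul]; exact add_mem (ha y hy) (hb y hy)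
    | hmul a b ha hb => intro y hy; rw [mul_assoc]; exact ha _ (hb y hy)
  have := hstab x 1 (Submodule.subset_span ⟨1, heckeT_one⟩)
  rwa [mul_one] at this

end Hecke

section Regular

variable {R : Type} [CommRing R] {q : R} {r : ℕ}

/-! ### The regular representation -/

variable (R q) in
/-- Left multiplication by a generator, in terms of coefficient functions. -/
def heckeOp (i : Fin (r - 1)) : (Equiv.Perm (Fin r) → R) →ₗ[R] (Equiv.Perm (Fin r) → R) where
  toFun a w := if Asc w i then q * a (simpleTransp r i * w)
    else a (simpleTransp r i * w) + (q - 1) * a w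
  map_add' a b := by
    funext w
    simp only [Pi.add_apply]
    split_ifs <;> ring
  map_smul' c a := by
    funext w
    simp only [Pi.smul_apply, smul_eq_mul, RingHom.id_apply]
    split_ifs <;> ring

theorem heckeOp_apply (i : Fin (r - 1)) (a : Equiv.Perm (Fin r) → R) (w : Equiv.Perm (Fin r)) :
    heckeOp R q i a w = if Asc w i then q * a (simpleTransp r i * w)
      else a (simpleTransp r i * w) + (q - 1) * a w := rfl

theorem asc_simpleTransp_mul_of_far' {w : Equiv.Perm (Fin r)} {i j : Fin (r - 1)}
    (h : (i : ℕ) + 1 < j) : Asc (simpleTransp r j * w) i ↔ Asc w i := by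
  have h1 : simpleTransp r j (lo i) = lo i := by
    apply Fin.ext
    rw [simpleTransp_val, val_lo, if_neg (by omega), if_neg (by omega)]
  have h2 : simpleTransp r j (hi i) = hi i := by
    apply Fin.ext
    rw [simpleTransp_val, val_hi, if_neg (by omega), if_neg (by omega)]
  rw [Asc, Asc, inv_simpleTransp_mul_apply, inv_simpleTransp_mul_apply, h1, h2]

theorem heckeOp_quadratic (i : Fin (r - 1)) :
    heckeOp R q i * heckeOp R q i =
      (q - 1) • heckeOp R q i + algebraMap R (Module.End R (Equiv.Perm (Fin r) → R)) q := by
  refine LinearMap.ext fun a => ?_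
  funext w
  simp only [Module.End.mul_apply, LinearMap.add_apply, LinearMap.smul_apply,
    Module.algebraMap_end_apply, Pi.add_apply, Pi.smul_apply, smul_eq_mul, heckeOp_apply,
    asc_simpleTransp_mul, simpleTransp_mul_cancel_left]
  by_cases h : Asc w i
  · simp only [h, not_true_eq_false, if_true, if_false]; ring
  · simp only [h, not_false_eq_true, if_true, if_false]; ring

theorem heckeOp_comm {i j : Fin (r - 1)} (h : (i : ℕ) + 1 < j) :
    heckeOp R q i * heckeOp R q j = heckeOp R q j * heckeOp R q i := by
  refine LinearMap.ext fun a => ?_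
  funext w
  have hc : simpleTransp r j * (simpleTransp r i * w) =
      simpleTransp r i * (simpleTransp r j * w) := by
    rw [← mul_assoc, ← simpleTransp_comm h, mul_assoc]
  simp only [Module.End.mul_apply, heckeOp_apply, not_asc_simpleTransp_mul_of_far h,
    asc_simpleTransp_mul_of_far' h, hc]
  split_ifs <;> ring

theorem heckeOp_braid {i j : Fin (r - 1)} (h : (i : ℕ) + 1 = j) :
    heckeOp R q i * heckeOp R q j * heckeOp R q i =
      heckeOp R q j * heckeOp R q i * heckeOp R q j := by
  refine LinearMap.ext fun a => ?_
  funext w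
  have hb : simpleTransp r i * (simpleTransp r j * (simpleTransp r i * w)) =
      simpleTransp r j * (simpleTransp r i * (simpleTransp r j * w)) := by
    have := simpleTransp_braid h
    calc _ = simpleTransp r i * (simpleTransp r j * simpleTransp r i) * w := by
          simp only [mul_assoc]
      _ = _ := by rw [this]; simp only [mul_assoc]
  have e1 : simpleTransp r i (lo j) = lo i := by rw [← hi_eq_lo h, simpleTransp_hi]
  have e2 : simpleTransp r j (lo j) = hi j := simpleTransp_lo j
  simp only [Module.End.mul_apply, heckeOp_apply, Asc, inv_simpleTransp_mul_apply, hi_eq_lo h,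
    simpleTransp_lo_of_succ h, simpleTransp_hi_of_succ h, simpleTransp_lo, simpleTransp_hi, e1,
    simpleTransp_mul_cancel_left, hb]
  have n1 : w⁻¹ (lo i) ≠ w⁻¹ (lo j) := fun hh => by
    have := congrArg Fin.val (w⁻¹.injective hh); simp at this; omega
  have n2 : w⁻¹ (lo i) ≠ w⁻¹ (hi j) := fun hh => by
    have := congrArg Fin.val (w⁻¹.injective hh); simp at this; omega
  have n3 : w⁻¹ (lo j) ≠ w⁻¹ (hi j) := fun hh => by
    have := congrArg Fin.val (w⁻¹.injective hh); simp at this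
  -- The order of these three preimages decides every ascent condition. Two of the eight patterns
  -- contradict transitivity; the others are polynomial identities.
  rcases lt_or_gt_of_ne n1 with h1 | h1 <;> rcases lt_or_gt_of_ne n2 with h2 | h2 <;>
    rcases lt_or_gt_of_ne n3 with h3 | h3 <;>
    first
    | exact absurd (h1.trans h3) (lt_asymm h2)
    | exact absurd (h3.trans h1) (lt_asymm h2)
    | (simp only [h1, h2, h3, not_lt_of_gt h1, not_lt_of_gt h2, not_lt_of_gt h3, if_true, if_false]
       try ring)

variable (R q r) in
/-- The left regular representation in terms of coefficient functions. -/
def heckeRep : Hecke R q r →ₐ[R] Module.End R (Equiv.Perm (Fin r) → R) :=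
  RingQuot.liftAlgHom R ⟨FreeAlgebra.lift R (heckeOp R q), by
    intro x y hxy
    induction hxy with
    | quadratic i =>
      simp only [map_mul, map_add, map_smul, AlgHom.commutes, FreeAlgebra.lift_ι_apply]
      exact heckeOp_quadratic i
    | comm i j h =>
      simp only [map_mul, FreeAlgebra.lift_ι_apply]
      exact heckeOp_comm h
    | braid i j h =>
      simp only [map_mul, FreeAlgebra.lift_ι_apply]
      exact heckeOp_braid h⟩

theorem heckeRep_gen (i : Fin (r - 1)) : heckeRep R q r (heckeGen R q r i) = heckeOp R q i := by
  refine (RingQuot.liftAlgHom_mkAlgHom_apply _ _ _ _).trans ?_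
  exact FreeAlgebra.lift_ι_apply _ _

variable (R q r) in
/-- The coefficient function of an element of the Hecke algebra. -/
def coef : Hecke R q r →ₗ[R] (Equiv.Perm (Fin r) → R) :=
  (LinearMap.applyₗ (Pi.single 1 1 : Equiv.Perm (Fin r) → R)).comp (heckeRep R q r).toLinearMap

theorem coef_mul (x y : Hecke R q r) : coef R q r (x * y) = heckeRep R q r x (coef R q r y) := by
  simp [coef]

theorem coef_gen_mul (i : Fin (r - 1)) (x : Hecke R q r) (w : Equiv.Perm (Fin r)) :
    coef R q r (heckeGen R q r i * x) w = if Asc w i then q * coef R q r x (simpleTransp r i * w)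
      else coef R q r x (simpleTransp r i * w) + (q - 1) * coef R q r x w := by
  rw [coef_mul, heckeRep_gen, heckeOp_apply]

/-- The regular representation exists for the sake of this formula: it shows that the T_w are
linearly independent, so that elements may be compared by their coefficients. -/
theorem coef_heckeT (w : Equiv.Perm (Fin r)) :
    coef R q r (heckeT R q w) = Pi.single w 1 := by
  induction hk : inv w generalizing w with
  | zero =>
    have : w = 1 := by
      by_contra hne
      obtain ⟨i, hi⟩ := exists_not_asc hne
      have := inv_of_not_asc hi
      omega
    subst this
    simp [coef]
  | succ k ih =>
    have hne : w ≠ 1 := by rintro rfl; simp at hk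
    obtain ⟨i, hi⟩ := exists_not_asc hne
    have h1 := ih (simpleTransp r i * w) (by have := inv_of_not_asc hi; omega)
    have h2 := heckeGen_mul_heckeT_of_asc (R := R) (q := q) (asc_simpleTransp_mul.2 hi)
    rw [simpleTransp_mul_cancel_left] at h2
    rw [← h2]
    funext v
    rw [coef_gen_mul, h1]
    by_cases hv : v = w
    · subst hv
      have hv' : v ≠ simpleTransp r i * v := by
        intro h3
        apply hi
        rw [h3, asc_simpleTransp_mul]
        exact hi
      rw [if_neg hi, Pi.single_eq_same, Pi.single_eq_same, Pi.single_eq_of_ne hv']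
      ring
    · have h3 : simpleTransp r i * v ≠ simpleTransp r i * w := fun h => hv (mul_left_cancel h)
      rw [Pi.single_eq_of_ne h3, Pi.single_eq_of_ne hv]
      by_cases hv2 : v = simpleTransp r i * w
      · rw [if_pos (by rw [hv2, asc_simpleTransp_mul]; exact hi), mul_zero]
      · rw [Pi.single_eq_of_ne hv2]
        simp

theorem coef_sum (a : Equiv.Perm (Fin r) → R) :
    coef R q r (∑ w, a w • heckeT R q w) = a := by
  rw [map_sum]
  funext v
  simp [coef_heckeT, Finset.sum_apply, Pi.single_apply]

theorem eq_sum_coef (x : Hecke R q r) : x = ∑ w, coef R q r x w • heckeT R q w := by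
  have hx : x ∈ Submodule.span R (Set.range (heckeT R q (r := r))) := by
    rw [span_heckeT]; trivial
  induction hx using Submodule.span_induction with
  | mem x hx =>
    obtain ⟨w, rfl⟩ := hx
    rw [coef_heckeT]
    simp [Pi.single_apply, ite_smul]
  | zero => simp
  | add x y _ _ hx hy =>
    rw [map_add]
    simp only [Pi.add_apply, add_smul, Finset.sum_add_distrib]
    rw [← hx, ← hy]
  | smul c x _ hx =>
    rw [map_smul]
    simp only [Pi.smul_apply, smul_assoc]
    rw [← Finset.smul_sum, ← hx]

theorem coef_injective : Function.Injective (coef R q r) := by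
  intro x y h
  rw [eq_sum_coef x, eq_sum_coef y, h]

theorem coef_sum_finset (s : Finset (Equiv.Perm (Fin r))) (w : Equiv.Perm (Fin r)) :
    coef R q r (∑ w ∈ s, heckeT R q w) w = if w ∈ s then 1 else 0 := by
  rw [map_sum]
  simp [coef_heckeT, Finset.sum_apply, Pi.single_apply]

/-! ### The anti-involution -/

variable (R q r) in
/-- The anti-involution fixing the generators. -/
def heckeRev : Hecke R q r →ₐ[R] (Hecke R q r)ᵐᵒᵖ :=
  RingQuot.liftAlgHom R ⟨FreeAlgebra.lift R fun i => MulOpposite.op (heckeGen R q r i), by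
    intro x y hxy
    induction hxy with
    | quadratic i =>
      simp only [map_mul, map_add, map_smul, AlgHom.commutes, FreeAlgebra.lift_ι_apply]
      rw [← MulOpposite.op_mul, heckeGen_mul_self]
      rfl
    | comm i j h =>
      simp only [map_mul, FreeAlgebra.lift_ι_apply]
      rw [← MulOpposite.op_mul, ← MulOpposite.op_mul, heckeGen_comm h]
    | braid i j h =>
      simp only [map_mul, FreeAlgebra.lift_ι_apply]
      simp only [← MulOpposite.op_mul, ← mul_assoc, heckeGen_braid h]⟩

variable (R q r) in
/-- The anti-involution as a linear map. -/
def rev : Hecke R q r →ₗ[R] Hecke R q r :=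
  (MulOpposite.opLinearEquiv R).symm.toLinearMap.comp (heckeRev R q r).toLinearMap

theorem rev_gen (i : Fin (r - 1)) : rev R q r (heckeGen R q r i) = heckeGen R q r i := by
  have : heckeRev R q r (heckeGen R q r i) = MulOpposite.op (heckeGen R q r i) := by
    refine (RingQuot.liftAlgHom_mkAlgHom_apply _ _ _ _).trans ?_
    exact FreeAlgebra.lift_ι_apply _ _
  simp [rev, this]

theorem rev_mul (x y : Hecke R q r) : rev R q r (x * y) = rev R q r y * rev R q r x := by
  simp [rev]

theorem rev_one : rev R q r 1 = 1 := by
  simp [rev]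

theorem isReducedWord_reverse {w : Equiv.Perm (Fin r)} {l : List (Fin (r - 1))}
    (h : IsReducedWord w l) : IsReducedWord w⁻¹ l.reverse := by
  have key : ∀ l : List (Fin (r - 1)),
      (l.reverse.map (simpleTransp r)).prod = (l.map (simpleTransp r)).prod⁻¹ := by
    intro l
    rw [List.prod_inv_reverse, List.map_map, ← List.map_reverse]
    congr 2
  refine ⟨by rw [key, h.1], fun l' hl' => ?_⟩
  rw [List.length_reverse, ← List.length_reverse (as := l')]
  exact h.2 _ (by rw [key, hl', inv_inv])

theorem rev_heckeT (w : Equiv.Perm (Fin r)) :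
    rev R q r (heckeT R q w) = heckeT R q w⁻¹ := by
  have h := (exists_reducedWord w).choose_spec
  have h' := isReducedWord_iff.1 (isReducedWord_reverse h)
  rw [heckeT_eq_heckeWord h'.1 h'.2]
  rw [show heckeT R q w = heckeWord R q (exists_reducedWord w).choose from rfl]
  generalize (exists_reducedWord w).choose = l
  induction l with
  | nil => simp [rev_one]
  | cons i l ih =>
    rw [heckeWord_cons, rev_mul, ih, rev_gen, heckeWord, heckeWord]
    simp

theorem coef_rev (x : Hecke R q r) (w : Equiv.Perm (Fin r)) :
    coef R q r (rev R q r x) w = coef R q r x w⁻¹ := by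
  conv_lhs => rw [eq_sum_coef x, map_sum]
  simp only [map_smul, rev_heckeT]
  have : ∑ v, coef R q r x v • heckeT R q v⁻¹ =
      ∑ v, (fun v => coef R q r x v⁻¹) v • heckeT R q v :=
    Fintype.sum_equiv (Equiv.inv _) _ _ fun v => by simp
  rw [this, coef_sum]

theorem rev_rev (x : Hecke R q r) : rev R q r (rev R q r x) = x := by
  apply coef_injective
  funext w
  rw [coef_rev, coef_rev, inv_inv]

/-! ### Eigenvectors of the generators -/

/-- The equation at a descent reads a(s_i w) + (q - 1) a(w) = q a(w), and q cancels additively. No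
division by q is needed, so the criterion holds for q = X and for q = 0 alike. -/
theorem gen_mul_eq_smul_iff {i : Fin (r - 1)} {x : Hecke R q r} :
    heckeGen R q r i * x = q • x ↔
      ∀ w, coef R q r x (simpleTransp r i * w) = coef R q r x w := by
  constructor
  · intro h
    have key : ∀ w, ¬ Asc w i → coef R q r x (simpleTransp r i * w) = coef R q r x w := by
      intro w hw
      have h1 := congrFun (congrArg (coef R q r) h) w
      rw [coef_gen_mul, if_neg hw, map_smul, Pi.smul_apply, smul_eq_mul] at h1
      linear_combination h1
    intro w
    by_cases hw : Asc w i
    · have := key (simpleTransp r i * w) (by rw [asc_simpleTransp_mul]; exact not_not.2 hw)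
      rw [simpleTransp_mul_cancel_left] at this
      exact this.symm
    · exact key w hw
  · intro h
    apply coef_injective
    funext w
    rw [coef_gen_mul, h, map_smul, Pi.smul_apply, smul_eq_mul]
    split_ifs <;> ring

theorem mul_gen_eq_smul_iff {i : Fin (r - 1)} {x : Hecke R q r} :
    x * heckeGen R q r i = q • x ↔
      ∀ w, coef R q r x (w * simpleTransp r i) = coef R q r x w := by
  have h1 : x * heckeGen R q r i = q • x ↔
      heckeGen R q r i * rev R q r x = q • rev R q r x := by
    constructor
    · intro h
      rw [← rev_gen (q := q) i, ← rev_mul, h, map_smul]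
    · intro h
      have := congrArg (rev R q r) h
      rwa [rev_mul, rev_rev, rev_gen, map_smul, rev_rev] at this
  rw [h1, gen_mul_eq_smul_iff]
  simp only [coef_rev, mul_inv_rev, simpleTransp_inv]
  exact ⟨fun h w => by simpa using h w⁻¹, fun h w => h w⁻¹⟩

end Regular

/-! ### Blocks -/

section Blocks

variable {n r : ℕ}

/-- The sum of the first `a` parts. -/
def psum (l : Fin n → ℕ) (a : ℕ) : ℕ := ∑ k ∈ Finset.univ.filter (fun k : Fin n => (k : ℕ) < a), l k

theorem psum_mono (l : Fin n → ℕ) {a b : ℕ} (h : a ≤ b) : psum l a ≤ psum l b :=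
  Finset.sum_le_sum_of_subset fun k hk => by
    simp only [Finset.mem_filter, Finset.mem_univ, true_and] at hk ⊢
    omega

@[simp] theorem psum_zero (l : Fin n → ℕ) : psum l 0 = 0 := by simp [psum]

theorem psum_of_le (l : WComp n r) {a : ℕ} (h : n ≤ a) : psum l.1 a = r := by
  rw [psum, Finset.filter_true_of_mem]
  · exact l.2
  · intro k _
    omega

theorem psum_le (l : WComp n r) (a : ℕ) : psum l.1 a ≤ r :=
  (psum_mono l.1 (le_max_left a n)).trans (psum_of_le l (le_max_right a n)).le

theorem psum_succ (l : Fin n → ℕ) (i : Fin n) : psum l (i + 1) = psum l i + l i := by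
  have : (Finset.univ.filter fun k : Fin n => (k : ℕ) < i + 1) =
      insert i (Finset.univ.filter fun k : Fin n => (k : ℕ) < i) := by
    ext k
    simp only [Finset.mem_filter, Finset.mem_univ, true_and, Finset.mem_insert, Fin.ext_iff]
    omega
  rw [psum, this, Finset.sum_insert (by simp), psum, add_comm]

theorem psum_ext {l m : Fin n → ℕ} (h : ∀ a, psum l a = psum m a) : l = m := by
  funext i
  have h1 := psum_succ l i
  have h2 := psum_succ m i
  rw [h, h] at h1
  omega

theorem mem_block {l : WComp n r} {i : Fin n} {x : Fin r} :
    x ∈ block l i ↔ psum l.1 i ≤ x ∧ (x : ℕ) < psum l.1 (i + 1) := by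
  have h1 : Finset.Iio i = Finset.univ.filter fun k : Fin n => (k : ℕ) < i := by
    ext k; simp
  have h2 : Finset.Iic i = Finset.univ.filter fun k : Fin n => (k : ℕ) < i + 1 := by
    ext k
    simp only [Finset.mem_Iic, Finset.mem_filter, Finset.mem_univ, true_and, Fin.le_def]
    omega
  simp only [block, Finset.mem_filter, Finset.mem_univ, true_and, h1, h2, psum]

theorem exists_mem_block (l : WComp n r) (x : Fin r) : ∃ i, x ∈ block l i := by
  classical
  have hex : ∃ a, (x : ℕ) < psum l.1 a := ⟨n, by rw [psum_of_le l le_rfl]; exact x.2⟩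
  have h1 := Nat.find_spec hex
  have h2 : Nat.find hex ≠ 0 := by
    intro h0
    rw [h0] at h1
    simp at h1
  obtain ⟨a, ha⟩ := Nat.exists_eq_succ_of_ne_zero h2
  have h3 : ¬ (x : ℕ) < psum l.1 a := Nat.find_min hex (by omega)
  have han : a < n := by
    by_contra hh
    rw [psum_of_le l (by omega)] at h3
    exact h3 x.2
  rw [ha] at h1
  exact ⟨⟨a, han⟩, mem_block.2 ⟨by simpa using h3, h1⟩⟩

/-- The index of the block containing a letter. -/
def bl (l : WComp n r) (x : Fin r) : Fin n := (exists_mem_block l x).choose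

theorem bl_lt_iff {l : WComp n r} {x : Fin r} {a : ℕ} :
    (bl l x : ℕ) < a ↔ (x : ℕ) < psum l.1 a := by
  have h := mem_block.1 (exists_mem_block l x).choose_spec
  constructor
  · intro h1
    exact h.2.trans_le (psum_mono l.1 h1)
  · intro h1
    by_contra h2
    have := psum_mono l.1 (not_lt.1 h2)
    have := h.1
    change psum l.1 (bl l x) ≤ x at this
    omega

theorem mem_block_iff {l : WComp n r} {i : Fin n} {x : Fin r} : x ∈ block l i ↔ bl l x = i := by
  rw [mem_block, ← not_lt, ← bl_lt_iff, ← bl_lt_iff, Fin.ext_iff]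
  omega

theorem bl_mono (l : WComp n r) : Monotone (bl l) := by
  intro x y h
  have h1 : (bl l y : ℕ) < bl l y + 1 := Nat.lt_succ_self _
  rw [bl_lt_iff] at h1
  have h2 : (bl l x : ℕ) < bl l y + 1 := bl_lt_iff.2 (lt_of_le_of_lt h h1)
  exact Fin.le_def.2 (Nat.lt_succ_iff.1 h2)

theorem card_val_lt {b : ℕ} (hb : b ≤ r) :
    (Finset.univ.filter fun x : Fin r => (x : ℕ) < b).card = b := by
  have : (Finset.univ.filter fun x : Fin r => (x : ℕ) < b).map Fin.valEmbedding =
      Finset.range b := by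
    ext k
    simp only [Finset.mem_map, Finset.mem_filter, Finset.mem_univ, true_and, Fin.valEmbedding_apply,
      Finset.mem_range]
    exact ⟨by rintro ⟨x, hx, rfl⟩; exact hx, fun h => ⟨⟨k, by omega⟩, h, rfl⟩⟩
  rw [← Finset.card_map Fin.valEmbedding, this, Finset.card_range]

theorem card_bl (l : WComp n r) (i : Fin n) :
    (Finset.univ.filter fun x => bl l x = i).card = l.1 i := by
  have h1 := card_val_lt (psum_le l (i + 1))
  have h2 := card_val_lt (psum_le l i)
  simp only [← bl_lt_iff] at h1 h2
  have h3 : (Finset.univ.filter fun x => (bl l x : ℕ) < i + 1) =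
      (Finset.univ.filter fun x => (bl l x : ℕ) < i) ∪ Finset.univ.filter fun x => bl l x = i := by
    ext x
    simp only [Finset.mem_filter, Finset.mem_univ, true_and, Finset.mem_union, Fin.ext_iff]
    omega
  rw [h3, Finset.card_union_of_disjoint, psum_succ] at h1
  · omega
  · rw [Finset.disjoint_filter]
    rintro x - hx rfl
    exact lt_irrefl _ hx

/-! ### Young subgroups -/

theorem mem_young {l : WComp n r} {w : Equiv.Perm (Fin r)} :
    w ∈ young l ↔ ∀ x, bl l (w x) = bl l x := by
  simp only [young, Finset.mem_filter, Finset.mem_univ, true_and, mem_block_iff]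
  exact ⟨fun h x => h _ x rfl, fun h i x hx => by rw [h, hx]⟩

theorem one_mem_young (l : WComp n r) : 1 ∈ young l := mem_young.2 fun _ => rfl

theorem mul_mem_young {l : WComp n r} {v w : Equiv.Perm (Fin r)} (hv : v ∈ young l)
    (hw : w ∈ young l) : v * w ∈ young l :=
  mem_young.2 fun x => by rw [Equiv.Perm.mul_apply, mem_young.1 hv, mem_young.1 hw]

theorem bl_inv_apply {l : WComp n r} {w : Equiv.Perm (Fin r)} (hw : w ∈ young l) (x : Fin r) :
    bl l (w⁻¹ x) = bl l x := by
  simpa using (mem_young.1 hw (w⁻¹ x)).symm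

theorem inv_mem_young {l : WComp n r} {w : Equiv.Perm (Fin r)} (hw : w ∈ young l) :
    w⁻¹ ∈ young l := mem_young.2 (bl_inv_apply hw)

/-- The letters moved by a simple transposition are in the same block. -/
def Adj (l : WComp n r) (i : Fin (r - 1)) : Prop := bl l (lo i) = bl l (hi i)

theorem simpleTransp_mem_young {l : WComp n r} {i : Fin (r - 1)} (h : Adj l i) :
    simpleTransp r i ∈ young l := by
  refine mem_young.2 fun x => ?_
  by_cases h1 : x = lo i
  · rw [h1, simpleTransp_lo, h]
  by_cases h2 : x = hi i
  · rw [h2, simpleTransp_hi, h]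
  rw [simpleTransp_eq, Equiv.swap_apply_of_ne_of_ne h1 h2]

theorem adj_of_not_asc {l : WComp n r} {w : Equiv.Perm (Fin r)} (hw : w ∈ young l)
    {i : Fin (r - 1)} (h : ¬ Asc w i) : Adj l i := by
  rw [not_asc_iff] at h
  have h1 := bl_mono l h.le
  rw [bl_inv_apply hw, bl_inv_apply hw] at h1
  exact le_antisymm (bl_mono l (lo_lt_hi i).le) h1

/-- Induction on elements of a Young subgroup. -/
theorem young_induction {l : WComp n r} {p : Equiv.Perm (Fin r) → Prop} (one : p 1)
    (mul : ∀ i u, Adj l i → u ∈ young l → Asc u i → p u → p (simpleTransp r i * u))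
    {w : Equiv.Perm (Fin r)} (hw : w ∈ young l) : p w := by
  induction hk : inv w using Nat.strong_induction_on generalizing w with
  | _ k ih =>
    by_cases h1 : w = 1
    · rw [h1]; exact one
    obtain ⟨i, hi⟩ := exists_not_asc h1
    have hadj := adj_of_not_asc hw hi
    have hmem := mul_mem_young (simpleTransp_mem_young hadj) hw
    have := mul i _ hadj hmem (asc_simpleTransp_mul.2 hi)
      (ih _ (by rw [← hk, inv_of_not_asc hi]; omega) hmem rfl)
    rwa [simpleTransp_mul_cancel_left] at this

theorem young_mul_invariant {l : WComp n r} {X : Type*} {f : Equiv.Perm (Fin r) → X}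
    (h : ∀ i, Adj l i → ∀ w, f (simpleTransp r i * w) = f w) {u : Equiv.Perm (Fin r)}
    (hu : u ∈ young l) (w : Equiv.Perm (Fin r)) : f (u * w) = f w := by
  refine young_induction (p := fun u => f (u * w) = f w) (by rw [one_mul])
    (fun i u hi _ _ ih => ?_) hu
  rw [mul_assoc, h i hi, ih]

theorem mul_young_invariant {l : WComp n r} {X : Type*} {f : Equiv.Perm (Fin r) → X}
    (h : ∀ i, Adj l i → ∀ w, f (w * simpleTransp r i) = f w) {u : Equiv.Perm (Fin r)}
    (hu : u ∈ young l) (w : Equiv.Perm (Fin r)) : f (w * u) = f w := by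
  have := young_mul_invariant (l := l) (f := fun w => f w⁻¹) (fun i hi w => by
    simpa using h i hi w⁻¹) (inv_mem_young hu) w⁻¹
  simpa using this

/-- `w` is the shortest element of its coset `𝔖_l w`. -/
def LMin (l : WComp n r) (w : Equiv.Perm (Fin r)) : Prop := ∀ i, Adj l i → Asc w i

theorem LMin.lt {l : WComp n r} {w : Equiv.Perm (Fin r)} (h : LMin l w) {x y : Fin r}
    (hxy : x < y) (hb : bl l x = bl l y) : w⁻¹ x < w⁻¹ y := by
  have step : ∀ z y : Fin r, (y : ℕ) = z + 1 → bl l z = bl l y → w⁻¹ z < w⁻¹ y := by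
    intro z y hzy hbz
    have hy : hi (⟨z, by omega⟩ : Fin (r - 1)) = y := Fin.ext hzy.symm
    rw [← hy] at hbz ⊢
    exact h (⟨z, by omega⟩ : Fin (r - 1)) hbz
  obtain ⟨k, hk⟩ : ∃ k, (y : ℕ) = x + 1 + k := ⟨y - x - 1, by rw [Fin.lt_def] at hxy; omega⟩
  induction k generalizing y with
  | zero => exact step x y hk hb
  | succ k ih =>
    obtain ⟨z, hz⟩ : ∃ z : Fin r, (z : ℕ) = x + 1 + k := ⟨⟨x + 1 + k, by omega⟩, rfl⟩
    have hxz : x < z := Fin.lt_def.2 (by omega)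
    have hzy : z < y := Fin.lt_def.2 (by omega)
    have hbz : bl l x = bl l z :=
      le_antisymm (bl_mono l hxz.le) (by rw [hb]; exact bl_mono l hzy.le)
    exact (ih hxz hbz hz).trans (step z y (by omega) (by rw [← hbz, hb]))

theorem exists_young_mul_lMin (l : WComp n r) (w : Equiv.Perm (Fin r)) :
    ∃ u ∈ young l, ∃ d, LMin l d ∧ w = u * d := by
  induction hk : inv w using Nat.strong_induction_on generalizing w with
  | _ k ih =>
    by_cases h : LMin l w
    · exact ⟨1, one_mem_young l, w, h, (one_mul w).symm⟩
    · rw [LMin] at h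
      push Not at h
      obtain ⟨i, hi, hw⟩ := h
      obtain ⟨u, hu, d, hd, hud⟩ := ih (inv (simpleTransp r i * w))
        (by rw [← hk, inv_of_not_asc hw]; omega) _ rfl
      refine ⟨simpleTransp r i * u, mul_mem_young (simpleTransp_mem_young hi) hu, d, hd, ?_⟩
      rw [mul_assoc, ← hud, simpleTransp_mul_cancel_left]

/-- Since d⁻¹ increases on blocks and u permutes the letters within them, the order of two letters
of one block under (u d)⁻¹ is decided by u. This is what makes lengths add in u d and the
decomposition unique. -/
theorem asc_mul_of_lMin {l : WComp n r} {u d : Equiv.Perm (Fin r)} (hu : u ∈ young l)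
    (hd : LMin l d) {i : Fin (r - 1)} (hi : Adj l i) : Asc (u * d) i ↔ Asc u i := by
  have key : ∀ x y, bl l x = bl l y → u⁻¹ x < u⁻¹ y → (u * d)⁻¹ x < (u * d)⁻¹ y := by
    intro x y hxy h
    rw [mul_inv_rev, Equiv.Perm.mul_apply, Equiv.Perm.mul_apply]
    exact hd.lt h (by rw [bl_inv_apply hu, bl_inv_apply hu, hxy])
  constructor
  · intro h
    by_contra h2
    exact lt_asymm h (key _ _ hi.symm (not_asc_iff.1 h2))
  · exact key _ _ hi

theorem young_mul_lMin_unique {l : WComp n r} {u u' d d' : Equiv.Perm (Fin r)} (hu : u ∈ young l)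
    (hu' : u' ∈ young l) (hd : LMin l d) (hd' : LMin l d') (h : u * d = u' * d') :
    u = u' ∧ d = d' := by
  have hv : u'⁻¹ * u ∈ young l := mul_mem_young (inv_mem_young hu') hu
  have hvd : d' = u'⁻¹ * u * d := by rw [mul_assoc, h, inv_mul_cancel_left]
  have h1 : u'⁻¹ * u = 1 := by
    by_contra hne
    obtain ⟨i, hi⟩ := exists_not_asc hne
    have hadj := adj_of_not_asc hv hi
    have h2 := hd' i hadj
    rw [hvd, asc_mul_of_lMin hv hd hadj] at h2
    exact hi h2
  rw [h1, one_mul] at hvd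
  exact ⟨(inv_mul_eq_one.1 h1).symm, hvd.symm⟩

variable {R : Type} [CommRing R] {q : R}

theorem coef_xElt (l : WComp n r) (w : Equiv.Perm (Fin r)) :
    coef R q r (xElt R q l) w = if w ∈ young l then 1 else 0 := coef_sum_finset _ _

theorem simpleTransp_mul_mem_young_iff {l : WComp n r} {i : Fin (r - 1)} (hi : Adj l i)
    (w : Equiv.Perm (Fin r)) : simpleTransp r i * w ∈ young l ↔ w ∈ young l := by
  constructor
  · intro h
    have := mul_mem_young (simpleTransp_mem_young hi) h
    rwa [simpleTransp_mul_cancel_left] at this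
  · exact mul_mem_young (simpleTransp_mem_young hi)

theorem mul_simpleTransp_mem_young_iff {l : WComp n r} {i : Fin (r - 1)} (hi : Adj l i)
    (w : Equiv.Perm (Fin r)) : w * simpleTransp r i ∈ young l ↔ w ∈ young l := by
  constructor
  · intro h
    have := mul_mem_young h (simpleTransp_mem_young hi)
    rwa [simpleTransp_mul_cancel_right] at this
  · exact fun h => mul_mem_young h (simpleTransp_mem_young hi)

theorem gen_mul_xElt {l : WComp n r} {i : Fin (r - 1)} (hi : Adj l i) :
    heckeGen R q r i * xElt R q l = q • xElt R q l := by
  rw [gen_mul_eq_smul_iff]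
  intro w
  simp only [coef_xElt, simpleTransp_mul_mem_young_iff hi]

theorem xElt_mul_gen {l : WComp n r} {i : Fin (r - 1)} (hi : Adj l i) :
    xElt R q l * heckeGen R q r i = q • xElt R q l := by
  rw [mul_gen_eq_smul_iff]
  intro w
  simp only [coef_xElt, mul_simpleTransp_mem_young_iff hi]

theorem rev_xElt (l : WComp n r) : rev R q r (xElt R q l) = xElt R q l := by
  apply coef_injective
  funext w
  rw [coef_rev, coef_xElt, coef_xElt]
  congr 1
  exact propext ⟨fun h => by simpa using inv_mem_young h, inv_mem_young⟩

theorem heckeT_mul_of_lMin {l : WComp n r} {u d : Equiv.Perm (Fin r)} (hu : u ∈ young l)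
    (hd : LMin l d) : heckeT R q u * heckeT R q d = heckeT R q (u * d) := by
  refine young_induction (p := fun u => heckeT R q u * heckeT R q d = heckeT R q (u * d))
    (by rw [heckeT_one, one_mul, one_mul]) (fun i u hi hu has ih => ?_) hu
  rw [← heckeGen_mul_heckeT_of_asc has, mul_assoc, ih,
    heckeGen_mul_heckeT_of_asc ((asc_mul_of_lMin hu hd hi).2 has), mul_assoc]

/-- An element whose coefficients are constant on the cosets `𝔖_l w` is in `x_l H`. -/
theorem exists_eq_xElt_mul {l : WComp n r} {x : Hecke R q r}
    (h : ∀ i, Adj l i → heckeGen R q r i * x = q • x) : ∃ y, x = xElt R q l * y := by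
  classical
  have hinv : ∀ u ∈ young l, ∀ w, coef R q r x (u * w) = coef R q r x w := fun u hu w =>
    young_mul_invariant (fun i hi w => gen_mul_eq_smul_iff.1 (h i hi) w) hu w
  -- Only the coefficients at shortest representatives are kept; multiplication by x_l spreads each
  -- of them over its coset.
  refine ⟨∑ d with LMin l d, coef R q r x d • heckeT R q d, ?_⟩
  conv_lhs => rw [eq_sum_coef x]
  rw [xElt, Finset.sum_mul_sum, ← Finset.sum_product']
  symm
  refine Finset.sum_nbij (fun p => p.1 * p.2) (fun _ _ => Finset.mem_univ _) ?_ ?_ ?_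
  · rintro ⟨u, d⟩ h1 ⟨u', d'⟩ h2 h3
    simp only [Finset.coe_product, Finset.coe_filter, Set.mem_prod, Finset.mem_coe,
      Finset.mem_univ, true_and, Set.mem_ofPred_eq] at h1 h2
    obtain ⟨rfl, rfl⟩ := young_mul_lMin_unique h1.1 h2.1 h1.2 h2.2 h3
    rfl
  · intro w _
    obtain ⟨u, hu, d, hd, rfl⟩ := exists_young_mul_lMin l w
    exact ⟨(u, d), by simpa using ⟨hu, hd⟩, rfl⟩
  · rintro ⟨u, d⟩ h1
    simp only [Finset.mem_product, Finset.mem_filter, Finset.mem_univ, true_and] at h1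
    rw [mul_smul_comm, heckeT_mul_of_lMin h1.1 h1.2, hinv u h1.1]

theorem exists_eq_mul_xElt {l : WComp n r} {x : Hecke R q r}
    (h : ∀ i, Adj l i → x * heckeGen R q r i = q • x) : ∃ y, x = y * xElt R q l := by
  obtain ⟨y, hy⟩ := exists_eq_xElt_mul (l := l) (x := rev R q r x) fun i hi => by
    rw [← rev_gen (q := q) i, ← rev_mul, h i hi, map_smul]
  refine ⟨rev R q r y, ?_⟩
  rw [← rev_rev x, hy, rev_mul, rev_xElt]

end Blocks

/-! ### Double cosets of Young subgroups -/

/-- Used to produce permutations with prescribed behaviour on blocks, once to compare two elements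
of a double coset and once to realise a given matrix. -/
theorem exists_equiv_of_card_fiber {α β γ : Type*} [Fintype α] [Fintype β] [DecidableEq γ]
    (f : α → γ) (g : β → γ) (h : ∀ c, (Finset.univ.filter fun a => f a = c).card =
      (Finset.univ.filter fun b => g b = c).card) : ∃ e : α ≃ β, ∀ a, g (e a) = f a := by
  have e : ∀ c, Nonempty ({a // f a = c} ≃ {b // g b = c}) := fun c =>
    ⟨Fintype.equivOfCardEq (by rw [Fintype.card_subtype, Fintype.card_subtype, h])⟩
  exact ⟨Equiv.ofFiberEquiv fun c => (e c).some, Equiv.ofFiberEquiv_map _⟩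

section DoubleCosets

variable {n r : ℕ}

theorem relMatrix_apply (l m : WComp n r) (w : Equiv.Perm (Fin r)) (i j : Fin n) :
    relMatrix l m w i j =
      (Finset.univ.filter fun x => bl l x = i ∧ bl m (w⁻¹ x) = j).card := by
  rw [relMatrix, Matrix.of_apply]
  congr 1
  ext x
  simp only [Finset.mem_inter, Finset.mem_image, Finset.mem_filter, Finset.mem_univ, true_and,
    mem_block_iff]
  refine and_congr_right fun _ => ⟨?_, fun h => ⟨w⁻¹ x, h, by simp⟩⟩
  rintro ⟨y, hy, rfl⟩
  simpa using hy

theorem relMatrix_mul_mul {l m : WComp n r} {u v : Equiv.Perm (Fin r)} (hu : u ∈ young l)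
    (hv : v ∈ young m) (w : Equiv.Perm (Fin r)) :
    relMatrix l m (u * w * v) = relMatrix l m w := by
  ext i j
  rw [relMatrix_apply, relMatrix_apply]
  refine Finset.card_equiv u⁻¹ fun x => ?_
  simp only [Finset.mem_filter, Finset.mem_univ, true_and, bl_inv_apply hu]
  rw [mul_inv_rev, mul_inv_rev, Equiv.Perm.mul_apply, bl_inv_apply hv, Equiv.Perm.mul_apply]

/-- The matrix records the fibre sizes of the map sending a letter x to the blocks of x and of w⁻¹
x. Equal matrices allow a bijection u matching the fibres for w with those for w'; then u preserves
the blocks of l, and w⁻¹ u⁻¹ w' those of m. -/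
theorem exists_of_relMatrix_eq {l m : WComp n r} {w w' : Equiv.Perm (Fin r)}
    (h : relMatrix l m w = relMatrix l m w') :
    ∃ u ∈ young l, ∃ v ∈ young m, w' = u * w * v := by
  obtain ⟨u, hu⟩ := exists_equiv_of_card_fiber (fun x => (bl l x, bl m (w⁻¹ x)))
    (fun x => (bl l x, bl m (w'⁻¹ x))) (by
      rintro ⟨i, j⟩
      simp only [Prod.mk.injEq]
      rw [← relMatrix_apply, ← relMatrix_apply, h])
  simp only [Prod.mk.injEq] at hu
  have hu1 : u ∈ young l := mem_young.2 fun x => (hu x).1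
  refine ⟨u, hu1, w⁻¹ * u⁻¹ * w', ?_, by group⟩
  have : (w⁻¹ * u⁻¹ * w')⁻¹ ∈ young m := by
    refine mem_young.2 fun x => ?_
    have h1 := (hu (w x)).2
    rw [Equiv.Perm.inv_def w, Equiv.symm_apply_apply] at h1
    rw [← h1]
    simp [mul_inv_rev]
  simpa using inv_mem_young this

theorem sum_relMatrix_row (l m : WComp n r) (w : Equiv.Perm (Fin r)) (i : Fin n) :
    ∑ j, relMatrix l m w i j = l.1 i := by
  rw [← card_bl l i, Finset.card_eq_sum_card_fiberwise (f := fun x => bl m (w⁻¹ x))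
    (t := Finset.univ) (by simp)]
  simp only [relMatrix_apply, Finset.filter_filter]

theorem sum_relMatrix_col (l m : WComp n r) (w : Equiv.Perm (Fin r)) (j : Fin n) :
    ∑ i, relMatrix l m w i j = m.1 j := by
  have h1 : (Finset.univ.filter fun x => bl m (w⁻¹ x) = j).card = m.1 j := by
    rw [← card_bl m j]
    exact Finset.card_equiv w⁻¹ fun x => by simp
  rw [← h1, Finset.card_eq_sum_card_fiberwise (f := fun x => bl l x)
    (t := Finset.univ) (by simp)]
  simp only [relMatrix_apply, Finset.filter_filter, and_comm]

/-- The matrix of a double coset as an element of `M_n(r)`. -/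
def relMat (l m : WComp n r) (w : Equiv.Perm (Fin r)) : Mat n r :=
  ⟨relMatrix l m w, by simp only [sum_relMatrix_row, l.2]⟩

theorem ro_relMat (l m : WComp n r) (w : Equiv.Perm (Fin r)) : ro (relMat l m w) = l :=
  Subtype.ext (funext (sum_relMatrix_row l m w))

theorem co_relMat (l m : WComp n r) (w : Equiv.Perm (Fin r)) : co (relMat l m w) = m :=
  Subtype.ext (funext (sum_relMatrix_col l m w))

theorem exists_relMatrix_eq (A : Mat n r) : ∃ w, relMatrix (ro A) (co A) w = A.1 := by
  -- The units of A, each with its position. Letters correspond to units in two ways, matching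
  -- blocks of the row sums with rows and blocks of the column sums with columns; comparing the two
  -- gives the permutation.
  let T := Σ p : Fin n × Fin n, Fin (A.1 p.1 p.2)
  have hT : ∀ (P : Fin n × Fin n → Prop) [DecidablePred P],
      (Finset.univ.filter fun t : T => P t.1).card =
        ∑ p ∈ Finset.univ.filter P, A.1 p.1 p.2 := by
    intro P _
    have : (Finset.univ.filter fun t : T => P t.1) =
        (Finset.univ.filter P).sigma fun _ => Finset.univ := by
      ext t; simp [Finset.mem_sigma, T]
    rw [this, Finset.card_sigma]
    simp
  obtain ⟨e₁, h₁⟩ := exists_equiv_of_card_fiber (bl (ro A)) (fun t : T => t.1.1) (fun i => by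
    rw [card_bl, hT (fun p => p.1 = i), Finset.sum_filter, Fintype.sum_prod_type_right]
    simp [ro])
  obtain ⟨e₂, h₂⟩ := exists_equiv_of_card_fiber (bl (co A)) (fun t : T => t.1.2) (fun j => by
    rw [card_bl, hT (fun p => p.2 = j), Finset.sum_filter, Fintype.sum_prod_type]
    simp [co])
  refine ⟨(e₁.trans e₂.symm)⁻¹, ?_⟩
  ext i j
  rw [relMatrix_apply, inv_inv]
  have h3 : ∀ x, bl (co A) ((e₁.trans e₂.symm) x) = (e₁ x).1.2 := by
    intro x
    rw [← h₂]
    simp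
  simp only [h3, ← h₁]
  have h4 : (Finset.univ.filter fun t : T => t.1 = (i, j)).card = A.1 i j := by
    rw [hT (fun p => p = (i, j)), Finset.filter_eq' , if_pos (Finset.mem_univ _),
      Finset.sum_singleton]
  rw [← h4]
  exact Finset.card_equiv e₁ fun x => by simp [Prod.ext_iff]

/-- A representative of the double coset of `A`. -/
def rep (A : Mat n r) : Equiv.Perm (Fin r) := (exists_relMatrix_eq A).choose

theorem relMatrix_rep (A : Mat n r) : relMatrix (ro A) (co A) (rep A) = A.1 :=
  (exists_relMatrix_eq A).choose_spec

/-! ### The Dipper–James basis -/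

variable {R : Type} [CommRing R] {q : R}

theorem coef_dcSum (A : Mat n r) (w : Equiv.Perm (Fin r)) :
    coef R q r (dcSum R q A) w = if relMatrix (ro A) (co A) w = A.1 then 1 else 0 := by
  rw [dcSum, coef_sum_finset]
  simp

theorem gen_mul_dcSum {A : Mat n r} {i : Fin (r - 1)} (hi : Adj (ro A) i) :
    heckeGen R q r i * dcSum R q A = q • dcSum R q A := by
  rw [gen_mul_eq_smul_iff]
  intro w
  have := relMatrix_mul_mul (simpleTransp_mem_young hi) (one_mem_young (co A)) w
  rw [mul_one] at this
  simp only [coef_dcSum, this]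

theorem dcSum_mul_gen {A : Mat n r} {i : Fin (r - 1)} (hi : Adj (co A) i) :
    dcSum R q A * heckeGen R q r i = q • dcSum R q A := by
  rw [mul_gen_eq_smul_iff]
  intro w
  have := relMatrix_mul_mul (one_mem_young (ro A)) (simpleTransp_mem_young hi) w
  rw [one_mul] at this
  simp only [coef_dcSum, this]

theorem mem_xIdeal {l : WComp n r} {x : Hecke R q r} :
    x ∈ xIdeal R q l ↔ ∃ y, x = xElt R q l * y := by
  rw [Submodule.mem_span_singleton]
  constructor
  · rintro ⟨a, rfl⟩
    exact ⟨a.unop, rfl⟩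
  · rintro ⟨y, rfl⟩
    exact ⟨MulOpposite.op y, rfl⟩

/-- Left multiplication by `y` as a map of right ideals. -/
def leftMul {l m : WComp n r} (y : Hecke R q r) (h : y * xElt R q l ∈ xIdeal R q m) :
    xIdeal R q l →ₗ[(Hecke R q r)ᵐᵒᵖ] xIdeal R q m where
  toFun z := ⟨y * z.1, by
    obtain ⟨t, ht⟩ := mem_xIdeal.1 z.2
    rw [ht, ← mul_assoc]
    exact Submodule.smul_mem _ (MulOpposite.op t) h⟩
  map_add' z z' := Subtype.ext (mul_add _ _ _)
  map_smul' a z := Subtype.ext (mul_assoc y z.1 a.unop).symm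

/-- The double coset sum has coefficients invariant under both Young subgroups, so it lies in x_{ro
A} H and in H x_{co A}. Writing it as y x_{co A}, left multiplication by y is the required
homomorphism. -/
theorem exists_isDJ (R : Type) [CommRing R] (q : R) (A : Mat n r) :
    ∃ φ, IsDJ R q A φ := by
  obtain ⟨y, hy⟩ := exists_eq_mul_xElt (l := co A) (x := dcSum R q A) fun i hi => dcSum_mul_gen hi
  have hy' : y * xElt R q (co A) ∈ xIdeal R q (ro A) := by
    rw [← hy]
    exact mem_xIdeal.2 (exists_eq_xElt_mul fun i hi => gen_mul_dcSum hi)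
  refine ⟨(DirectSum.lof (Hecke R q r)ᵐᵒᵖ _ (fun l : WComp n r => xIdeal R q l) (ro A)) ∘ₗ
    leftMul y hy' ∘ₗ DirectSum.component (Hecke R q r)ᵐᵒᵖ _ _ (co A), ?_⟩
  intro ν κ
  simp only [LinearMap.comp_apply]
  rw [← DirectSum.lof_eq_of (Hecke R q r)ᵐᵒᵖ]
  by_cases hν : ν = co A
  · subst hν
    rw [DirectSum.component.lof_self]
    by_cases hκ : κ = ro A
    · subst hκ
      rw [if_pos ⟨rfl, rfl⟩, DirectSum.lof_apply, hy]
      rfl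
    · rw [if_neg (by tauto), DirectSum.lof_eq_of, DirectSum.of_eq_of_ne _ _ _ hκ]
      rfl
  · rw [if_neg (by tauto), DirectSum.lof_eq_of, DirectSum.lof_eq_of]
    have : (DirectSum.component (Hecke R q r)ᵐᵒᵖ (WComp n r) (fun l => xIdeal R q l) (co A))
        (DirectSum.of (fun l : WComp n r => xIdeal R q l) ν (xGen R q ν)) = 0 :=
      DirectSum.of_eq_of_ne _ _ _ (Ne.symm hν)
    rw [this, map_zero, map_zero]
    rfl

theorem isDJ_djElt (A : Mat n r) : IsDJ R q A (djElt R q A) := by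
  rw [djElt, dif_pos (exists_isDJ R q A)]
  exact (exists_isDJ R q A).choose_spec

/-- The component in `x_κ H` of the image of `x_ν`. -/
def ev (κ ν : WComp n r) : QSchur R q n r →ₗ[R] Hecke R q r where
  toFun φ := ((φ (DirectSum.of (fun l : WComp n r => xIdeal R q l) ν (xGen R q ν)) κ :
    xIdeal R q κ) : Hecke R q r)
  map_add' _ _ := rfl
  map_smul' _ _ := rfl

theorem ev_djElt (A : Mat n r) (κ ν : WComp n r) :
    ev κ ν (djElt R q A) = if ν = co A ∧ κ = ro A then dcSum R q A else 0 :=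
  isDJ_djElt A ν κ

theorem ev_ext {φ ψ : QSchur R q n r} (h : ∀ κ ν, ev κ ν φ = ev κ ν ψ) : φ = ψ := by
  refine DirectSum.linearMap_ext _ fun ν => ?_
  ext ⟨y, hy⟩ : 1
  obtain ⟨a, rfl⟩ := Submodule.mem_span_singleton.1 hy
  have e : (⟨a • xElt R q ν, hy⟩ : xIdeal R q ν) = a • xGen R q ν := rfl
  rw [e, map_smul, map_smul]
  congr 1
  exact DFinsupp.ext fun κ => Subtype.ext (h κ ν)

theorem exists_ev_eq (φ : QSchur R q n r) (κ ν : WComp n r) :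
    ∃ y, ev κ ν φ = xElt R q κ * y :=
  mem_xIdeal.1 (φ (DirectSum.of (fun l : WComp n r => xIdeal R q l) ν (xGen R q ν)) κ).2

theorem apply_of_smul (φ : QSchur R q n r) (κ ν : WComp n r) (y : Hecke R q r) :
    ((φ (DirectSum.of (fun l : WComp n r => xIdeal R q l) ν (MulOpposite.op y • xGen R q ν)) κ :
      xIdeal R q κ) : Hecke R q r) = ev κ ν φ * y := by
  rw [← DirectSum.lof_eq_of (Hecke R q r)ᵐᵒᵖ, map_smul, map_smul, DirectSum.lof_eq_of]
  rfl

theorem gen_mul_ev (φ : QSchur R q n r) (κ ν : WComp n r) {i : Fin (r - 1)} (hi : Adj κ i) :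
    heckeGen R q r i * ev κ ν φ = q • ev κ ν φ := by
  obtain ⟨y, hy⟩ := exists_ev_eq φ κ ν
  rw [hy, ← mul_assoc, gen_mul_xElt hi, smul_mul_assoc]

/-- Right linearity turns x_ν T_i = q x_ν into the same relation for the image of x_ν. With
`gen_mul_ev` it makes the coefficients of the image constant on double cosets, whence the
Dipper–James elements span. -/
theorem ev_mul_gen (φ : QSchur R q n r) (κ ν : WComp n r) {i : Fin (r - 1)} (hi : Adj ν i) :
    ev κ ν φ * heckeGen R q r i = q • ev κ ν φ := by
  have h : MulOpposite.op (heckeGen R q r i) • xGen R q ν =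
      MulOpposite.op (algebraMap R (Hecke R q r) q) • xGen R q ν := by
    apply Subtype.ext
    change xElt R q ν * heckeGen R q r i = xElt R q ν * algebraMap R _ q
    rw [xElt_mul_gen hi, Algebra.smul_def, Algebra.commutes]
  rw [← apply_of_smul, h, apply_of_smul, Algebra.smul_def, Algebra.commutes]

theorem coef_ev_congr (φ : QSchur R q n r) (κ ν : WComp n r) {w w' : Equiv.Perm (Fin r)}
    (h : relMatrix κ ν w = relMatrix κ ν w') :
    coef R q r (ev κ ν φ) w = coef R q r (ev κ ν φ) w' := by
  obtain ⟨u, hu, v, hv, rfl⟩ := exists_of_relMatrix_eq h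
  rw [mul_young_invariant (fun i hi w => mul_gen_eq_smul_iff.1 (ev_mul_gen φ κ ν hi) w) hv,
    young_mul_invariant (fun i hi w => gen_mul_eq_smul_iff.1 (gen_mul_ev φ κ ν hi) w) hu]

theorem coef_ev_sum (c : Mat n r → R) (κ ν : WComp n r) (w : Equiv.Perm (Fin r)) :
    coef R q r (ev κ ν (∑ A, c A • djElt R q A)) w = c (relMat κ ν w) := by
  simp only [map_sum, map_smul, ev_djElt, Finset.sum_apply, Pi.smul_apply]
  rw [Finset.sum_eq_single (relMat κ ν w)]
  · rw [ro_relMat, co_relMat, if_pos ⟨rfl, rfl⟩, coef_dcSum, ro_relMat, co_relMat]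
    simp [relMat]
  · intro A _ hA
    split_ifs with h
    · obtain ⟨rfl, rfl⟩ := h
      rw [coef_dcSum, if_neg, smul_zero]
      intro h
      exact hA (Subtype.ext h.symm)
    · simp
  · simp

theorem eq_sum_djElt (φ : QSchur R q n r) :
    φ = ∑ A, coef R q r (ev (ro A) (co A) φ) (rep A) • djElt R q A := by
  refine ev_ext fun κ ν => coef_injective (funext fun w => ?_)
  rw [coef_ev_sum, ro_relMat, co_relMat]
  refine coef_ev_congr φ κ ν ?_
  have := relMatrix_rep (relMat κ ν w)
  rw [ro_relMat, co_relMat] at this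
  exact this.symm

theorem relMat_rep (A : Mat n r) : relMat (ro A) (co A) (rep A) = A :=
  Subtype.ext (relMatrix_rep A)

variable (R q n r) in
/-- The Dipper–James basis of the `q`-Schur algebra. -/
def djBasis : Module.Basis (Mat n r) R (QSchur R q n r) :=
  Module.Basis.ofEquivFun (LinearEquiv.symm
    { toFun := fun c => ∑ A, c A • djElt R q A
      invFun := fun φ A => coef R q r (ev (ro A) (co A) φ) (rep A)
      map_add' := fun c d => by simp [add_smul, Finset.sum_add_distrib]
      map_smul' := fun c d => by simp [Finset.smul_sum, mul_smul]
      left_inv := fun c => by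
        funext A
        simp only
        rw [coef_ev_sum, relMat_rep]
      right_inv := fun φ => (eq_sum_djElt φ).symm })

theorem djBasis_apply (A : Mat n r) : djBasis n r R q A = djElt R q A := by
  classical
  rw [djBasis, Module.Basis.coe_ofEquivFun]
  simp [Pi.single_apply, ite_smul]

end DoubleCosets

/-! ### Change of the base ring -/

section Reduction

variable {R R' : Type} [CommRing R] [CommRing R'] {r : ℕ}

/-- Change of the base ring of the Hecke algebra. -/
def red (f : R →+* R') (q : R) (q' : R') (r : ℕ) : Hecke R q r →+ Hecke R' q' r where
  toFun x := ∑ w, f (coef R q r x w) • heckeT R' q' w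
  map_zero' := by simp
  map_add' x y := by simp [add_smul, Finset.sum_add_distrib]

variable {f : R →+* R'} {q : R} {q' : R'}

theorem coef_red (x : Hecke R q r) (w : Equiv.Perm (Fin r)) :
    coef R' q' r (red f q q' r x) w = f (coef R q r x w) :=
  congrFun (coef_sum (R := R') (q := q') fun w => f (coef R q r x w)) w

theorem red_heckeT (w : Equiv.Perm (Fin r)) :
    red f q q' r (heckeT R q w) = heckeT R' q' w := by
  apply coef_injective
  funext v
  rw [coef_red, coef_heckeT, coef_heckeT, Pi.single_apply, Pi.single_apply]
  split_ifs <;> simp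

theorem red_sum_heckeT (s : Finset (Equiv.Perm (Fin r))) :
    red f q q' r (∑ w ∈ s, heckeT R q w) = ∑ w ∈ s, heckeT R' q' w := by
  rw [map_sum]
  simp only [red_heckeT]

/-- It suffices to multiply on the left by generators and scalars; for generators the coefficient
formula `coef_gen_mul` involves the base ring only through q. -/
theorem red_mul (hq : f q = q') (x y : Hecke R q r) :
    red f q q' r (x * y) = red f q q' r x * red f q q' r y := by
  induction x using hecke_induction generalizing y with
  | hgen i =>
    rw [← heckeT_simpleTransp, red_heckeT, heckeT_simpleTransp, heckeT_simpleTransp]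
    apply coef_injective
    funext w
    rw [coef_red, coef_gen_mul, coef_gen_mul, coef_red, coef_red, ← hq]
    split_ifs <;> simp
  | hR c =>
    have key : ∀ y : Hecke R q r, red f q q' r (algebraMap R _ c * y) =
        algebraMap R' _ (f c) * red f q q' r y := by
      intro y
      apply coef_injective
      funext w
      rw [coef_red, ← Algebra.smul_def, ← Algebra.smul_def, map_smul, map_smul]
      simp [coef_red]
    have h1 := key 1
    have h2 : red f q q' r 1 = 1 := by rw [← heckeT_one, red_heckeT, heckeT_one]
    rw [h2, mul_one, mul_one] at h1
    rw [key, h1]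
  | hadd a b ha hb => rw [add_mul, map_add, ha, hb, map_add, add_mul]
  | hmul a b ha hb => rw [mul_assoc, ha, hb, ha, mul_assoc]

end Reduction

/-! ### The case `q = 0` -/

section Zero

variable {K : Type} [CommRing K] {n r : ℕ}

/-- At q = 0 the coefficient of T_i x vanishes wherever i is an ascent. A nontrivial u of the Young
subgroup starts with a T_i for which i is an ascent of every shortest representative. -/
theorem coef_heckeT_mul_eq_zero {κ : WComp n r} {u : Equiv.Perm (Fin r)} (hu : u ∈ young κ)
    (h1 : u ≠ 1) (x : Hecke K 0 r) {w : Equiv.Perm (Fin r)} (hw : LMin κ w) :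
    coef K 0 r (heckeT K 0 u * x) w = 0 := by
  obtain ⟨i, hi⟩ := exists_not_asc h1
  have hT := heckeGen_mul_heckeT_of_asc (R := K) (q := 0) (asc_simpleTransp_mul.2 hi)
  rw [simpleTransp_mul_cancel_left] at hT
  rw [← hT, mul_assoc, coef_gen_mul, if_pos (hw i (adj_of_not_asc hu hi)), zero_mul]

theorem coef_xElt_mul {κ : WComp n r} (x : Hecke K 0 r) {w : Equiv.Perm (Fin r)}
    (hw : LMin κ w) : coef K 0 r (xElt K 0 κ * x) w = coef K 0 r x w := by
  rw [xElt, Finset.sum_mul, map_sum, Finset.sum_apply,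
    Finset.sum_eq_single_of_mem 1 (one_mem_young κ), heckeT_one, one_mul]
  intro u hu h1
  exact coef_heckeT_mul_eq_zero hu h1 x hw

/-- By the preceding vanishing, multiplication by x_κ does not alter coefficients at shortest
representatives; it merely makes the function constant on cosets. Idempotency of x_κ is the case x =
y = x_κ. -/
theorem xElt_mul_eq {κ : WComp n r} {x y : Hecke K 0 r}
    (hy : ∀ u ∈ young κ, ∀ w, coef K 0 r y (u * w) = coef K 0 r y w)
    (hxy : ∀ w, LMin κ w → coef K 0 r y w = coef K 0 r x w) : xElt K 0 κ * x = y := by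
  apply coef_injective
  funext w
  obtain ⟨u, hu, d, hd, rfl⟩ := exists_young_mul_lMin κ w
  rw [hy u hu, hxy d hd, ← coef_xElt_mul x hd]
  refine young_mul_invariant (fun i hi w => gen_mul_eq_smul_iff.1 ?_ w) hu d
  rw [← mul_assoc, gen_mul_xElt hi, smul_mul_assoc]

theorem xElt_mul_xElt (κ : WComp n r) : xElt K 0 κ * xElt K 0 κ = xElt K 0 κ := by
  refine xElt_mul_eq (fun u hu w => ?_) fun _ _ => rfl
  exact young_mul_invariant (fun i hi w => gen_mul_eq_smul_iff.1 (gen_mul_xElt hi) w) hu w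

end Zero

/-! ### A basis of the `0`-Schur algebra -/

section Basis

variable {n r : ℕ}

/-- `ℤ[X] / (X) ≃ ℤ`. -/
def quotX : (ℤ[X] ⧸ Ideal.span {(Polynomial.X : ℤ[X])}) ≃+* ℤ :=
  (Ideal.quotEquivOfEq (by rw [map_zero, sub_zero])).trans
    (Polynomial.quotientSpanXSubCAlgEquiv (0 : ℤ)).toRingEquiv

variable (n r) in
/-- The Dipper–James basis over `ℤ`, as a basis of the tensor product. -/
def tensorBasis : Module.Basis (Mat n r) ℤ
    ((ℤ[X] ⧸ Ideal.span {(Polynomial.X : ℤ[X])}) ⊗[ℤ[X]] GenericSchur n r) :=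
  (Algebra.TensorProduct.basis (ℤ[X] ⧸ Ideal.span {(Polynomial.X : ℤ[X])})
    (djBasis n r ℤ[X] Polynomial.X)).mapCoeffs quotX fun c x => by
      have : c = ((quotX c : ℤ) : ℤ[X] ⧸ Ideal.span {(Polynomial.X : ℤ[X])}) := by
        apply quotX.injective
        rw [map_intCast]
        rfl
      conv_rhs => rw [this]
      exact (Int.cast_smul_eq_zsmul _ _ _).symm

theorem tensorBasis_apply (A : Mat n r) :
    tensorBasis n r A = 1 ⊗ₜ[ℤ[X]] djElt ℤ[X] Polynomial.X A := by
  rw [tensorBasis, Module.Basis.mapCoeffs_apply, Algebra.TensorProduct.basis_apply, djBasis_apply]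

variable (n r) in
/-- The Dipper–James basis over `ℤ`. -/
def zBasis : Module.Basis (Mat n r) ℤ (ZSchur n r) := tensorBasis n r

theorem zBasis_apply (A : Mat n r) :
    zBasis n r A = ZSchur.of (djElt ℤ[X] Polynomial.X A) := tensorBasis_apply A

variable (n r) in
/-- The Dipper–James basis over `ℂ`. -/
def cBasis : Module.Basis (Mat n r) ℂ (CSchur n r) := Algebra.TensorProduct.basis ℂ (zBasis n r)

/-- The specialisation `S_q(n, r) → 𝐒₀(n, r)`. -/
def sp : GenericSchur n r →+* CSchur n r :=
  (Algebra.TensorProduct.includeRight : ZSchur n r →ₐ[ℤ] CSchur n r).toRingHom.comp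
    (Algebra.TensorProduct.includeRight : GenericSchur n r →ₐ[ℤ[X]]
      ((ℤ[X] ⧸ Ideal.span {(Polynomial.X : ℤ[X])}) ⊗[ℤ[X]] GenericSchur n r)).toRingHom

theorem sp_apply (φ : GenericSchur n r) : sp φ = (1 : ℂ) ⊗ₜ[ℤ] ZSchur.of φ := rfl

theorem cBasis_apply (A : Mat n r) : cBasis n r A = sp (djElt ℤ[X] Polynomial.X A) := by
  rw [cBasis, Algebra.TensorProduct.basis_apply, zBasis_apply, sp_apply]

/-- Evaluation of polynomials at `0`. -/
def evalZero : ℤ[X] →+* ℂ := (Int.castRingHom ℂ).comp (Polynomial.evalRingHom 0)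

theorem evalZero_X : evalZero Polynomial.X = 0 := by simp [evalZero]

theorem sp_smul (c : ℤ[X]) (φ : GenericSchur n r) : sp (c • φ) = evalZero c • sp φ := by
  have h : ZSchur.of (c • φ) = (Polynomial.eval 0 c : ℤ) • ZSchur.of φ := by
    have h1 : (Ideal.Quotient.mk (Ideal.span {(Polynomial.X : ℤ[X])}) c) =
        ((Polynomial.eval 0 c : ℤ) : ℤ[X] ⧸ Ideal.span {(Polynomial.X : ℤ[X])}) := by
      rw [← map_intCast (Ideal.Quotient.mk (Ideal.span {(Polynomial.X : ℤ[X])})),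
        Ideal.Quotient.eq, Ideal.mem_span_singleton, Polynomial.X_dvd_iff]
      simp [Polynomial.coeff_zero_eq_eval_zero]
    have h2 : (1 : ℤ[X] ⧸ Ideal.span {(Polynomial.X : ℤ[X])}) ⊗ₜ[ℤ[X]] (c • φ) =
        (Polynomial.eval 0 c : ℤ) •
          ((1 : ℤ[X] ⧸ Ideal.span {(Polynomial.X : ℤ[X])}) ⊗ₜ[ℤ[X]] φ) := by
      rw [← TensorProduct.smul_tmul, TensorProduct.smul_tmul', zsmul_eq_mul, mul_one, ← h1]
      exact congrArg (· ⊗ₜ[ℤ[X]] φ) (Algebra.algebraMap_eq_smul_one c).symm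
    exact h2
  rw [sp_apply, h, TensorProduct.tmul_smul, sp_apply, evalZero]
  simp only [RingHom.comp_apply, Polynomial.coe_evalRingHom, eq_intCast]
  exact (Int.cast_smul_eq_zsmul _ _ _).symm

theorem repr_sp (φ : GenericSchur n r) (A : Mat n r) : (cBasis n r).repr (sp φ) A =
    evalZero (coef ℤ[X] Polynomial.X r (ev (ro A) (co A) φ) (rep A)) := by
  conv_lhs => rw [eq_sum_djElt φ, map_sum]
  simp only [sp_smul, ← cBasis_apply]
  rw [(cBasis n r).repr_sum_self]

/-! ### Realisation by matrices over the `0`-Hecke algebra -/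

/-- The component `x_ν H → x_κ H` of an element of the `0`-Schur algebra, as the image of `x_ν`. -/
def evC (κ ν : WComp n r) : CSchur n r →ₗ[ℂ] Hecke ℂ 0 r where
  toFun a := ∑ w, (cBasis n r).repr a (relMat κ ν w) • heckeT ℂ 0 w
  map_add' a b := by simp [add_smul, Finset.sum_add_distrib]
  map_smul' c a := by simp [mul_smul, Finset.smul_sum]

theorem coef_evC (κ ν : WComp n r) (a : CSchur n r) (w : Equiv.Perm (Fin r)) :
    coef ℂ 0 r (evC κ ν a) w = (cBasis n r).repr a (relMat κ ν w) :=
  congrFun (coef_sum (R := ℂ) (q := 0) fun w => (cBasis n r).repr a (relMat κ ν w)) w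

theorem evC_ext {a b : CSchur n r} (h : ∀ κ ν, evC κ ν a = evC κ ν b) : a = b := by
  apply (cBasis n r).repr.injective
  ext A
  have := congrFun (congrArg (coef ℂ 0 r) (h (ro A) (co A))) (rep A)
  rwa [coef_evC, coef_evC, relMat_rep] at this

theorem evC_sp (κ ν : WComp n r) (φ : GenericSchur n r) :
    evC κ ν (sp φ) = red evalZero Polynomial.X 0 r (ev κ ν φ) := by
  apply coef_injective
  funext w
  rw [coef_evC, coef_red, repr_sp, ro_relMat, co_relMat]
  congr 1
  refine coef_ev_congr φ κ ν ?_
  have := relMatrix_rep (relMat κ ν w)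
  rwa [ro_relMat, co_relMat] at this

theorem red_xElt (κ : WComp n r) :
    red evalZero Polynomial.X 0 r (xElt ℤ[X] Polynomial.X κ) = xElt ℂ 0 κ := red_sum_heckeT _

/-- Composition sends x_μ y to φ(x_μ) y, whereas the matrix product has φ(x_μ) x_μ y. These agree at
q = 0, because φ(x_μ) has the form z x_μ and x_μ is idempotent. -/
theorem evC_sp_mul (κ ν : WComp n r) (φ ψ : GenericSchur n r) :
    evC κ ν (sp φ * sp ψ) = ∑ μ, evC κ μ (sp φ) * evC μ ν (sp ψ) := by
  classical
  rw [← map_mul, evC_sp]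
  choose y hy using fun μ => exists_ev_eq ψ μ ν
  choose z hz using fun μ => exists_eq_mul_xElt (l := μ) (x := ev κ μ φ) fun i hi =>
    ev_mul_gen φ κ μ hi
  have h1 : ev κ ν (φ * ψ) = ∑ μ, ev κ μ φ * y μ := by
    have h2 : ψ (DirectSum.of (fun l : WComp n r => xIdeal ℤ[X] Polynomial.X l) ν
        (xGen ℤ[X] Polynomial.X ν)) = ∑ μ, DirectSum.of
          (fun l : WComp n r => xIdeal ℤ[X] Polynomial.X l) μ
            (MulOpposite.op (y μ) • xGen ℤ[X] Polynomial.X μ) := by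
      conv_lhs => rw [← DirectSum.sum_univ_of (ψ _)]
      refine Finset.sum_congr rfl fun μ _ => ?_
      congr 1
      exact Subtype.ext (hy μ)
    have h3 : ev κ ν (φ * ψ) = ((φ (ψ (DirectSum.of
        (fun l : WComp n r => xIdeal ℤ[X] Polynomial.X l) ν
          (xGen ℤ[X] Polynomial.X ν))) κ : xIdeal ℤ[X] Polynomial.X κ) :
            Hecke ℤ[X] Polynomial.X r) := rfl
    rw [h3, h2, map_sum, DirectSum.sum_apply, Submodule.coe_sum]
    exact Finset.sum_congr rfl fun μ _ => apply_of_smul φ κ μ (y μ)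
  rw [h1, map_sum]
  refine Finset.sum_congr rfl fun μ _ => ?_
  rw [evC_sp, evC_sp, hy, hz]
  simp only [red_mul evalZero_X, red_xElt]
  conv_rhs => rw [mul_assoc, ← mul_assoc (xElt ℂ 0 μ), xElt_mul_xElt]
  rw [mul_assoc]

theorem cBasis_induction {p : CSchur n r → Prop} (zero : p 0)
    (add : ∀ a b, p a → p b → p (a + b)) (smul : ∀ (c : ℂ) a, p a → p (c • a))
    (basis : ∀ A, p (cBasis n r A)) (a : CSchur n r) : p a := by
  induction (cBasis n r).mem_span a using Submodule.span_induction with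
  | mem x hx =>
    obtain ⟨A, rfl⟩ := hx
    exact basis A
  | zero => exact zero
  | add x y _ _ hx hy => exact add x y hx hy
  | smul c x _ hx => exact smul c x hx

theorem evC_mul (κ ν : WComp n r) (a b : CSchur n r) :
    evC κ ν (a * b) = ∑ μ, evC κ μ a * evC μ ν b := by
  induction a using cBasis_induction with
  | zero => simp
  | add a a' ha ha' => simp only [add_mul, map_add, ha, ha', Finset.sum_add_distrib]
  | smul c a ha => simp only [smul_mul_assoc, map_smul, ha, Finset.smul_sum]
  | basis A =>
  induction b using cBasis_induction with
  | zero => simp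
  | add a a' ha ha' => simp only [mul_add, map_add, ha, ha', Finset.sum_add_distrib]
  | smul c a ha => simp only [mul_smul_comm, map_smul, ha, Finset.smul_sum]
  | basis B => rw [cBasis_apply, cBasis_apply, evC_sp_mul]

end Basis

/-! ### Corner sums -/

section Corner

variable {n r : ℕ}

theorem psum_add (f g : Fin n → ℕ) (a : ℕ) :
    psum (fun k => f k + g k) a = psum f a + psum g a := Finset.sum_add_distrib

theorem psum_indicator (p : Fin n) (c a : ℕ) :
    psum (fun k => if k = p then c else 0) a = if (p : ℕ) < a then c else 0 := by
  simp [psum, Finset.sum_ite_eq']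

theorem psum_le_psum {f g : Fin n → ℕ} (h : ∀ k, f k ≤ g k) (a : ℕ) : psum f a ≤ psum g a :=
  Finset.sum_le_sum fun k _ => h k

/-- The sum of the entries in the first `a` rows and `b` columns. -/
def corner (A : Matrix (Fin n) (Fin n) ℕ) (a b : ℕ) : ℕ := psum (fun k => psum (A k) b) a

theorem psum_row (A : Mat n r) (k : Fin n) {b : ℕ} (h : n ≤ b) : psum (A.1 k) b = (ro A).1 k := by
  rw [psum, Finset.filter_true_of_mem fun l _ => by omega]
  rfl

theorem psum_row_le (A : Mat n r) (k : Fin n) (b : ℕ) : psum (A.1 k) b ≤ (ro A).1 k :=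
  (psum_mono _ (le_max_left b n)).trans (psum_row A k (le_max_right b n)).le

theorem corner_swap (A : Matrix (Fin n) (Fin n) ℕ) (a b : ℕ) :
    corner A a b = psum (fun l => psum (fun k => A k l) a) b := by
  simp only [corner, psum]
  exact Finset.sum_comm

theorem corner_of_le_right (A : Mat n r) (a : ℕ) {b : ℕ} (h : n ≤ b) :
    corner A.1 a b = psum (ro A).1 a := by
  rw [corner]
  congr 1
  funext k
  exact psum_row A k h

theorem corner_of_le_left (A : Mat n r) {a : ℕ} (b : ℕ) (h : n ≤ a) :
    corner A.1 a b = psum (co A).1 b := by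
  rw [corner_swap]
  congr 1
  funext k
  rw [psum, Finset.filter_true_of_mem fun l _ => by omega]
  rfl

theorem corner_mono_left (A : Matrix (Fin n) (Fin n) ℕ) {a a' : ℕ} (h : a ≤ a') (b : ℕ) :
    corner A a b ≤ corner A a' b := psum_mono _ h

theorem corner_mono_right (A : Matrix (Fin n) (Fin n) ℕ) (a : ℕ) {b b' : ℕ} (h : b ≤ b') :
    corner A a b ≤ corner A a b' := psum_le_psum (fun _ => psum_mono _ h) a

theorem corner_le_ro (A : Mat n r) (a b : ℕ) : corner A.1 a b ≤ psum (ro A).1 a :=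
  psum_le_psum (fun k => psum_row_le A k b) a

theorem corner_le_co (A : Mat n r) (a b : ℕ) : corner A.1 a b ≤ psum (co A).1 b :=
  (corner_mono_left _ (le_max_left a n) b).trans (corner_of_le_left A b (le_max_right a n)).le

theorem corner_succ (A : Matrix (Fin n) (Fin n) ℕ) (i : Fin n) (b : ℕ) :
    corner A (i + 1) b = corner A i b + psum (A i) b := psum_succ _ i

theorem corner_ext {A C : Matrix (Fin n) (Fin n) ℕ} (h : ∀ a b, corner A a b = corner C a b) :
    A = C := by
  funext i
  refine psum_ext fun b => ?_
  have h1 := corner_succ A i b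
  have h2 := corner_succ C i b
  rw [h, h] at h1
  omega

/-- The additional corners, empty or with all rows or columns, are determined by the row and column
sums. Having them available lets adjacent corners be compared without boundary cases. -/
theorem orbitLE_iff {C A : Mat n r} : OrbitLE C A ↔
    ro C = ro A ∧ co C = co A ∧ ∀ a b, corner A.1 a b ≤ corner C.1 a b := by
  have key : ∀ (A : Matrix (Fin n) (Fin n) ℕ) (i j : Fin n),
      ∑ k ∈ Finset.Iic i, ∑ l ∈ Finset.Iic j, A k l = corner A (i + 1) (j + 1) := by
    intro A i j
    have h2 : ∀ i : Fin n, Finset.Iic i =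
        Finset.univ.filter fun k : Fin n => (k : ℕ) < i + 1 := by
      intro i
      ext k
      simp only [Finset.mem_Iic, Finset.mem_filter, Finset.mem_univ, true_and, Fin.le_def]
      omega
    rw [h2, h2]
    rfl
  simp only [OrbitLE, key]
  refine and_congr_right fun hr => and_congr_right fun hc => ⟨fun h a b => ?_, fun h i j => h _ _⟩
  by_cases ha : n ≤ a
  · rw [corner_of_le_left A b ha, corner_of_le_left C b ha, hc]
  by_cases hb : n ≤ b
  · rw [corner_of_le_right A a hb, corner_of_le_right C a hb, hr]
  rcases a with _ | a
  · simp [corner]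
  rcases b with _ | b
  · rw [corner_swap]
    simp
  exact h ⟨a, by omega⟩ ⟨b, by omega⟩

theorem OrbitLE.refl (A : Mat n r) : OrbitLE A A := ⟨rfl, rfl, fun _ _ => le_rfl⟩

theorem OrbitLE.trans {A B C : Mat n r} (h : OrbitLE A B) (h' : OrbitLE B C) : OrbitLE A C :=
  ⟨h.1.trans h'.1, h.2.1.trans h'.2.1, fun i j => (h'.2.2 i j).trans (h.2.2 i j)⟩

theorem OrbitLE.antisymm {A B : Mat n r} (h : OrbitLE A B) (h' : OrbitLE B A) : A = B :=
  Subtype.ext <| corner_ext fun a b =>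
    le_antisymm ((orbitLE_iff.1 h').2.2 a b) ((orbitLE_iff.1 h).2.2 a b)

/-- The number of letters among the first `c` ones which `w⁻¹` maps to the first `b` blocks. -/
def cnt (m : WComp n r) (w : Equiv.Perm (Fin r)) (c b : ℕ) : ℕ :=
  (Finset.univ.filter fun x : Fin r => (x : ℕ) < c ∧ (bl m (w⁻¹ x) : ℕ) < b).card

theorem corner_relMatrix (l m : WComp n r) (w : Equiv.Perm (Fin r)) (a b : ℕ) :
    corner (relMatrix l m w) a b = cnt m w (psum l.1 a) b := by
  rw [cnt, corner, psum]
  have h1 : ∀ x : Fin r, (x : ℕ) < psum l.1 a ↔ (bl l x : ℕ) < a := fun x => bl_lt_iff.symm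
  simp only [h1]
  rw [Finset.card_eq_sum_card_fiberwise (f := bl l)
    (t := Finset.univ.filter fun k : Fin n => (k : ℕ) < a) (by
      intro x hx
      simp only [Finset.coe_filter, Finset.mem_univ, true_and, Set.mem_ofPred_eq] at hx ⊢
      exact hx.1)]
  refine Finset.sum_congr rfl fun k hk => ?_
  simp only [Finset.mem_filter, Finset.mem_univ, true_and] at hk
  rw [psum, Finset.card_eq_sum_card_fiberwise (f := fun x => bl m (w⁻¹ x))
    (t := Finset.univ.filter fun k : Fin n => (k : ℕ) < b) (by
      intro x hx
      simp only [Finset.coe_filter, Finset.mem_univ, true_and, Set.mem_ofPred_eq,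
        Finset.mem_filter] at hx ⊢
      exact hx.1.2)]
  refine Finset.sum_congr rfl fun j hj => ?_
  simp only [Finset.mem_filter, Finset.mem_univ, true_and] at hj
  rw [relMatrix_apply]
  congr 1
  ext x
  simp only [Finset.mem_filter, Finset.mem_univ, true_and]
  constructor
  · rintro ⟨rfl, rfl⟩
    exact ⟨⟨⟨hk, hj⟩, rfl⟩, rfl⟩
  · rintro ⟨⟨-, h2⟩, h3⟩
    exact ⟨h2, h3⟩

theorem cnt_mono (m : WComp n r) (w : Equiv.Perm (Fin r)) {c c' : ℕ} (h : c ≤ c') (b : ℕ) :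
    cnt m w c b ≤ cnt m w c' b := by
  refine Finset.card_le_card fun x hx => ?_
  simp only [Finset.mem_filter, Finset.mem_univ, true_and] at hx ⊢
  exact ⟨hx.1.trans_le h, hx.2⟩

theorem cnt_succ (m : WComp n r) (w : Equiv.Perm (Fin r)) (x : Fin r) (b : ℕ) :
    cnt m w (x + 1) b = cnt m w x b + if (bl m (w⁻¹ x) : ℕ) < b then 1 else 0 := by
  rw [cnt, cnt]
  split_ifs with h
  · rw [← Finset.card_insert_of_notMem (a := x) (by simp)]
    refine congrArg Finset.card (Finset.ext fun y => ?_)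
    simp only [Finset.mem_insert, Finset.mem_filter, Finset.mem_univ, true_and]
    constructor
    · rintro ⟨h1, h2⟩
      by_cases hy : y = x
      · exact Or.inl hy
      · rw [Fin.ext_iff] at hy
        exact Or.inr ⟨by omega, h2⟩
    · rintro (rfl | ⟨h1, h2⟩)
      · exact ⟨by omega, h⟩
      · exact ⟨by omega, h2⟩
  · rw [add_zero]
    refine congrArg Finset.card (Finset.ext fun y => ?_)
    simp only [Finset.mem_filter, Finset.mem_univ, true_and]
    constructor
    · rintro ⟨h1, h2⟩
      have : y ≠ x := by rintro rfl; exact h h2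
      rw [Ne, Fin.ext_iff] at this
      exact ⟨by omega, h2⟩
    · rintro ⟨h1, h2⟩
      exact ⟨by omega, h2⟩

theorem cnt_add_le (m : WComp n r) (w : Equiv.Perm (Fin r)) (c d b : ℕ) (h : c + d ≤ r) :
    cnt m w (c + d) b ≤ cnt m w c b + d := by
  induction d with
  | zero => simp
  | succ d ih =>
    have h1 := cnt_succ m w ⟨c + d, by omega⟩ b
    have h2 := ih (by omega)
    rw [← add_assoc]
    simp only at h1
    split_ifs at h1 <;> omega

theorem cnt_add_of_forall_lt (m : WComp n r) (w : Equiv.Perm (Fin r)) (c d b : ℕ) (h : c + d ≤ r)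
    (hb : ∀ x : Fin r, c ≤ x → (x : ℕ) < c + d → (bl m (w⁻¹ x) : ℕ) < b) :
    cnt m w (c + d) b = cnt m w c b + d := by
  induction d with
  | zero => simp
  | succ d ih =>
    have h1 := cnt_succ m w ⟨c + d, by omega⟩ b
    have h2 := ih (by omega) fun x hx hx' => hb x hx (by omega)
    rw [if_pos (hb ⟨c + d, by omega⟩ (by simp) (by simp))] at h1
    rw [← add_assoc]
    simp only at h1
    omega

theorem cnt_add_of_forall_not_lt (m : WComp n r) (w : Equiv.Perm (Fin r)) (c d b : ℕ)
    (h : c + d ≤ r) (hb : ∀ x : Fin r, c ≤ x → (x : ℕ) < c + d → ¬ (bl m (w⁻¹ x) : ℕ) < b) :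
    cnt m w (c + d) b = cnt m w c b := by
  induction d with
  | zero => simp
  | succ d ih =>
    have h1 := cnt_succ m w ⟨c + d, by omega⟩ b
    have h2 := ih (by omega) fun x hx hx' => hb x hx (by omega)
    rw [if_neg (hb ⟨c + d, by omega⟩ (by simp) (by simp))] at h1
    rw [← add_assoc]
    simp only at h1
    omega

theorem orbitLE_relMat_iff {l m : WComp n r} {w : Equiv.Perm (Fin r)} {A : Mat n r} :
    OrbitLE (relMat l m w) A ↔
      l = ro A ∧ m = co A ∧ ∀ a b, corner A.1 a b ≤ cnt m w (psum l.1 a) b := by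
  rw [orbitLE_iff, ro_relMat, co_relMat]
  simp only [relMat, corner_relMatrix]

/-! ### Elementary moves -/

/-- `A'` arises from `A` by moving a unit of the last nonzero entry of row `i'` to row `i`. -/
def Up (i i' : Fin n) (A A' : Mat n r) : Prop :=
  ∃ p, 0 < A.1 i' p ∧ (∀ j, p < j → A.1 i' j = 0) ∧
    ∀ k l, A'.1 k l + (if k = i' then if l = p then 1 else 0 else 0) =
      A.1 k l + if k = i then if l = p then 1 else 0 else 0

/-- `A'` arises from `A` by moving a unit of the first nonzero entry of row `i` to row `i'`. -/
def Down (i i' : Fin n) (A A' : Mat n r) : Prop :=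
  ∃ p, 0 < A.1 i p ∧ (∀ j, j < p → A.1 i j = 0) ∧
    ∀ k l, A'.1 k l + (if k = i then if l = p then 1 else 0 else 0) =
      A.1 k l + if k = i' then if l = p then 1 else 0 else 0

theorem psum_single (i p : Fin n) (k : Fin n) (b : ℕ) :
    psum (fun l => if k = i then if l = p then 1 else 0 else 0) b =
      if k = i then if (p : ℕ) < b then 1 else 0 else 0 := by
  by_cases h : k = i
  · simp only [h, if_true, psum_indicator]
  · simp [h, psum]

theorem corner_move {A A' : Mat n r} {i i' p : Fin n}
    (h : ∀ k l, A'.1 k l + (if k = i' then if l = p then 1 else 0 else 0) =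
      A.1 k l + if k = i then if l = p then 1 else 0 else 0) (a b : ℕ) :
    corner A'.1 a b + (if (i' : ℕ) < a then if (p : ℕ) < b then 1 else 0 else 0) =
      corner A.1 a b + if (i : ℕ) < a then if (p : ℕ) < b then 1 else 0 else 0 := by
  have key : ∀ k, psum (A'.1 k) b + (if k = i' then if (p : ℕ) < b then 1 else 0 else 0) =
      psum (A.1 k) b + if k = i then if (p : ℕ) < b then 1 else 0 else 0 := by
    intro k
    rw [← psum_single, ← psum_single, ← psum_add, ← psum_add]
    exact congrArg (psum · b) (funext fun l => h k l)
  have h2 := congrArg (psum · a) (funext key)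
  simp only [psum_add, psum_indicator] at h2
  exact h2

theorem ro_move {A A' : Mat n r} {i i' p : Fin n}
    (h : ∀ k l, A'.1 k l + (if k = i' then if l = p then 1 else 0 else 0) =
      A.1 k l + if k = i then if l = p then 1 else 0 else 0) (a : ℕ) :
    psum (ro A').1 a + (if (i' : ℕ) < a then 1 else 0) =
      psum (ro A).1 a + if (i : ℕ) < a then 1 else 0 := by
  have := corner_move h a n
  rwa [corner_of_le_right _ _ le_rfl, corner_of_le_right _ _ le_rfl, if_pos p.2] at this

theorem co_move {A A' : Mat n r} {i i' p : Fin n}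
    (h : ∀ k l, A'.1 k l + (if k = i' then if l = p then 1 else 0 else 0) =
      A.1 k l + if k = i then if l = p then 1 else 0 else 0) : co A' = co A := by
  refine Subtype.ext (psum_ext fun b => ?_)
  have := corner_move h n b
  rw [corner_of_le_left _ _ le_rfl, corner_of_le_left _ _ le_rfl, if_pos i.2, if_pos i'.2] at this
  omega

theorem Up.co_eq {i i' : Fin n} {A A' : Mat n r} (h : Up i i' A A') : co A' = co A := by
  obtain ⟨p, -, -, h⟩ := h
  exact co_move h

theorem Down.co_eq {i i' : Fin n} {A A' : Mat n r} (h : Down i i' A A') : co A' = co A := by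
  obtain ⟨p, -, -, h⟩ := h
  exact co_move h

theorem Up.psum_ro {i i' : Fin n} (hi : (i : ℕ) + 1 = i') {A A' : Mat n r} (h : Up i i' A A')
    (a : ℕ) : psum (ro A').1 a = psum (ro A).1 a + if a = i + 1 then 1 else 0 := by
  obtain ⟨p, -, -, h⟩ := h
  have := ro_move h a
  split_ifs at * <;> omega

theorem Down.psum_ro {i i' : Fin n} (hi : (i : ℕ) + 1 = i') {A A' : Mat n r}
    (h : Down i i' A A') (a : ℕ) :
    psum (ro A').1 a + (if a = i + 1 then 1 else 0) = psum (ro A).1 a := by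
  obtain ⟨p, -, -, h⟩ := h
  have := ro_move h a
  split_ifs at * <;> omega

/-! ### Elementary moves and the orbit order on shortest coset representatives. -/

theorem psum_eq_of_last {f : Fin n → ℕ} {p : Fin n} (h : ∀ j, p < j → f j = 0) {b : ℕ}
    (hb : (p : ℕ) < b) : psum f b = psum f n := by
  refine Finset.sum_subset_zero_on_sdiff (fun k hk => by simp) ?_ fun _ _ => rfl
  intro k hk
  simp only [Finset.mem_sdiff, Finset.mem_filter, Finset.mem_univ, true_and] at hk
  exact h k (Fin.lt_def.2 (by omega))

theorem psum_eq_zero_of_first {f : Fin n → ℕ} {p : Fin n} (h : ∀ j, j < p → f j = 0) {b : ℕ}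
    (hb : b ≤ p) : psum f b = 0 := by
  refine Finset.sum_eq_zero fun k hk => ?_
  simp only [Finset.mem_filter, Finset.mem_univ, true_and] at hk
  exact h k (Fin.lt_def.2 (by omega))

theorem lMin_bl_lt {κ ν : WComp n r} {w : Equiv.Perm (Fin r)} (hw : LMin κ w) {i : Fin n}
    {x y : Fin r} {b : ℕ} (hx : psum κ.1 i ≤ x) (hxy : x ≤ y) (hy : (y : ℕ) < psum κ.1 (i + 1))
    (h : (bl ν (w⁻¹ y) : ℕ) < b) : (bl ν (w⁻¹ x) : ℕ) < b := by
  rcases hxy.eq_or_lt with rfl | hlt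
  · exact h
  have h1 : bl κ x = i :=
    mem_block_iff.1 (mem_block.2 ⟨hx, lt_of_le_of_lt (Fin.le_def.1 hxy) hy⟩)
  have h2 : bl κ y = i := mem_block_iff.1 (mem_block.2 ⟨hx.trans (Fin.le_def.1 hxy), hy⟩)
  exact lt_of_le_of_lt (Fin.le_def.1 (bl_mono ν (hw.lt hlt (h1.trans h2.symm)).le)) h

/-- For shortest representatives w, the map w⁻¹ increases on blocks. The two conditions differ only
in the inequalities for the first i + 1 rows, where the block boundary shifts by one letter; either
version follows with the help of the neighbouring inequalities, for i and for i' + 1 rows. Hence e_i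
e_A will be a single basis element. -/
theorem Up.orbitLE_iff {i i' : Fin n} (hi : (i : ℕ) + 1 = i') {A A' : Mat n r}
    (h : Up i i' A A') {w : Equiv.Perm (Fin r)} (hw : LMin (ro A') w) :
    OrbitLE (relMat (ro A') (co A) w) A' ↔ OrbitLE (relMat (ro A) (co A) w) A := by
  have hps := h.psum_ro hi
  have hco := h.co_eq
  obtain ⟨p, hp0, hp, hA⟩ := h
  have hc := corner_move hA
  rw [orbitLE_relMat_iff, orbitLE_relMat_iff]
  simp only [hco, true_and]
  set K := psum (ro A').1 with hK
  set Λ := psum (ro A).1 with hΛ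
  have hK1 : K (i + 1) = Λ (i + 1) + 1 := by rw [hps, if_pos rfl]
  have hKne : ∀ a : ℕ, a ≠ i + 1 → K a = Λ a := fun a ha => by rw [hps, if_neg ha, add_zero]
  have hc1 : ∀ b, corner A'.1 (i + 1) b = corner A.1 (i + 1) b + if (p : ℕ) < b then 1 else 0 := by
    intro b
    have := hc (i + 1) b
    rwa [if_neg (show ¬ (i' : ℕ) < i + 1 by omega), if_pos (show (i : ℕ) < i + 1 by omega),
      add_zero] at this
  have hcne : ∀ a b : ℕ, a ≠ i + 1 → corner A'.1 a b = corner A.1 a b := by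
    intro a b ha
    have := hc a b
    by_cases h1 : (i : ℕ) < a
    · rw [if_pos h1, if_pos (show (i' : ℕ) < a by omega)] at this
      omega
    · rw [if_neg h1, if_neg (show ¬ (i' : ℕ) < a by omega)] at this
      omega
  have hrow : Λ (i' + 1) = Λ (i + 1) + (ro A).1 i' := by rw [hΛ, psum_succ, hi]
  have hrowi : Λ (i + 1) = Λ i + (ro A).1 i := psum_succ _ i
  have hKr : K (i + 1) ≤ r := psum_le _ _
  have hΛr : Λ (i' + 1) ≤ r := psum_le _ _
  have hpos : 1 ≤ (ro A).1 i' := by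
    have h1 := psum_row_le A i' (p + 1)
    have h2 := psum_succ (A.1 i') p
    omega
  constructor
  · intro H a b
    by_cases ha : a = i + 1
    · subst ha
      have H1 := H (i + 1) b
      rw [hK1] at H1
      -- This is the last letter of block i of `ro A'`, the one missing from block i of `ro A`. If
      -- it is counted, so is the whole of that smaller block, which bounds row i; if not, dropping
      -- it changes no count.
      have hs := cnt_succ (co A) w ⟨Λ (i + 1), by omega⟩ b
      simp only at hs
      split_ifs at hs with hb
      · have H0 := H i b
        rw [hKne i (by omega), hcne i b (by omega)] at H0
        have hfull := cnt_add_of_forall_lt (co A) w (Λ i) ((ro A).1 i) b (by omega) (by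
          intro x hx1 hx2
          refine lMin_bl_lt (i := i) hw ?_ (Fin.le_def.2 ?_) ?_ hb
          · change K i ≤ x
            rw [hKne i (by omega)]
            exact hx1
          · simp only
            omega
          · change Λ (i + 1) < K (i + 1)
            omega)
        rw [← hrowi] at hfull
        rw [hfull, corner_succ]
        have := psum_row_le A i b
        omega
      · rw [hc1] at H1
        omega
    · rw [← hcne a b ha, ← hKne a ha]
      exact H a b
  · intro H a b
    by_cases ha : a = i + 1
    · subst ha
      rw [hc1, hK1]
      split_ifs with hb
      -- Row i' of A lies within the first b columns. So the corner gains the full row sum between i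
      -- + 1 and i' + 1, while the count gains at most one less on the letters after the added one.
      · have H2 := H (i' + 1) b
        have h1 : corner A.1 (i' + 1) b = corner A.1 (i + 1) b + (ro A).1 i' := by
          rw [corner_succ, hi, psum_eq_of_last hp hb, psum_row A i' le_rfl]
        have h2 := cnt_add_le (co A) w (Λ (i + 1) + 1) ((ro A).1 i' - 1) b (by omega)
        have h3 : Λ (i + 1) + 1 + ((ro A).1 i' - 1) = Λ (i' + 1) := by omega
        rw [h3] at h2
        omega
      · exact (H (i + 1) b).trans (cnt_mono _ _ (by omega) b)
    · rw [hcne a b ha, hKne a ha]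
      exact H a b

/-- The mirror image of `Up.orbitLE_iff`: the boundary letter now passes from block i to block i',
and the first nonzero entry of the row takes the role of the last. -/
theorem Down.orbitLE_iff {i i' : Fin n} (hi : (i : ℕ) + 1 = i') {A A' : Mat n r}
    (h : Down i i' A A') {w : Equiv.Perm (Fin r)} (hw : LMin (ro A') w) :
    OrbitLE (relMat (ro A') (co A) w) A' ↔ OrbitLE (relMat (ro A) (co A) w) A := by
  have hps := h.psum_ro hi
  have hco := h.co_eq
  obtain ⟨p, hp0, hp, hA⟩ := h
  have hc := corner_move hA
  rw [orbitLE_relMat_iff, orbitLE_relMat_iff]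
  simp only [hco, true_and]
  set K := psum (ro A').1 with hK
  set Λ := psum (ro A).1 with hΛ
  have hK1 : K (i + 1) + 1 = Λ (i + 1) := by
    have := hps (i + 1)
    rwa [if_pos rfl] at this
  have hKne : ∀ a : ℕ, a ≠ i + 1 → K a = Λ a := fun a ha => by
    have := hps a
    rwa [if_neg ha, add_zero] at this
  have hc1 : ∀ b, corner A'.1 (i + 1) b + (if (p : ℕ) < b then 1 else 0) =
      corner A.1 (i + 1) b := by
    intro b
    have := hc (i + 1) b
    rwa [if_neg (show ¬ (i' : ℕ) < i + 1 by omega), if_pos (show (i : ℕ) < i + 1 by omega),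
      add_zero] at this
  have hcne : ∀ a b : ℕ, a ≠ i + 1 → corner A'.1 a b = corner A.1 a b := by
    intro a b ha
    have := hc a b
    by_cases h1 : (i : ℕ) < a
    · rw [if_pos h1, if_pos (show (i' : ℕ) < a by omega)] at this
      omega
    · rw [if_neg h1, if_neg (show ¬ (i' : ℕ) < a by omega)] at this
      omega
  have hrowi : Λ (i + 1) = Λ i + (ro A).1 i := psum_succ _ i
  have hK2 : K (i + 1) ≤ K (i' + 1) := psum_mono _ (by omega)
  have hKr : K (i' + 1) ≤ r := psum_le _ _
  have hΛr : Λ (i + 1) ≤ r := psum_le _ _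
  have hpos : 1 ≤ (ro A).1 i := by
    have h1 := psum_row_le A i (p + 1)
    have h2 := psum_succ (A.1 i) p
    omega
  constructor
  · intro H a b
    by_cases ha : a = i + 1
    · subst ha
      by_cases hb : (p : ℕ) < b
      · have H1 := H (i + 1) b
        have hc2 := hc1 b
        rw [if_pos hb] at hc2
        -- This is the first letter of the enlarged block i'. If it is not counted, no letter of
        -- that block is, and the bound for i' + 1 rows already gives the one for i + 1 rows.
        have hs := cnt_succ (co A) w ⟨K (i + 1), by omega⟩ b
        simp only [hK1] at hs
        split_ifs at hs with hx
        · omega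
        · have H2 := H (i' + 1) b
          rw [hcne _ _ (by omega)] at H2
          have hempty := cnt_add_of_forall_not_lt (co A) w (K (i + 1)) (K (i' + 1) - K (i + 1)) b
            (by omega) (by
              intro y hy1 hy2 hy3
              refine hx (lMin_bl_lt (i := i') hw ?_ (Fin.le_def.2 hy1) ?_ hy3)
              · change K i' ≤ K (i + 1)
                rw [hi]
              · change (y : ℕ) < K (i' + 1)
                omega)
          rw [Nat.add_sub_cancel' hK2] at hempty
          have := corner_mono_left A.1 (show (i : ℕ) + 1 ≤ i' + 1 by omega) b
          omega
      · rw [corner_succ, psum_eq_zero_of_first hp (not_lt.1 hb), add_zero]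
        have H0 := H i b
        rw [hKne i (by omega), hcne i b (by omega)] at H0
        exact H0.trans (cnt_mono _ _ (by omega) b)
    · rw [← hcne a b ha, ← hKne a ha]
      exact H a b
  · intro H a b
    by_cases ha : a = i + 1
    · subst ha
      have hc2 := hc1 b
      by_cases hb : (p : ℕ) < b
      · rw [if_pos hb] at hc2
        have H1 := H (i + 1) b
        have := cnt_add_le (co A) w (K (i + 1)) 1 b (by omega)
        rw [hK1] at this
        omega
      · rw [if_neg hb, add_zero, corner_succ A.1, psum_eq_zero_of_first hp (not_lt.1 hb),
          add_zero] at hc2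
        rw [hc2]
        exact (H i b).trans (cnt_mono _ _ (by omega) b)
    · rw [hcne a b ha, hKne a ha]
      exact H a b

end Corner

/-! ### The standard basis and products with generators -/

section Products

variable {n r : ℕ}

theorem e_eq_sum (A : Mat n r) [DecidablePred fun C : Mat n r => OrbitLE C A] :
    e A = ∑ C ∈ Finset.univ.filter (fun C : Mat n r => OrbitLE C A), cBasis n r C := by
  rw [e]
  refine Finset.sum_congr (by ext C; simp) fun C _ => ?_
  rw [cBasis_apply, sp_apply]

open Classical in
theorem repr_e (A C : Mat n r) : (cBasis n r).repr (e A) C = if OrbitLE C A then 1 else 0 := by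
  rw [e_eq_sum, map_sum, Finsupp.coe_finsetSum, Finset.sum_apply]
  simp [Finsupp.single_apply]

open Classical in
theorem coef_evC_e (κ ν : WComp n r) (A : Mat n r) (w : Equiv.Perm (Fin r)) :
    coef ℂ 0 r (evC κ ν (e A)) w = if OrbitLE (relMat κ ν w) A then 1 else 0 := by
  rw [coef_evC, repr_e]

theorem evC_e_eq_zero {κ ν : WComp n r} {A : Mat n r} (h : ¬ (κ = ro A ∧ ν = co A)) :
    evC κ ν (e A) = 0 := by
  classical
  apply coef_injective
  funext w
  rw [coef_evC_e, if_neg, map_zero, Pi.zero_apply]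
  intro h1
  apply h
  rw [← h1.1, ← h1.2.1, ro_relMat, co_relMat]
  exact ⟨rfl, rfl⟩

theorem coef_evC_young_mul (κ ν : WComp n r) (a : CSchur n r) {u : Equiv.Perm (Fin r)}
    (hu : u ∈ young κ) (w : Equiv.Perm (Fin r)) :
    coef ℂ 0 r (evC κ ν a) (u * w) = coef ℂ 0 r (evC κ ν a) w := by
  have : relMat κ ν (u * w) = relMat κ ν w := by
    have := relMatrix_mul_mul hu (one_mem_young ν) w
    rw [mul_one] at this
    exact Subtype.ext this
  rw [coef_evC, coef_evC, this]

/-- Both sides are constant on cosets of the Young subgroup, so at q = 0 only shortest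
representatives have to be compared. -/
theorem xElt_mul_evC_e {A A' : Mat n r} (hco : co A' = co A)
    (h : ∀ w, LMin (ro A') w →
      (OrbitLE (relMat (ro A') (co A) w) A' ↔ OrbitLE (relMat (ro A) (co A) w) A)) :
    xElt ℂ 0 (ro A') * evC (ro A) (co A) (e A) = evC (ro A') (co A') (e A') := by
  classical
  refine xElt_mul_eq (fun u hu w => coef_evC_young_mul _ _ _ hu w) fun w hw => ?_
  rw [coef_evC_e, coef_evC_e, hco]
  simp only [h w hw]

/-- The diagonal matrix of a composition. -/
def diagM (l : WComp n r) : Mat n r :=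
  ⟨Matrix.diagonal l.1, by
    have h := l.2
    simpa [Matrix.diagonal_apply] using h⟩

@[simp] theorem ro_diagM (l : WComp n r) : ro (diagM l) = l := by
  apply Subtype.ext
  funext i
  simp [ro, diagM, Matrix.diagonal_apply]

@[simp] theorem co_diagM (l : WComp n r) : co (diagM l) = l := by
  apply Subtype.ext
  funext i
  simp [co, diagM, Matrix.diagonal_apply]

theorem corner_diagM (l : WComp n r) (a b : ℕ) :
    corner (diagM l).1 a b = psum l.1 (min a b) := by
  have key : ∀ k : Fin n, psum ((diagM l).1 k) b = if (k : ℕ) < b then l.1 k else 0 := by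
    intro k
    have : (diagM l).1 k = fun j => if j = k then l.1 k else 0 := by
      funext j
      simp only [diagM, Matrix.diagonal_apply, eq_comm]
    rw [this, psum_indicator]
  rw [corner, funext key, psum, psum, Finset.sum_ite, Finset.sum_const_zero, add_zero,
    Finset.filter_filter]
  simp only [lt_min_iff]

/-- The corners with equal indices force w⁻¹ never to raise the index of a block. The sum of these
indices over all letters is unchanged by a permutation, so each index is preserved. -/
theorem orbitLE_relMat_diagM_iff {l : WComp n r} {w : Equiv.Perm (Fin r)} :
    OrbitLE (relMat l l w) (diagM l) ↔ w ∈ young l := by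
  constructor
  · intro h
    rw [orbitLE_relMat_iff] at h
    have h1 : ∀ x, (bl l (w⁻¹ x) : ℕ) ≤ bl l x := by
      intro x
      by_contra hx
      have h2 := h.2.2 (bl l x + 1) (bl l x + 1)
      rw [corner_diagM, min_self] at h2
      have h3 : cnt l w (psum l.1 (bl l x + 1)) (bl l x + 1) <
          (Finset.univ.filter fun y : Fin r => (y : ℕ) < psum l.1 (bl l x + 1)).card := by
        refine Finset.card_lt_card ((Finset.ssubset_iff_of_subset fun y hy => ?_).2 ⟨x, ?_, ?_⟩)
        · simp only [Finset.mem_filter, Finset.mem_univ, true_and] at hy ⊢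
          exact hy.1
        · simp only [Finset.mem_filter, Finset.mem_univ, true_and]
          exact bl_lt_iff.1 (Nat.lt_succ_self _)
        · simp only [Finset.mem_filter, Finset.mem_univ, true_and, not_and]
          intro _
          omega
      rw [card_val_lt (psum_le l _)] at h3
      omega
    have h2 : ∑ x, (bl l (w⁻¹ x) : ℕ) = ∑ x, (bl l x : ℕ) :=
      Equiv.sum_comp w⁻¹ fun x => (bl l x : ℕ)
    have h3 := (Finset.sum_eq_sum_iff_of_le fun x _ => h1 x).1 h2
    have h4 : w⁻¹ ∈ young l := mem_young.2 fun x => Fin.ext (h3 x (Finset.mem_univ x))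
    simpa using inv_mem_young h4
  · intro hw
    have h1 : relMat l l w = diagM l := by
      apply Subtype.ext
      ext i j
      change relMatrix l l w i j = _
      rw [relMatrix_apply]
      simp only [bl_inv_apply hw, diagM, Matrix.diagonal_apply]
      split_ifs with hij
      · subst hij
        simp only [and_self, card_bl]
      · rw [Finset.card_eq_zero, Finset.filter_eq_empty_iff]
        rintro x - ⟨rfl, rfl⟩
        exact hij rfl
    rw [h1]
    exact OrbitLE.refl _

theorem evC_e_diagM (l : WComp n r) : evC l l (e (diagM l)) = xElt ℂ 0 l := by
  classical
  apply coef_injective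
  funext w
  rw [coef_evC_e, coef_xElt]
  simp only [orbitLE_relMat_diagM_iff]

theorem e_mul_e_eq_zero {A B : Mat n r} (h : co B ≠ ro A) : e B * e A = 0 := by
  refine evC_ext fun κ ν => ?_
  rw [evC_mul, map_zero]
  refine Finset.sum_eq_zero fun μ _ => ?_
  by_cases hμ : μ = ro A
  · rw [evC_e_eq_zero (A := B), zero_mul]
    rintro ⟨-, h1⟩
    exact h (h1.symm.trans hμ)
  · rw [evC_e_eq_zero (A := A), mul_zero]
    exact fun h1 => hμ h1.1

/-- Products with the elements for which the double coset is the trivial one. -/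
theorem e_mul_e_of_move {A A' B : Mat n r} (hco : co A' = co A) (hBA : co B = ro A)
    (hBA' : ro B = ro A')
    (h : ∀ w, LMin (ro A') w →
      (OrbitLE (relMat (ro A') (co A) w) A' ↔ OrbitLE (relMat (ro A) (co A) w) A))
    (hB : ∀ w, LMin (ro B) w → (OrbitLE (relMat (ro B) (co B) w) B ↔
      OrbitLE (relMat (co B) (co B) w) (diagM (co B)))) : e B * e A = e A' := by
  have h1 := xElt_mul_evC_e hco h
  have h2 := xElt_mul_evC_e (A := diagM (co B)) (A' := B) (by simp) (by simpa using hB)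
  rw [ro_diagM, co_diagM, evC_e_diagM] at h2
  have hidem : xElt ℂ 0 (ro A) * evC (ro A) (co A) (e A) = evC (ro A) (co A) (e A) :=
    xElt_mul_eq (fun u hu w => coef_evC_young_mul _ _ _ hu w) fun _ _ => rfl
  refine evC_ext fun κ ν => ?_
  rw [evC_mul]
  by_cases hκν : κ = ro A' ∧ ν = co A'
  · obtain ⟨rfl, rfl⟩ := hκν
    rw [Finset.sum_eq_single (ro A)]
    -- The entry of e_B is x_{ro B} x_{co B}. Its second factor is absorbed by the entry of e_A, and
    -- the first turns that into the entry of e_{A'}.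
    · rw [← h1, ← hBA', ← hBA, ← h2, hBA, mul_assoc, hco, hidem]
    · intro μ _ hμ
      rw [evC_e_eq_zero (A := A), mul_zero]
      exact fun h1 => hμ h1.1
    · simp
  · rw [evC_e_eq_zero hκν]
    refine Finset.sum_eq_zero fun μ _ => ?_
    by_cases hκ : κ = ro A'
    · rw [evC_e_eq_zero (A := A), mul_zero]
      rintro ⟨-, h3⟩
      exact hκν ⟨hκ, h3.trans hco.symm⟩
    · rw [evC_e_eq_zero (A := B), zero_mul]
      rintro ⟨h3, -⟩
      exact hκ (h3.trans hBA')

/-! ### Products of the generators with standard basis elements. -/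

theorem Up.ro_congr {i i' : Fin n} (hi : (i : ℕ) + 1 = i') {A A' B B' : Mat n r}
    (h : Up i i' A A') (h' : Up i i' B B') (hro : ro A = ro B) : ro A' = ro B' :=
  Subtype.ext (psum_ext fun a => by rw [h.psum_ro hi, h'.psum_ro hi, hro])

theorem Down.ro_congr {i i' : Fin n} (hi : (i : ℕ) + 1 = i') {A A' B B' : Mat n r}
    (h : Down i i' A A') (h' : Down i i' B B') (hro : ro A = ro B) : ro A' = ro B' :=
  Subtype.ext (psum_ext fun a => by
    have h1 := h.psum_ro hi a
    have h2 := h'.psum_ro hi a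
    rw [hro] at h1
    omega)

theorem Up.e_mul_e {i i' : Fin n} (hi : (i : ℕ) + 1 = i') {A A' B : Mat n r} (h : Up i i' A A')
    (hB : Up i i' (diagM (ro A)) B) : e B * e A = e A' := by
  have hcoB := hB.co_eq
  rw [co_diagM] at hcoB
  refine e_mul_e_of_move h.co_eq hcoB (hB.ro_congr hi h (by simp))
    (fun w hw => h.orbitLE_iff hi hw) fun w hw => ?_
  have := hB.orbitLE_iff hi hw
  rwa [co_diagM, ro_diagM, ← hcoB] at this

theorem Down.e_mul_e {i i' : Fin n} (hi : (i : ℕ) + 1 = i') {A A' B : Mat n r}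
    (h : Down i i' A A') (hB : Down i i' (diagM (ro A)) B) : e B * e A = e A' := by
  have hcoB := hB.co_eq
  rw [co_diagM] at hcoB
  refine e_mul_e_of_move h.co_eq hcoB (hB.ro_congr hi h (by simp))
    (fun w hw => h.orbitLE_iff hi hw) fun w hw => ?_
  have := hB.orbitLE_iff hi hw
  rwa [co_diagM, ro_diagM, ← hcoB] at this

theorem e_diagM_mul_e (A : Mat n r) : e (diagM (ro A)) * e A = e A :=
  e_mul_e_of_move rfl (by simp) (by simp) (fun _ _ => Iff.rfl) (by simp)

theorem kElt_eq (l : WComp n r) : kElt l = e (diagM l) := by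
  have h : ∑ i, ∑ j, Matrix.diagonal l.1 i j = r := (diagM l).2
  rw [kElt, eMat, dif_pos h]
  rfl

theorem kElt_mul_e (l : WComp n r) (A : Mat n r) :
    kElt l * e A = if l = ro A then e A else 0 := by
  rw [kElt_eq]
  split_ifs with h
  · rw [h, e_diagM_mul_e]
  · exact e_mul_e_eq_zero (by simpa using h)

/-- A matrix obtained by moving a unit within a column. -/
def moveM (A : Mat n r) (k k' p : Fin n) (h : 0 < A.1 k p) : Mat n r :=
  ⟨fun a b => A.1 a b - (if a = k then if b = p then 1 else 0 else 0) +
    (if a = k' then if b = p then 1 else 0 else 0), by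
    have h1 : ∀ a b, (A.1 a b - (if a = k then if b = p then 1 else 0 else 0) +
        (if a = k' then if b = p then 1 else 0 else 0)) +
          (if a = k then if b = p then 1 else 0 else 0) =
            A.1 a b + (if a = k' then if b = p then 1 else 0 else 0) := by
      intro a b
      by_cases ha : a = k
      · by_cases hb : b = p
        · subst ha hb
          simp only [if_true]
          omega
        · simp [hb]
      · simp [ha]
    have h2 : ∀ k : Fin n, ∑ a : Fin n, ∑ b : Fin n,
        (if a = k then if b = p then 1 else 0 else 0) = 1 := by
      intro k
      rw [Finset.sum_eq_single k (by intro a _ ha; simp [ha]) (by simp)]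
      simp
    have h3 := A.2
    have h4 : ∑ a, ∑ b, ((A.1 a b - (if a = k then if b = p then 1 else 0 else 0) +
        (if a = k' then if b = p then 1 else 0 else 0)) +
          (if a = k then if b = p then 1 else 0 else 0)) =
            ∑ a, ∑ b, (A.1 a b + (if a = k' then if b = p then 1 else 0 else 0)) :=
      Finset.sum_congr rfl fun a _ => Finset.sum_congr rfl fun b _ => h1 a b
    simp only [Finset.sum_add_distrib] at h4
    rw [h2, h2] at h4
    simp only [Finset.sum_add_distrib]
    rw [h2]
    omega⟩

theorem moveM_apply (A : Mat n r) (k k' p : Fin n) (h : 0 < A.1 k p) (a b : Fin n) :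
    (moveM A k k' p h).1 a b + (if a = k then if b = p then 1 else 0 else 0) =
      A.1 a b + if a = k' then if b = p then 1 else 0 else 0 := by
  simp only [moveM]
  by_cases ha : a = k
  · by_cases hb : b = p
    · subst ha hb
      simp only [if_true]
      omega
    · simp [hb]
  · simp [ha]

theorem exists_last {f : Fin n → ℕ} (h : ∃ j, f j ≠ 0) : ∃ p, 0 < f p ∧ ∀ j, p < j → f j = 0 := by
  obtain ⟨p, hp, hmax⟩ := Finset.exists_max_image (Finset.univ.filter fun j => f j ≠ 0) id
    (by obtain ⟨j, hj⟩ := h; exact ⟨j, by simpa using hj⟩)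
  simp only [Finset.mem_filter, Finset.mem_univ, true_and, id] at hp hmax
  refine ⟨p, Nat.pos_of_ne_zero hp, fun j hj => ?_⟩
  by_contra h0
  exact absurd (hmax j h0) (not_le_of_gt hj)

theorem exists_first {f : Fin n → ℕ} (h : ∃ j, f j ≠ 0) : ∃ p, 0 < f p ∧ ∀ j, j < p → f j = 0 := by
  obtain ⟨p, hp, hmin⟩ := Finset.exists_min_image (Finset.univ.filter fun j => f j ≠ 0) id
    (by obtain ⟨j, hj⟩ := h; exact ⟨j, by simpa using hj⟩)
  simp only [Finset.mem_filter, Finset.mem_univ, true_and, id] at hp hmin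
  refine ⟨p, Nat.pos_of_ne_zero hp, fun j hj => ?_⟩
  by_contra h0
  exact absurd (hmin j h0) (not_le_of_gt hj)

theorem exists_ne_zero_of_ro_pos {A : Mat n r} {i : Fin n} (h : 0 < (ro A).1 i) :
    ∃ j, A.1 i j ≠ 0 := by
  by_contra! hc
  have h0 : ∑ j, A.1 i j = 0 := Finset.sum_eq_zero fun j _ => hc j
  exact h.ne' h0

theorem exists_up (i : Fin n) {i' : Fin n} {A : Mat n r} (h : 0 < (ro A).1 i') :
    ∃ A', Up i i' A A' := by
  obtain ⟨p, hp0, hp⟩ := exists_last (exists_ne_zero_of_ro_pos h)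
  exact ⟨moveM A i' i p hp0, p, hp0, hp, moveM_apply A i' i p hp0⟩

theorem exists_down {i : Fin n} (i' : Fin n) {A : Mat n r} (h : 0 < (ro A).1 i) :
    ∃ A', Down i i' A A' := by
  obtain ⟨p, hp0, hp⟩ := exists_first (exists_ne_zero_of_ro_pos h)
  exact ⟨moveM A i i' p hp0, p, hp0, hp, moveM_apply A i i' p hp0⟩

theorem ro_pos_of_pos {A : Mat n r} {i j : Fin n} (h : 0 < A.1 i j) : 0 < (ro A).1 i :=
  lt_of_lt_of_le h (Finset.single_le_sum (f := fun j => A.1 i j) (fun _ _ => Nat.zero_le _)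
    (Finset.mem_univ j))

theorem Up.ro_pos {i i' : Fin n} {A A' : Mat n r} (h : Up i i' A A') : 0 < (ro A).1 i' := by
  obtain ⟨p, hp, -⟩ := h
  exact ro_pos_of_pos hp

theorem Down.ro_pos {i i' : Fin n} {A A' : Mat n r} (h : Down i i' A A') : 0 < (ro A).1 i := by
  obtain ⟨p, hp, -⟩ := h
  exact ro_pos_of_pos hp

/-- A matrix obtained from a diagonal matrix by moving one unit, in the notation of `eMat`. -/
theorem eMat_diagonal_move {l : WComp n r} {k k' : Fin n} (h : 0 < (diagM l).1 k k) :
    eMat r (Matrix.diagonal l.1 - Matrix.single k k 1 + Matrix.single k' k 1) =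
      e (moveM (diagM l) k k' k h) := by
  have hM : Matrix.diagonal l.1 - Matrix.single k k 1 + Matrix.single k' k 1 =
      (moveM (diagM l) k k' k h).1 := by
    ext a b
    simp only [moveM, diagM, Matrix.add_apply, Matrix.sub_apply, Matrix.single_apply, eq_comm,
      ite_and]
  rw [hM, eMat, dif_pos (moveM (diagM l) k k' k h).2]

theorem diagM_apply_self (l : WComp n r) (i : Fin n) : (diagM l).1 i i = l.1 i := by
  simp [diagM]

theorem diagM_apply_ne (l : WComp n r) {i j : Fin n} (h : i ≠ j) : (diagM l).1 i j = 0 := by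
  simp [diagM, h]

theorem exists_eiElt_eq (i : Fin n) {i' : Fin n} {l : WComp n r} (h : 0 < l.1 i') :
    ∃ B, Up i i' (diagM l) B ∧ eiElt i i' l = e B := by
  have h' : 0 < (diagM l).1 i' i' := by rwa [diagM_apply_self]
  refine ⟨moveM (diagM l) i' i i' h', ⟨i', h', fun j hj => diagM_apply_ne l hj.ne,
    moveM_apply _ _ _ _ _⟩, ?_⟩
  rw [eiElt, if_pos h, eMat_diagonal_move]

theorem exists_fiElt_eq {i : Fin n} (i' : Fin n) {l : WComp n r} (h : 0 < l.1 i) :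
    ∃ B, Down i i' (diagM l) B ∧ fiElt i i' l = e B := by
  have h' : 0 < (diagM l).1 i i := by rwa [diagM_apply_self]
  refine ⟨moveM (diagM l) i i' i h', ⟨i, h', fun j hj => diagM_apply_ne l hj.ne',
    moveM_apply _ _ _ _ _⟩, ?_⟩
  rw [fiElt, if_pos h, eMat_diagonal_move]

theorem eiElt_mul_e_of_ne {i i' : Fin n} {l : WComp n r} {A : Mat n r} (h : l ≠ ro A) :
    eiElt i i' l * e A = 0 := by
  by_cases hl : 0 < l.1 i'
  · obtain ⟨B, hB, he⟩ := exists_eiElt_eq i hl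
    rw [he]
    exact e_mul_e_eq_zero (by rwa [hB.co_eq, co_diagM])
  · rw [eiElt, if_neg hl, zero_mul]

theorem fiElt_mul_e_of_ne {i i' : Fin n} {l : WComp n r} {A : Mat n r} (h : l ≠ ro A) :
    fiElt i i' l * e A = 0 := by
  by_cases hl : 0 < l.1 i
  · obtain ⟨B, hB, he⟩ := exists_fiElt_eq i' hl
    rw [he]
    exact e_mul_e_eq_zero (by rwa [hB.co_eq, co_diagM])
  · rw [fiElt, if_neg hl, zero_mul]

/-- The generator `e_i`. -/
def eiGen (n r : ℕ) (i i' : Fin n) : CSchur n r := ∑ l : WComp n r, eiElt i i' l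

/-- The generator `f_i`. -/
def fiGen (n r : ℕ) (i i' : Fin n) : CSchur n r := ∑ l : WComp n r, fiElt i i' l

theorem eiGen_mul_e (i i' : Fin n) (A : Mat n r) :
    eiGen n r i i' * e A = eiElt i i' (ro A) * e A := by
  rw [eiGen, Finset.sum_mul]
  exact Finset.sum_eq_single _ (fun l _ hl => eiElt_mul_e_of_ne hl) (by simp)

theorem fiGen_mul_e (i i' : Fin n) (A : Mat n r) :
    fiGen n r i i' * e A = fiElt i i' (ro A) * e A := by
  rw [fiGen, Finset.sum_mul]
  exact Finset.sum_eq_single _ (fun l _ hl => fiElt_mul_e_of_ne hl) (by simp)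

theorem Up.eiGen_mul {i i' : Fin n} (hi : (i : ℕ) + 1 = i') {A A' : Mat n r}
    (h : Up i i' A A') : eiGen n r i i' * e A = e A' := by
  obtain ⟨B, hB, he⟩ := exists_eiElt_eq i h.ro_pos
  rw [eiGen_mul_e, he, h.e_mul_e hi hB]

theorem Down.fiGen_mul {i i' : Fin n} (hi : (i : ℕ) + 1 = i') {A A' : Mat n r}
    (h : Down i i' A A') : fiGen n r i i' * e A = e A' := by
  obtain ⟨B, hB, he⟩ := exists_fiElt_eq i' h.ro_pos
  rw [fiGen_mul_e, he, h.e_mul_e hi hB]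

theorem eiGen_mul_e_cases {i i' : Fin n} (hi : (i : ℕ) + 1 = i') (A : Mat n r) :
    eiGen n r i i' * e A = 0 ∨ ∃ A', Up i i' A A' ∧ eiGen n r i i' * e A = e A' := by
  by_cases h : 0 < (ro A).1 i'
  · obtain ⟨A', hA'⟩ := exists_up i h
    exact Or.inr ⟨A', hA', hA'.eiGen_mul hi⟩
  · left
    rw [eiGen_mul_e, eiElt, if_neg h, zero_mul]

theorem fiGen_mul_e_cases {i i' : Fin n} (hi : (i : ℕ) + 1 = i') (A : Mat n r) :
    fiGen n r i i' * e A = 0 ∨ ∃ A', Down i i' A A' ∧ fiGen n r i i' * e A = e A' := by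
  by_cases h : 0 < (ro A).1 i
  · obtain ⟨A', hA'⟩ := exists_down i' h
    exact Or.inr ⟨A', hA', hA'.fiGen_mul hi⟩
  · left
    rw [fiGen_mul_e, fiElt, if_neg h, zero_mul]

/-! ### The standard basis is a basis -/

/-- The e_A are unitriangular over the Dipper–James basis for the orbit order. -/
theorem span_e : Submodule.span ℂ (Set.range (e : Mat n r → CSchur n r)) = ⊤ := by
  classical
  rw [eq_top_iff, ← (cBasis n r).span_eq, Submodule.span_le]
  rintro _ ⟨A, rfl⟩
  -- induction on the number of matrices below `A`
  induction hk : (Finset.univ.filter fun C : Mat n r => OrbitLE C A).card using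
    Nat.strong_induction_on generalizing A with
  | _ k ih =>
    have h1 : cBasis n r A = e A - ∑ C ∈ (Finset.univ.filter
        fun C : Mat n r => OrbitLE C A).erase A, cBasis n r C := by
      rw [e_eq_sum, ← Finset.add_sum_erase _ _ (show A ∈ _ by simpa using OrbitLE.refl A)]
      simp
    rw [SetLike.mem_coe, h1]
    refine sub_mem (Submodule.subset_span ⟨A, rfl⟩) (Submodule.sum_mem _ fun C hC => ?_)
    simp only [Finset.mem_erase, Finset.mem_filter, Finset.mem_univ, true_and] at hC
    refine ih _ ?_ C rfl
    rw [← hk]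
    refine Finset.card_lt_card ((Finset.ssubset_iff_of_subset fun B hB => ?_).2 ⟨A, ?_, ?_⟩)
    · simp only [Finset.mem_filter, Finset.mem_univ, true_and] at hB ⊢
      exact hB.trans hC.2
    · simpa using OrbitLE.refl A
    · simp only [Finset.mem_filter, Finset.mem_univ, true_and]
      exact fun h => hC.1 (hC.2.antisymm h)

variable (n r) in
/-- The standard basis. -/
def eBasis : Module.Basis (Mat n r) ℂ (CSchur n r) :=
  Module.Basis.mk (v := e)
    (linearIndependent_of_top_le_span_of_card_eq_finrank span_e.ge
      (Module.finrank_eq_card_basis (cBasis n r)).symm) span_e.ge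

@[simp] theorem eBasis_apply (A : Mat n r) : eBasis n r A = e A := by
  rw [eBasis, Module.Basis.mk_apply]

theorem e_injective : Function.Injective (e : Mat n r → CSchur n r) := by
  intro A B h
  rw [← eBasis_apply, ← eBasis_apply] at h
  exact (eBasis n r).injective h

theorem e_ne_zero (A : Mat n r) : e A ≠ 0 := by
  rw [← eBasis_apply]
  exact (eBasis n r).ne_zero A

theorem sum_kElt : ∑ l : WComp n r, kElt l = 1 := by
  have h : ∀ a : CSchur n r, (∑ l : WComp n r, kElt l) * a = a := by
    intro a
    have ha : a ∈ Submodule.span ℂ (Set.range (e : Mat n r → CSchur n r)) := by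
      rw [span_e]; trivial
    induction ha using Submodule.span_induction with
    | mem x hx =>
      obtain ⟨A, rfl⟩ := hx
      rw [Finset.sum_mul]
      simp only [kElt_mul_e]
      simp
    | zero => simp
    | add x y _ _ hx hy => rw [mul_add, hx, hy]
    | smul c x _ hx => rw [mul_smul_comm, hx]
  simpa using h 1

end Products

/-! ### Generation by elementary moves -/

section Generation

variable {n r : ℕ}

theorem move_ne_zero {A A' : Mat n r} {i i' p : Fin n}
    (h : ∀ k l, A'.1 k l + (if k = i' then if l = p then 1 else 0 else 0) =
      A.1 k l + if k = i then if l = p then 1 else 0 else 0) {k l : Fin n}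
    (hA : A'.1 k l ≠ 0) : A.1 k l ≠ 0 ∨ (k = i ∧ l = p) := by
  have := h k l
  by_cases h1 : k = i
  · by_cases h2 : l = p
    · exact Or.inr ⟨h1, h2⟩
    · left
      simp only [h2, if_false, ite_self] at this
      omega
  · left
    simp only [h1, if_false] at this
    omega

theorem ne_zero_move {A A' : Mat n r} {i i' p : Fin n}
    (h : ∀ k l, A'.1 k l + (if k = i' then if l = p then 1 else 0 else 0) =
      A.1 k l + if k = i then if l = p then 1 else 0 else 0) {k l : Fin n}
    (hA : A.1 k l ≠ 0) : A'.1 k l ≠ 0 ∨ (k = i' ∧ l = p) :=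
  move_ne_zero (fun k l => (h k l).symm) hA

theorem move_target_ne_zero {A A' : Mat n r} {i i' p : Fin n} (hi : i ≠ i')
    (h : ∀ k l, A'.1 k l + (if k = i' then if l = p then 1 else 0 else 0) =
      A.1 k l + if k = i then if l = p then 1 else 0 else 0) : A'.1 i p ≠ 0 := by
  have := h i p
  simp only [hi, if_false, if_true] at this
  omega

/-- The distance of the units of `A` to the diagonal. -/
def offDiag (A : Mat n r) : ℕ := ∑ k, ∑ l, A.1 k l * (((k : ℕ) - l) + ((l : ℕ) - k))

theorem offDiag_move {A A' : Mat n r} {i i' p : Fin n}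
    (h : ∀ k l, A'.1 k l + (if k = i' then if l = p then 1 else 0 else 0) =
      A.1 k l + if k = i then if l = p then 1 else 0 else 0) :
    offDiag A' + (((i' : ℕ) - p) + ((p : ℕ) - i')) = offDiag A + (((i : ℕ) - p) + ((p : ℕ) - i)) := by
  have h2 : ∀ i : Fin n, ∑ k : Fin n, ∑ l : Fin n,
      (if k = i then if l = p then 1 else 0 else 0) * (((k : ℕ) - l) + ((l : ℕ) - k)) =
        ((i : ℕ) - p) + ((p : ℕ) - i) := by
    intro i
    rw [Finset.sum_eq_single i (by intro a _ ha; simp [ha]) (by simp)]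
    simp
  rw [← h2, ← h2, offDiag, offDiag, ← Finset.sum_add_distrib, ← Finset.sum_add_distrib]
  refine Finset.sum_congr rfl fun k _ => ?_
  rw [← Finset.sum_add_distrib, ← Finset.sum_add_distrib]
  refine Finset.sum_congr rfl fun l _ => ?_
  rw [← add_mul, ← add_mul, h]

theorem eq_diagM {A : Mat n r} (h : ∀ k l, k ≠ l → A.1 k l = 0) : A = diagM (ro A) := by
  apply Subtype.ext
  ext k l
  by_cases hkl : k = l
  · subst hkl
    rw [diagM_apply_self]
    have hs : ∑ l, A.1 k l = A.1 k k :=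
      Finset.sum_eq_single k (fun l _ hl => h k l hl.symm) fun hk => absurd (Finset.mem_univ k) hk
    exact hs.symm
  · rw [h k l hkl, diagM_apply_ne _ hkl]

/-- Every matrix arises from a diagonal one by elementary moves. -/
theorem move_induction {P : Mat n r → Prop} (diag : ∀ l, P (diagM l))
    (up : ∀ (i i' : Fin n) (A A' : Mat n r), (i : ℕ) + 1 = i' → Up i i' A A' → P A → P A')
    (down : ∀ (i i' : Fin n) (A A' : Mat n r), (i : ℕ) + 1 = i' → Down i i' A A' → P A → P A')
    (A : Mat n r) : P A := by
  induction hm : offDiag A using Nat.strong_induction_on generalizing A with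
  | _ m ih =>
    by_cases hup : ∃ l k : Fin n, k < l ∧ A.1 k l ≠ 0
    -- Take the last column with an entry above the diagonal and lower one of its units by a row. In
    -- the new row nothing lies further right, as such an entry would again be above the diagonal;
    -- so an upward move restores A, and the unit has come closer to the diagonal.
    · obtain ⟨l, hl, hmax⟩ := Finset.exists_max_image
        (Finset.univ.filter fun l : Fin n => ∃ k, k < l ∧ A.1 k l ≠ 0) id
        (by obtain ⟨l, hl⟩ := hup; exact ⟨l, by simpa using hl⟩)
      simp only [Finset.mem_filter, Finset.mem_univ, true_and, id] at hl hmax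
      obtain ⟨k, hkl, hA⟩ := hl
      rw [Fin.lt_def] at hkl
      obtain ⟨k', hk'⟩ : ∃ k' : Fin n, (k : ℕ) + 1 = k' := ⟨⟨k + 1, by omega⟩, rfl⟩
      have hkk : k' ≠ k := by rw [Ne, Fin.ext_iff]; omega
      have hmv := moveM_apply A k k' l (Nat.pos_of_ne_zero hA)
      set A' := moveM A k k' l (Nat.pos_of_ne_zero hA)
      refine up k k' A' A hk' ⟨l, Nat.pos_of_ne_zero (move_target_ne_zero hkk hmv), ?_,
        fun a b => (hmv a b).symm⟩ (ih _ ?_ A' rfl)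
      · intro j hj
        by_contra h0
        rcases move_ne_zero hmv h0 with h1 | ⟨-, h1⟩
        · exact absurd (hmax j ⟨k', Fin.lt_def.2 (by rw [Fin.lt_def] at hj; omega), h1⟩)
            (not_le_of_gt hj)
        · exact hj.ne' h1
      · have := offDiag_move hmv
        omega
    push Not at hup
    by_cases hlow : ∃ l k : Fin n, l < k ∧ A.1 k l ≠ 0
    -- The same with the first column having an entry below the diagonal: raising a unit there is
    -- undone by a downward move.
    · obtain ⟨l, hl, hmin⟩ := Finset.exists_min_image
        (Finset.univ.filter fun l : Fin n => ∃ k, l < k ∧ A.1 k l ≠ 0) id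
        (by obtain ⟨l, hl⟩ := hlow; exact ⟨l, by simpa using hl⟩)
      simp only [Finset.mem_filter, Finset.mem_univ, true_and, id] at hl hmin
      obtain ⟨k, hkl, hA⟩ := hl
      rw [Fin.lt_def] at hkl
      obtain ⟨k', hk'⟩ : ∃ k' : Fin n, (k' : ℕ) + 1 = k := ⟨⟨k - 1, by omega⟩, by simp; omega⟩
      have hkk : k' ≠ k := by rw [Ne, Fin.ext_iff]; omega
      have hmv := moveM_apply A k k' l (Nat.pos_of_ne_zero hA)
      set A' := moveM A k k' l (Nat.pos_of_ne_zero hA)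
      refine down k' k A' A hk' ⟨l, Nat.pos_of_ne_zero (move_target_ne_zero hkk hmv), ?_,
        fun a b => (hmv a b).symm⟩ (ih _ ?_ A' rfl)
      · intro j hj
        by_contra h0
        rcases move_ne_zero hmv h0 with h1 | ⟨-, h1⟩
        · exact absurd (hmin j ⟨k', Fin.lt_def.2 (by rw [Fin.lt_def] at hj; omega), h1⟩)
            (not_le_of_gt hj)
        · exact hj.ne h1
      · have := offDiag_move hmv
        omega
    push Not at hlow
    rw [eq_diagM fun k l hkl => (lt_or_gt_of_ne hkl).elim (hup l k) (hlow l k)]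
    exact diag _

theorem eiGen_mem {i i' : Fin n} (hi : (i : ℕ) + 1 = i') : eiGen n r i i' ∈ generators n r :=
  Or.inl ⟨i, i', hi, rfl⟩

theorem fiGen_mem {i i' : Fin n} (hi : (i : ℕ) + 1 = i') : fiGen n r i i' ∈ generators n r :=
  Or.inr (Or.inl ⟨i, i', hi, rfl⟩)

theorem kElt_mem (l : WComp n r) : kElt l ∈ generators n r := Or.inr (Or.inr ⟨l, rfl⟩)

theorem adjoin_generators : Algebra.adjoin ℂ (generators n r) = ⊤ := by
  suffices h : Submodule.span ℂ (Set.range (e : Mat n r → CSchur n r)) ≤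
      Subalgebra.toSubmodule (Algebra.adjoin ℂ (generators n r)) from
    Algebra.eq_top_iff.2 fun x => h (by rw [span_e]; trivial)
  rw [Submodule.span_le]
  rintro _ ⟨A, rfl⟩
  refine move_induction (P := fun A => e A ∈ Algebra.adjoin ℂ (generators n r)) (fun l => ?_)
    (fun i i' A A' hi h ih => ?_) (fun i i' A A' hi h ih => ?_) A
  · rw [← kElt_eq]
    exact Algebra.subset_adjoin (kElt_mem l)
  · rw [← h.eiGen_mul hi]
    exact mul_mem (Algebra.subset_adjoin (eiGen_mem hi)) ih
  · rw [← h.fiGen_mul hi]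
    exact mul_mem (Algebra.subset_adjoin (fiGen_mem hi)) ih

/-- The product of a generator and a standard basis element. -/
theorem generator_mul_e {b : CSchur n r} (hb : b ∈ generators n r) (A : Mat n r) :
    b * e A = 0 ∨ ∃ A', b * e A = e A' ∧ (A' = A ∨ (∃ i i' : Fin n, (i : ℕ) + 1 = i' ∧
      Up i i' A A') ∨ ∃ i i' : Fin n, (i : ℕ) + 1 = i' ∧ Down i i' A A') := by
  rcases hb with ⟨i, i', hi, rfl⟩ | ⟨i, i', hi, rfl⟩ | ⟨l, rfl⟩
  · rcases eiGen_mul_e_cases hi A with h | ⟨A', h1, h2⟩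
    · exact Or.inl h
    · exact Or.inr ⟨A', h2, Or.inr (Or.inl ⟨i, i', hi, h1⟩)⟩
  · rcases fiGen_mul_e_cases hi A with h | ⟨A', h1, h2⟩
    · exact Or.inl h
    · exact Or.inr ⟨A', h2, Or.inr (Or.inr ⟨i, i', hi, h1⟩)⟩
  · rw [kElt_mul_e]
    split_ifs
    · exact Or.inr ⟨A, rfl, Or.inl rfl⟩
    · exact Or.inl rfl

/-- A set of matrices closed under elementary moves. -/
def MoveClosed (P : Mat n r → Prop) : Prop :=
  ∀ i i' : Fin n, (i : ℕ) + 1 = i' → ∀ A A' : Mat n r, (Up i i' A A' ∨ Down i i' A A') →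
    P A → P A'

theorem MoveClosed.generator_mul {P : Mat n r → Prop} (hP : MoveClosed P) {b : CSchur n r}
    (hb : b ∈ generators n r) {A : Mat n r} (hA : P A) :
    b * e A = 0 ∨ ∃ A', b * e A = e A' ∧ P A' := by
  rcases generator_mul_e hb A with h | ⟨A', h, rfl | ⟨i, i', hi, h'⟩ | ⟨i, i', hi, h'⟩⟩
  · exact Or.inl h
  · exact Or.inr ⟨A', h, hA⟩
  · exact Or.inr ⟨A', h, hP i i' hi A A' (Or.inl h') hA⟩
  · exact Or.inr ⟨A', h, hP i i' hi A A' (Or.inr h') hA⟩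

/-- Matrices closed under elementary moves span a left ideal. -/
theorem MoveClosed.mul_mem {P : Mat n r → Prop} (hP : MoveClosed P) (a : CSchur n r)
    {x : CSchur n r} (hx : x ∈ Submodule.span ℂ (e '' {A | P A})) :
    a * x ∈ Submodule.span ℂ (e '' {A | P A}) := by
  have ha : a ∈ Algebra.adjoin ℂ (generators n r) := by
    rw [adjoin_generators]; trivial
  induction ha using Algebra.adjoin_induction generalizing x with
  | mem b hb =>
    induction hx using Submodule.span_induction with
    | mem x hx =>
      obtain ⟨A, hA, rfl⟩ := hx
      rcases hP.generator_mul hb hA with h | ⟨A', h, hA'⟩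
      · rw [h]; exact zero_mem _
      · rw [h]; exact Submodule.subset_span ⟨A', hA', rfl⟩
    | zero => rw [mul_zero]; exact zero_mem _
    | add x y _ _ hx hy => rw [mul_add]; exact add_mem hx hy
    | smul c x _ hx => rw [mul_smul_comm]; exact Submodule.smul_mem _ _ hx
  | algebraMap c => rw [← Algebra.smul_def]; exact Submodule.smul_mem _ _ hx
  | add a b _ _ ha hb => rw [add_mul]; exact add_mem (ha hx) (hb hx)
  | mul a b _ _ ha hb => rw [mul_assoc]; exact ha (hb hx)

/-! ### Column block diagonal matrices and open matrices -/

/-- A violation is a nonzero entry together with another one weakly above it and strictly to its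
right. A move that empties one of them puts its unit into the adjacent row of the same column. The
new pair could be harmless only if both entries were in the row the unit left, and this is excluded
by moving the last (or first) entry of the row. -/
theorem moveClosed_not_CB :
    MoveClosed fun A : Mat n r => ¬ IsColumnBlockDiagonal A.1 := by
  rintro a a' ha A A' h hA
  simp only [IsColumnBlockDiagonal] at hA ⊢
  push Not at hA ⊢
  obtain ⟨i, j, hij, i', j', hi, hj, hij'⟩ := hA
  rw [Fin.le_def] at hi
  have haa : a ≠ a' := by rw [Ne, Fin.ext_iff]; omega
  rcases h with ⟨p, hp0, hp, hA⟩ | ⟨p, hp0, hp, hA⟩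
  · have ht := move_target_ne_zero haa hA
    rcases ne_zero_move hA hij.ne' with h1 | ⟨rfl, rfl⟩
    · rcases ne_zero_move hA hij' with h2 | ⟨rfl, rfl⟩
      · exact ⟨i, j, Nat.pos_of_ne_zero h1, i', j', hi, hj, h2⟩
      · exact ⟨i, j, Nat.pos_of_ne_zero h1, a, j', Fin.le_def.2 (by omega), hj, ht⟩
    · have h3 : i' ≠ i := by
        rintro rfl
        exact hij' (hp j' hj)
      rw [Ne, Fin.ext_iff] at h3
      rcases ne_zero_move hA hij' with h2 | ⟨h2, -⟩
      · exact ⟨a, j, Nat.pos_of_ne_zero ht, i', j', Fin.le_def.2 (by omega), hj, h2⟩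
      · exact absurd (congrArg Fin.val h2) h3
  · have ht := move_target_ne_zero haa.symm hA
    rcases ne_zero_move hA hij' with h1 | ⟨rfl, rfl⟩
    · rcases ne_zero_move hA hij.ne' with h2 | ⟨rfl, rfl⟩
      · exact ⟨i, j, Nat.pos_of_ne_zero h2, i', j', hi, hj, h1⟩
      · exact ⟨a', j, Nat.pos_of_ne_zero ht, i', j', Fin.le_def.2 (by omega), hj, h1⟩
    · have h3 : i ≠ i' := by
        rintro rfl
        exact hij.ne' (hp j hj)
      rw [Ne, Fin.ext_iff] at h3
      rcases ne_zero_move hA hij.ne' with h2 | ⟨h2, -⟩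
      · exact ⟨i, j, Nat.pos_of_ne_zero h2, a', j', Fin.le_def.2 (by omega), hj, ht⟩
      · exact absurd (congrArg Fin.val h2) h3

/-- Open on columns. -/
def OpenOn (a : Composition n) (A : Matrix (Fin n) (Fin n) ℕ) : Prop :=
  ∀ v, IsOpenMatrix (colPart A a v)

theorem openOn_iff {a : Composition n} {A : Matrix (Fin n) (Fin n) ℕ} :
    OpenOn a A ↔ ∀ i i' j j' : Fin n, i < i' → j < j' → a.index j = a.index j' →
      A i j ≠ 0 → A i' j' ≠ 0 → False := by
  constructor
  · intro h i i' j j' hi hj hjj h1 h2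
    rcases h (a.index j) i i' j j' hi hj with h3 | h3
    · simp [colPart] at h3
      exact h1 h3
    · simp [colPart, hjj] at h3
      exact h2 h3
  · intro h v i i' j j' hi hj
    by_contra! hc
    simp only [colPart, Matrix.of_apply, ne_eq, ite_eq_right_iff, Classical.not_imp] at hc
    exact h i i' j j' hi hj (hc.1.1.trans hc.2.1.symm) hc.1.2 hc.2.2

/-- A forbidden pair in the new matrix that uses the moved unit comes from a forbidden pair with the
unit in its old row. The exception would be a partner in that old row, strictly beyond the moved
entry on the side where the row is known to vanish. -/
theorem moveClosed_openOn (c : Composition n) : MoveClosed fun A : Mat n r => OpenOn c A.1 := by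
  rintro a a' ha A A' h hO
  rw [openOn_iff] at hO ⊢
  intro i i' j j' hi hj hjj h1 h2
  rw [Fin.lt_def] at hi
  rcases h with ⟨p, hp0, hp, hA⟩ | ⟨p, hp0, hp, hA⟩
  · rcases move_ne_zero hA h1 with h3 | ⟨rfl, rfl⟩
    · rcases move_ne_zero hA h2 with h4 | ⟨rfl, rfl⟩
      · exact hO i i' j j' hi hj hjj h3 h4
      · exact hO i a' j j' (Fin.lt_def.2 (by omega)) hj hjj h3 hp0.ne'
    · rcases move_ne_zero hA h2 with h4 | ⟨h4, -⟩
      · by_cases h5 : i' = a'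
        · subst h5
          exact h4 (hp j' hj)
        · rw [Fin.ext_iff] at h5
          exact hO a' i' j j' (Fin.lt_def.2 (by omega)) hj hjj hp0.ne' h4
      · rw [Fin.ext_iff] at h4
        omega
  · rcases move_ne_zero hA h2 with h3 | ⟨rfl, rfl⟩
    · rcases move_ne_zero hA h1 with h4 | ⟨rfl, rfl⟩
      · exact hO i i' j j' hi hj hjj h4 h3
      · exact hO a i' j j' (Fin.lt_def.2 (by omega)) hj hjj hp0.ne' h3
    · rcases move_ne_zero hA h1 with h4 | ⟨h4, -⟩
      · by_cases h5 : i = a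
        · subst h5
          exact h4 (hp j hj)
        · rw [Fin.ext_iff] at h5
          exact hO i a j j' (Fin.lt_def.2 (by omega)) hj hjj h4 hp0.ne'
      · rw [Fin.ext_iff] at h4
        omega

/-- The label of an element of `B^λ`. -/
def InB (l : WComp n r) (A : Mat n r) : Prop :=
  co A = l ∧ ∀ a, IsMaximal l a → a ≠ Composition.ones n → ¬ OpenOn a A.1

theorem e_mem_BSet {l : WComp n r} {A : Mat n r} : e A ∈ BSet l ↔ InB l A := by
  simp only [BSet, Set.mem_sdiff, Set.mem_ofPred_eq, Set.mem_iUnion, not_exists, openSet, InB,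
    OpenOn]
  constructor
  · rintro ⟨⟨A', hA', h⟩, h2⟩
    obtain rfl := e_injective h
    exact ⟨hA', fun a ha hne ho => h2 a ⟨ha, hne⟩ A ⟨hA', ho, rfl⟩⟩
  · rintro ⟨h1, h2⟩
    refine ⟨⟨A, h1, rfl⟩, ?_⟩
    rintro a ⟨ha, hne⟩ A' ⟨h3, ho, h⟩
    obtain rfl := e_injective h
    exact h2 a ha hne ho

theorem exists_of_mem_BSet {l : WComp n r} {x : CSchur n r} (hx : x ∈ BSet l) :
    ∃ A, InB l A ∧ x = e A := by
  obtain ⟨A, -, rfl⟩ := hx.1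
  exact ⟨A, e_mem_BSet.1 hx, rfl⟩

theorem moveClosed_not_inB (l : WComp n r) : MoveClosed fun A : Mat n r => ¬ InB l A := by
  intro i i' hi A A' h hA hA'
  apply hA
  have hco : co A' = co A := by
    rcases h with h | h
    · exact h.co_eq
    · exact h.co_eq
  exact ⟨hco.symm.trans hA'.1, fun a ha hne ho =>
    hA'.2 a ha hne (moveClosed_openOn a i i' hi A A' h ho)⟩

theorem exists_ne_zero_of_co_ne_zero {A : Mat n r} {j : Fin n} (h : (co A).1 j ≠ 0) :
    ∃ i, A.1 i j ≠ 0 := by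
  by_contra! hc
  have h0 : ∑ i, A.1 i j = 0 := Finset.sum_eq_zero fun i _ => hc i
  exact h h0

/-- A composition other than (1, …, 1) has a block of length at least two. By maximality its first
and last columns are nonzero, and column block diagonality places an entry of the last strictly
below one of the first, which contradicts openness. -/
theorem inB_of_CB {l : WComp n r} {A : Mat n r} (hA : IsColumnBlockDiagonal A.1)
    (hco : co A = l) : InB l A := by
  refine ⟨hco, fun a ha hne ho => ?_⟩
  obtain ⟨m, hm, hm1⟩ := Composition.ne_ones_iff.1 hne
  obtain ⟨v, hv, rfl⟩ := List.mem_iff_getElem.1 hm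
  have hb : 1 < a.blocksFun ⟨v, hv⟩ := hm1
  set w : Fin a.length := ⟨v, hv⟩
  rcases ha w with ⟨h1, -⟩ | ⟨h1, h2⟩
  · omega
  · rw [← hco] at h1 h2
    obtain ⟨i, hi⟩ := exists_ne_zero_of_co_ne_zero h1
    obtain ⟨i', hi'⟩ := exists_ne_zero_of_co_ne_zero h2
    have hlt : a.embedding w ⟨0, a.blocks_pos' w w.2⟩ < a.embedding w
        ⟨a.blocksFun w - 1, Nat.sub_lt (a.blocks_pos' w w.2) Nat.one_pos⟩ := by
      rw [OrderEmbedding.lt_iff_lt, Fin.lt_def]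
      simp only
      omega
    have hii : i < i' := by
      by_contra hc
      exact hi' (hA i _ (Nat.pos_of_ne_zero hi) i' _ (not_lt.1 hc) hlt)
    exact openOn_iff.1 ho i i' _ _ hii hlt (by simp) hi hi'

theorem isColumnBlockDiagonal_diagM (l : WComp n r) : IsColumnBlockDiagonal (diagM l).1 := by
  intro i j hij i' j' hi hj
  have h1 : i = j := by
    by_contra hne
    rw [diagM_apply_ne _ hne] at hij
    exact lt_irrefl _ hij
  subst h1
  exact diagM_apply_ne _ (lt_of_le_of_lt hi hj).ne

/-! ### Corner sums of column block diagonal matrices. -/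

theorem exists_lt_of_psum_lt {f g : Fin n → ℕ} {a : ℕ} (h : psum f a < psum g a) :
    ∃ k : Fin n, (k : ℕ) < a ∧ f k < g k := by
  obtain ⟨k, hk, hlt⟩ := Finset.exists_lt_of_sum_lt h
  exact ⟨k, by simpa using hk, hlt⟩

theorem exists_of_psum_lt {f : Fin n → ℕ} {a : ℕ} (h : psum f a < ∑ k, f k) :
    ∃ k : Fin n, a ≤ k ∧ f k ≠ 0 := by
  by_contra! hc
  refine h.ne (Finset.sum_subset_zero_on_sdiff (Finset.subset_univ _) ?_ fun _ _ => rfl)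
  intro l hl
  simp only [Finset.mem_sdiff, Finset.mem_filter, Finset.mem_univ, true_and, not_lt] at hl
  exact hc l hl

/-- If a corner were smaller than both bounds, there would be a nonzero entry to the right of it in
the first a rows and one below it in the first b columns; the two violate column block diagonality.
-/
theorem corner_of_CB {A : Mat n r} (hA : IsColumnBlockDiagonal A.1) (a b : ℕ) :
    corner A.1 a b = min (psum (ro A).1 a) (psum (co A).1 b) := by
  refine le_antisymm (le_min (corner_le_ro A a b) (corner_le_co A a b)) ?_
  by_contra! hc
  obtain ⟨h1, h2⟩ := lt_min_iff.1 hc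
  obtain ⟨k, hk, hk'⟩ := exists_lt_of_psum_lt h1
  obtain ⟨l, hl, hkl⟩ := exists_of_psum_lt hk'
  rw [corner_swap] at h2
  obtain ⟨l', hl', hl2⟩ := exists_lt_of_psum_lt h2
  obtain ⟨k', hk2, hkl'⟩ := exists_of_psum_lt (f := fun k => A.1 k l') hl2
  exact hkl (hA k' l' (Nat.pos_of_ne_zero hkl') k l (Fin.le_def.2 (by omega))
    (Fin.lt_def.2 (by omega)))

/-- A column block diagonal matrix is determined by its row and column sums. -/
theorem CB_unique {A A' : Mat n r} (hA : IsColumnBlockDiagonal A.1)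
    (hA' : IsColumnBlockDiagonal A'.1) (hro : ro A = ro A') (hco : co A = co A') : A = A' :=
  Subtype.ext <| corner_ext fun a b => by rw [corner_of_CB hA, corner_of_CB hA', hro, hco]

end Generation

/-! ### Monotonicity of products -/

section Monotone

variable {n r : ℕ}

theorem OrbitLE.up {i i' : Fin n} (hi : (i : ℕ) + 1 = i') {A C A' C' : Mat n r}
    (h : OrbitLE A C) (hA : Up i i' A A') (hC : Up i i' C C') : OrbitLE A' C' := by
  rw [orbitLE_iff] at h ⊢
  obtain ⟨hro, hco, h⟩ := h
  refine ⟨hA.ro_congr hi hC hro, by rw [hA.co_eq, hC.co_eq, hco], fun a b => ?_⟩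
  obtain ⟨p, hp0, hp, hA⟩ := hA
  obtain ⟨p', hp0', hp', hC⟩ := hC
  have h1 := corner_move hA a b
  have h2 := corner_move hC a b
  have h3 := h a b
  by_cases hai : a = i + 1
  · subst hai
    rw [if_neg (show ¬ (i' : ℕ) < i + 1 by omega), if_pos (Nat.lt_succ_self _), add_zero] at h1 h2
    by_cases hb : (p : ℕ) < b
    · rw [if_pos hb] at h1
      split_ifs at h2 <;> omega
    · by_cases hb' : (p' : ℕ) < b
      -- Row i' of C lies within the first b columns, that of A does not, and the row sums agree. So
      -- the inequality for i' + 1 rows leaves the one unit of slack needed for i + 1 rows.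
      · have h4 := h (i' + 1) b
        have h5 := psum_succ (A.1 i') p
        have h6 := psum_row_le A i' (p + 1)
        have h7 := psum_mono (A.1 i') (not_lt.1 hb)
        rw [corner_succ, corner_succ, psum_eq_of_last hp' hb', psum_row C i' le_rfl, ← hro,
          ← hi] at h4
        rw [if_neg hb] at h1
        rw [if_pos hb'] at h2
        omega
      · rw [if_neg hb] at h1
        rw [if_neg hb'] at h2
        omega
  · by_cases hlt : (i : ℕ) < a
    · rw [if_pos hlt, if_pos (show (i' : ℕ) < a by omega)] at h1 h2
      omega
    · rw [if_neg hlt, if_neg (show ¬ (i' : ℕ) < a by omega)] at h1 h2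
      omega

theorem OrbitLE.down {i i' : Fin n} (hi : (i : ℕ) + 1 = i') {A C A' C' : Mat n r}
    (h : OrbitLE A C) (hA : Down i i' A A') (hC : Down i i' C C') : OrbitLE A' C' := by
  rw [orbitLE_iff] at h ⊢
  obtain ⟨hro, hco, h⟩ := h
  refine ⟨hA.ro_congr hi hC hro, by rw [hA.co_eq, hC.co_eq, hco], fun a b => ?_⟩
  obtain ⟨p, hp0, hp, hA⟩ := hA
  obtain ⟨p', hp0', hp', hC⟩ := hC
  have h1 := corner_move hA a b
  have h2 := corner_move hC a b
  have h3 := h a b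
  by_cases hai : a = i + 1
  · subst hai
    rw [if_neg (show ¬ (i' : ℕ) < i + 1 by omega), if_pos (Nat.lt_succ_self _), add_zero] at h1 h2
    by_cases hb' : (p' : ℕ) < b
    · rw [if_pos hb'] at h2
      split_ifs at h1 <;> omega
    · by_cases hb : (p : ℕ) < b
      -- Row i of C vanishes in the first b columns, while row i of A has a unit there, which pays
      -- for the unit removed.
      · have h4 := h i b
        have h5 := psum_succ (A.1 i) p
        have h7 := psum_mono (A.1 i) (show (p : ℕ) + 1 ≤ b from hb)
        rw [corner_succ C.1, psum_eq_zero_of_first hp' (not_lt.1 hb')] at h2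
        rw [corner_succ A.1] at h1
        rw [if_pos hb] at h1
        rw [if_neg hb'] at h2
        omega
      · rw [if_neg hb] at h1
        rw [if_neg hb'] at h2
        omega
  · by_cases hlt : (i : ℕ) < a
    · rw [if_pos hlt, if_pos (show (i' : ℕ) < a by omega)] at h1 h2
      omega
    · rw [if_neg hlt, if_neg (show ¬ (i' : ℕ) < a by omega)] at h1 h2
      omega

/-- Left multiplication by a standard basis element is a monotone map on labels. -/
theorem exists_mul_map (X : Mat n r) : ∃ F : Mat n r → Mat n r,
    (∀ A, ro A = co X → e X * e A = e (F A) ∧ ro (F A) = ro X ∧ co (F A) = co A) ∧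
      ∀ A C, ro C = co X → OrbitLE A C → OrbitLE (F A) (F C) := by
  classical
  refine move_induction (P := fun X => ∃ F : Mat n r → Mat n r,
    (∀ A, ro A = co X → e X * e A = e (F A) ∧ ro (F A) = ro X ∧ co (F A) = co A) ∧
      ∀ A C, ro C = co X → OrbitLE A C → OrbitLE (F A) (F C)) ?_ ?_ ?_ X
  · intro l
    refine ⟨id, fun A hA => ⟨?_, ?_, rfl⟩, fun A C _ h => h⟩
    · rw [co_diagM] at hA
      rw [← hA, e_diagM_mul_e]
      rfl
    · rw [ro_diagM, ← co_diagM l, ← hA]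
      rfl
  · rintro i i' X X' hi hX ⟨F, hF, hmono⟩
    have hex : ∀ A, ro A = co X → ∃ B, Up i i' (F A) B := fun A hA =>
      exists_up i (by rw [(hF A hA).2.1]; exact hX.ro_pos)
    -- The default value is never taken on matrices whose row sums are the column sums of X', and
    -- nothing is claimed about the others.
    refine ⟨fun A => if h : ∃ B, Up i i' (F A) B then h.choose else A, fun A hA => ?_,
      fun A C hC h => ?_⟩
    · rw [hX.co_eq] at hA
      have hB := (hex A hA).choose_spec
      simp only [dif_pos (hex A hA)]
      refine ⟨?_, hB.ro_congr hi hX (hF A hA).2.1, hB.co_eq.trans (hF A hA).2.2⟩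
      rw [← hX.eiGen_mul hi, mul_assoc, (hF A hA).1, hB.eiGen_mul hi]
    · rw [hX.co_eq] at hC
      have hA : ro A = co X := h.1.trans hC
      simp only [dif_pos (hex A hA), dif_pos (hex C hC)]
      exact (hmono A C hC h).up hi (hex A hA).choose_spec (hex C hC).choose_spec
  · rintro i i' X X' hi hX ⟨F, hF, hmono⟩
    have hex : ∀ A, ro A = co X → ∃ B, Down i i' (F A) B := fun A hA =>
      exists_down i' (by rw [(hF A hA).2.1]; exact hX.ro_pos)
    refine ⟨fun A => if h : ∃ B, Down i i' (F A) B then h.choose else A, fun A hA => ?_,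
      fun A C hC h => ?_⟩
    · rw [hX.co_eq] at hA
      have hB := (hex A hA).choose_spec
      simp only [dif_pos (hex A hA)]
      refine ⟨?_, hB.ro_congr hi hX (hF A hA).2.1, hB.co_eq.trans (hF A hA).2.2⟩
      rw [← hX.fiGen_mul hi, mul_assoc, (hF A hA).1, hB.fiGen_mul hi]
    · rw [hX.co_eq] at hC
      have hA : ro A = co X := h.1.trans hC
      simp only [dif_pos (hex A hA), dif_pos (hex C hC)]
      exact (hmono A C hC h).down hi (hex A hA).choose_spec (hex C hC).choose_spec

end Monotone

/-! ### The representations on the spans of the `B^λ` -/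

section Rho

variable {n r : ℕ}

open Classical in
/-- The projection to the span of `B^λ` along the other standard basis elements. -/
def toP (l : WComp n r) : CSchur n r →ₗ[ℂ] PSpace l :=
  (eBasis n r).constr ℂ fun A => if h : e A ∈ BSet l then Finsupp.single ⟨e A, h⟩ 1 else 0

/-- The inclusion of the span of `B^λ`. -/
def ofP (l : WComp n r) : PSpace l →ₗ[ℂ] CSchur n r := Finsupp.linearCombination ℂ Subtype.val

theorem toP_of_mem {l : WComp n r} {x : CSchur n r} (h : x ∈ BSet l) :
    toP l x = Finsupp.single ⟨x, h⟩ 1 := by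
  classical
  obtain ⟨A, -, rfl⟩ := exists_of_mem_BSet h
  have h1 := (eBasis n r).constr_basis ℂ
    (fun A => if h : e A ∈ BSet l then Finsupp.single (⟨e A, h⟩ : BSet l) (1 : ℂ) else 0) A
  rw [eBasis_apply] at h1
  refine Eq.trans ?_ (h1.trans (dif_pos h))
  rw [toP]

theorem toP_e_of_notMem {l : WComp n r} {A : Mat n r} (h : e A ∉ BSet l) : toP l (e A) = 0 := by
  rw [toP, ← eBasis_apply, Module.Basis.constr_basis, dif_neg h]

theorem ofP_single {l : WComp n r} (x : BSet l) : ofP l (Finsupp.single x 1) = x := by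
  simp [ofP]

theorem toP_ofP {l : WComp n r} (p : PSpace l) : toP l (ofP l p) = p := by
  induction p using Finsupp.induction_linear with
  | zero => simp
  | add p q hp hq => rw [map_add, map_add, hp, hq]
  | single x c =>
    rw [← mul_one c, ← smul_eq_mul, ← Finsupp.smul_single, map_smul, map_smul, ofP_single,
      toP_of_mem x.2]

theorem toP_eq_zero {l : WComp n r} {x : CSchur n r}
    (hx : x ∈ Submodule.span ℂ (e '' {A | ¬ InB l A})) : toP l x = 0 := by
  induction hx using Submodule.span_induction with
  | mem x hx =>
    obtain ⟨A, hA, rfl⟩ := hx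
    exact toP_e_of_notMem fun h => hA (e_mem_BSet.1 h)
  | zero => rw [map_zero]
  | add x y _ _ hx hy => rw [map_add, hx, hy, add_zero]
  | smul c x _ hx => rw [map_smul, hx, smul_zero]

theorem sub_ofP_toP_mem (l : WComp n r) (x : CSchur n r) :
    x - ofP l (toP l x) ∈ Submodule.span ℂ (e '' {A | ¬ InB l A}) := by
  have hx : x ∈ Submodule.span ℂ (Set.range (e : Mat n r → CSchur n r)) := by
    rw [span_e]; trivial
  induction hx using Submodule.span_induction with
  | mem x hx =>
    obtain ⟨A, rfl⟩ := hx
    by_cases h : e A ∈ BSet l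
    · rw [toP_of_mem h, ofP_single, sub_self]
      exact zero_mem _
    · rw [toP_e_of_notMem h, map_zero, sub_zero]
      exact Submodule.subset_span ⟨A, fun hA => h (e_mem_BSet.2 hA), rfl⟩
  | zero => simp
  | add x y _ _ hx hy =>
    rw [map_add, map_add, add_sub_add_comm]
    exact add_mem hx hy
  | smul c x _ hx =>
    rw [map_smul, map_smul, ← smul_sub]
    exact Submodule.smul_mem _ _ hx

/-- The kernel of `toP` contains the defect, which lies in a left ideal. So the regular action
descends to the quotient, and this identity is the multiplicativity of `rho`. -/
theorem toP_mul_ofP_toP (l : WComp n r) (a x : CSchur n r) :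
    toP l (a * ofP l (toP l x)) = toP l (a * x) := by
  rw [eq_comm, ← sub_eq_zero, ← map_sub, ← mul_sub]
  exact toP_eq_zero ((moveClosed_not_inB l).mul_mem a (sub_ofP_toP_mem l x))

/-- The representation defining `P_λ`. -/
def rho (l : WComp n r) : CSchur n r →ₐ[ℂ] Module.End ℂ (PSpace l) :=
  AlgHom.ofLinearMap
    (LinearMap.mk₂ ℂ (fun a p => toP l (a * ofP l p)) (fun a b p => by rw [add_mul, map_add])
      (fun c a p => by rw [smul_mul_assoc, map_smul]) (fun a p q => by rw [map_add, mul_add, map_add])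
      fun c a p => by rw [map_smul, mul_smul_comm, map_smul])
    (LinearMap.ext fun p => by
      rw [LinearMap.mk₂_apply, one_mul, toP_ofP]
      rfl)
    fun a b => LinearMap.ext fun p => by
      rw [Module.End.mul_apply, LinearMap.mk₂_apply, LinearMap.mk₂_apply, LinearMap.mk₂_apply,
        toP_mul_ofP_toP, mul_assoc]

theorem rho_apply (l : WComp n r) (a : CSchur n r) (p : PSpace l) :
    rho l a p = toP l (a * ofP l p) := rfl

theorem isPAction_rho (l : WComp n r) : IsPAction l (rho l) := by
  intro b hb x
  rw [rho_apply, ofP_single]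
  refine ⟨fun h => toP_of_mem h, fun h => ?_⟩
  obtain ⟨A, hA, hx⟩ := exists_of_mem_BSet x.2
  rw [hx] at h ⊢
  rcases generator_mul_e hb A with h0 | ⟨A', h0, -⟩
  · rw [h0, map_zero]
  · rw [h0] at h ⊢
    exact toP_e_of_notMem h

theorem IsPAction.unique {l : WComp n r} {ρ ρ' : CSchur n r →ₐ[ℂ] Module.End ℂ (PSpace l)}
    (h : IsPAction l ρ) (h' : IsPAction l ρ') : ρ = ρ' := by
  refine AlgHom.ext_of_adjoin_eq_top adjoin_generators fun b hb => ?_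
  refine Finsupp.lhom_ext fun x c => ?_
  rw [← mul_one c, ← smul_eq_mul, ← Finsupp.smul_single, map_smul, map_smul]
  congr 1
  by_cases hx : b * (x : CSchur n r) ∈ BSet l
  · rw [(h b hb x).1 hx, (h' b hb x).1 hx]
  · rw [(h b hb x).2 hx, (h' b hb x).2 hx]

/-! ### The modules `S_λ` -/

theorem diagM_mem_BSet (l : WComp n r) : e (diagM l) ∈ BSet l :=
  e_mem_BSet.2 (inB_of_CB (isColumnBlockDiagonal_diagM l) (co_diagM l))

theorem CB.mem_BSet {l : WComp n r} (A : CB l) : e A.1 ∈ BSet l :=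
  e_mem_BSet.2 (inB_of_CB A.2.1 A.2.2)

/-- The label of an element of `β^λ`. -/
def InCB (l : WComp n r) (A : Mat n r) : Prop := IsColumnBlockDiagonal A.1 ∧ co A = l

theorem moveClosed_not_inCB (l : WComp n r) : MoveClosed fun A : Mat n r => ¬ InCB l A := by
  intro i i' hi A A' h hA hA'
  have hco : co A' = co A := by
    rcases h with h | h
    · exact h.co_eq
    · exact h.co_eq
  by_cases h1 : IsColumnBlockDiagonal A.1
  · exact hA ⟨h1, hco.symm.trans hA'.2⟩
  · exact moveClosed_not_CB i i' hi A A' h h1 hA'.1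

theorem e_mem_betaSet {l : WComp n r} {A : Mat n r} : e A ∈ betaSet l ↔ InCB l A := by
  constructor
  · rintro ⟨A', h⟩
    obtain rfl := e_injective h
    exact A'.2
  · exact fun h => ⟨⟨A, h⟩, rfl⟩

variable {l : WComp n r} {ρ : CSchur n r →ₐ[ℂ] Module.End ℂ (PSpace l)}

variable (l ρ) in
/-- The generator of `P_λ`. -/
def pGen : PMod l ρ := pBasis l ρ ⟨e (diagM l), diagM_mem_BSet l⟩

/-- The rule is prescribed only for generators; induction along elementary moves extends it to all
e_A acting on the diagonal vector, since a label outside B^λ never moves back in. It holds for any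
representation obeying the rule and presents P_λ as a cyclic module. -/
theorem IsPAction.e_smul_pGen (hρ : IsPAction l ρ) (A : Mat n r) :
    (∀ h : e A ∈ BSet l, e A • pGen l ρ = pBasis l ρ ⟨e A, h⟩) ∧
      (e A ∉ BSet l → e A • pGen l ρ = 0) := by
  have step : ∀ (b : CSchur n r), b ∈ generators n r → ∀ A A' : Mat n r, b * e A = e A' →
      (e A ∉ BSet l → e A' ∉ BSet l) →
      ((∀ h : e A ∈ BSet l, e A • pGen l ρ = pBasis l ρ ⟨e A, h⟩) ∧
        (e A ∉ BSet l → e A • pGen l ρ = 0)) →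
      (∀ h : e A' ∈ BSet l, e A' • pGen l ρ = pBasis l ρ ⟨e A', h⟩) ∧
        (e A' ∉ BSet l → e A' • pGen l ρ = 0) := by
    intro b hb A A' hA hcl ih
    have hb1 : ∀ h : e A ∈ BSet l, ∀ h' : e A' ∈ BSet l,
        b • pBasis l ρ ⟨e A, h⟩ = pBasis l ρ ⟨e A', h'⟩ := by
      intro h h'
      have := (hρ b hb ⟨e A, h⟩).1 (by rw [hA]; exact h')
      refine this.trans ?_
      simp only [hA]
      rfl
    rw [← hA, mul_smul]
    by_cases h : e A ∈ BSet l
    · rw [ih.1 h, hA]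
      refine ⟨hb1 h, fun h' => ?_⟩
      exact (hρ b hb ⟨e A, h⟩).2 (by rw [hA]; exact h')
    · rw [ih.2 h, smul_zero, hA]
      exact ⟨fun h' => absurd h' (hcl h), fun _ => rfl⟩
  have hcl : ∀ i i' : Fin n, (i : ℕ) + 1 = i' → ∀ A A' : Mat n r, (Up i i' A A' ∨ Down i i' A A') →
      e A ∉ BSet l → e A' ∉ BSet l := by
    intro i i' hi A A' h h1
    rw [e_mem_BSet] at h1 ⊢
    exact moveClosed_not_inB l i i' hi A A' h h1
  refine move_induction (P := fun A => (∀ h : e A ∈ BSet l, e A • pGen l ρ = pBasis l ρ ⟨e A, h⟩) ∧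
      (e A ∉ BSet l → e A • pGen l ρ = 0)) ?_ ?_ ?_ A
  · intro m
    have hm : kElt m * e (diagM l) = if m = l then e (diagM l) else 0 := by
      rw [kElt_mul_e, ro_diagM]
    have hk := hρ (kElt m) (kElt_mem m) ⟨e (diagM l), diagM_mem_BSet l⟩
    by_cases hml : m = l
    · subst hml
      rw [if_pos rfl] at hm
      refine ⟨fun h => ?_, fun h => absurd (diagM_mem_BSet m) h⟩
      have h1 : kElt m • pGen m ρ = pBasis m ρ ⟨e (diagM m), h⟩ := by
        refine (hk.1 (by rw [hm]; exact h)).trans ?_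
        simp only [hm]
        rfl
      rw [kElt_eq] at h1
      exact h1
    · rw [if_neg hml] at hm
      refine ⟨fun h => absurd ((e_mem_BSet.1 h).1.symm.trans (co_diagM m)).symm hml, fun _ => ?_⟩
      rw [← kElt_eq]
      refine hk.2 ?_
      rw [hm]
      intro h0
      obtain ⟨A, -, hA⟩ := exists_of_mem_BSet h0
      exact e_ne_zero A hA.symm
  · intro i i' A A' hi h ih
    exact step _ (eiGen_mem hi) A A' (h.eiGen_mul hi) (hcl i i' hi A A' (Or.inl h)) ih
  · intro i i' A A' hi h ih
    exact step _ (fiGen_mem hi) A A' (h.fiGen_mul hi) (hcl i i' hi A A' (Or.inr h)) ih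

/-- `N_λ` is the image of the span of the `e_A` with `A` not column block diagonal. -/
theorem IsPAction.mem_NSpan (hρ : IsPAction l ρ) {m : PMod l ρ} : m ∈ NSpan l ρ ↔
    ∃ x ∈ Submodule.span ℂ (e '' {A | ¬ InCB l A}), m = x • pGen l ρ := by
  constructor
  · intro hm
    rw [NSpan] at hm
    induction hm using Submodule.span_induction with
    | mem m hm =>
      obtain ⟨x, hx, rfl⟩ := hm
      obtain ⟨A, hA, hxA⟩ := exists_of_mem_BSet x.2
      obtain ⟨x, hxB⟩ := x
      simp only at hxA
      subst hxA
      exact ⟨e A, Submodule.subset_span ⟨A, fun h => hx (e_mem_betaSet.2 h), rfl⟩,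
        ((hρ.e_smul_pGen A).1 hxB).symm⟩
    | zero => exact ⟨0, zero_mem _, (zero_smul (CSchur n r) (pGen l ρ)).symm⟩
    | add m m' _ _ h h' =>
      obtain ⟨x, hx, rfl⟩ := h
      obtain ⟨x', hx', rfl⟩ := h'
      exact ⟨x + x', add_mem hx hx', (add_smul _ _ _).symm⟩
    | smul c m _ h =>
      obtain ⟨x, hx, rfl⟩ := h
      exact ⟨c • x, Submodule.smul_mem _ _ hx, (smul_assoc _ _ _).symm⟩
  · rintro ⟨x, hx, rfl⟩
    induction hx using Submodule.span_induction with
    | mem x hx =>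
      obtain ⟨A, hA, rfl⟩ := hx
      by_cases h : e A ∈ BSet l
      · rw [(hρ.e_smul_pGen A).1 h]
        exact Submodule.subset_span ⟨_, fun h1 => hA (e_mem_betaSet.1 h1), rfl⟩
      · rw [(hρ.e_smul_pGen A).2 h]
        exact zero_mem _
    | zero =>
      have h0 : (0 : CSchur n r) • pGen l ρ = 0 := zero_smul (CSchur n r) (pGen l ρ)
      rw [h0]; exact zero_mem _
    | add x y _ _ hx hy => rw [add_smul]; exact add_mem hx hy
    | smul c x _ hx => rw [smul_assoc]; exact Submodule.smul_mem _ _ hx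

variable (l ρ) in
/-- `N_λ` as a submodule. -/
def NSub (hρ : IsPAction l ρ) : Submodule (CSchur n r) (PMod l ρ) where
  carrier := NSpan l ρ
  add_mem' := add_mem
  zero_mem' := zero_mem _
  smul_mem' a m hm := by
    obtain ⟨x, hx, rfl⟩ := hρ.mem_NSpan.1 hm
    exact hρ.mem_NSpan.2 ⟨a * x, (moveClosed_not_inCB l).mul_mem a hx, smul_smul _ _ _⟩

theorem restrictScalars_NSub (hρ : IsPAction l ρ) :
    (NSub l ρ hρ).restrictScalars ℂ = NSpan l ρ := rfl

variable (l ρ) in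
/-- The basis of `P_λ`. -/
def pB : Module.Basis (BSet l) ℂ (PMod l ρ) := Finsupp.basisSingleOne

theorem pB_apply (x : BSet l) : pB l ρ x = pBasis l ρ x :=
  congrFun (Finsupp.coe_basisSingleOne (R := ℂ) (ι := BSet l)) x

/-- The class of `e_A` in `S_λ`. -/
def sVec (hρ : IsPAction l ρ) (A : CB l) : PMod l ρ ⧸ NSub l ρ hρ :=
  (NSub l ρ hρ).mkQ (pBasis l ρ ⟨e A.1, A.mem_BSet⟩)

theorem linearIndependent_sVec (hρ : IsPAction l ρ) : LinearIndependent ℂ (sVec hρ) := by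
  have h1 : LinearIndependent ℂ fun A : CB l => pBasis l ρ ⟨e A.1, A.mem_BSet⟩ := by
    have := (pB l ρ).linearIndependent.comp (fun A : CB l => (⟨e A.1, A.mem_BSet⟩ : BSet l))
      fun A A' h => Subtype.ext (e_injective (congrArg Subtype.val h))
    convert this using 1
    funext A
    exact (pB_apply _).symm
  refine h1.map (f := (NSub l ρ hρ).mkQ.restrictScalars ℂ) ?_
  have hker : LinearMap.ker ((NSub l ρ hρ).mkQ.restrictScalars ℂ) = NSpan l ρ := by
    ext m
    rw [LinearMap.mem_ker, LinearMap.restrictScalars_apply, Submodule.mkQ_apply,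
      Submodule.Quotient.mk_eq_zero]
    rfl
  rw [hker, NSpan]
  have hr : Set.range (fun A : CB l => pBasis l ρ ⟨e A.1, A.mem_BSet⟩) =
      pB l ρ '' {x : BSet l | (x : CSchur n r) ∈ betaSet l} := by
    ext m
    constructor
    · rintro ⟨A, rfl⟩
      exact ⟨⟨e A.1, A.mem_BSet⟩, ⟨A, rfl⟩, pB_apply _⟩
    · rintro ⟨⟨x, hxB⟩, ⟨A, hx⟩, rfl⟩
      simp only at hx
      subst hx
      exact ⟨A, (pB_apply _).symm⟩
  have hc : pBasis l ρ '' {x : BSet l | (x : CSchur n r) ∉ betaSet l} =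
      pB l ρ '' {x : BSet l | (x : CSchur n r) ∉ betaSet l} :=
    Set.image_congr fun x _ => (pB_apply x).symm
  rw [hr, hc]
  exact (pB l ρ).linearIndependent.disjoint_span_image
    (Set.disjoint_left.2 fun x hx hx' => hx' hx)

theorem mkQ_pBasis_of_not_inCB (hρ : IsPAction l ρ) {x : BSet l}
    (h : (x : CSchur n r) ∉ betaSet l) : (NSub l ρ hρ).mkQ (pBasis l ρ x) = 0 := by
  rw [Submodule.mkQ_apply, Submodule.Quotient.mk_eq_zero]
  exact Submodule.subset_span ⟨x, h, rfl⟩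

theorem span_sVec (hρ : IsPAction l ρ) : Submodule.span ℂ (Set.range (sVec hρ)) = ⊤ := by
  rw [eq_top_iff]
  rintro q -
  obtain ⟨m, rfl⟩ := (NSub l ρ hρ).mkQ_surjective q
  induction (pB l ρ).mem_span m using Submodule.span_induction with
  | mem m hm =>
    obtain ⟨x, rfl⟩ := hm
    rw [pB_apply]
    by_cases h : (x : CSchur n r) ∈ betaSet l
    · obtain ⟨x, hxB⟩ := x
      obtain ⟨A, hA⟩ := h
      simp only at hA
      subst hA
      exact Submodule.subset_span ⟨A, rfl⟩
    · rw [mkQ_pBasis_of_not_inCB hρ h]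
      exact zero_mem _
  | zero => rw [map_zero]; exact zero_mem _
  | add x y _ _ hx hy => rw [map_add]; exact add_mem hx hy
  | smul c x _ hx => exact Submodule.smul_mem _ c hx

/-- The basis of `S_λ`. -/
def sBasis (hρ : IsPAction l ρ) : Module.Basis (CB l) ℂ (PMod l ρ ⧸ NSub l ρ hρ) :=
  Module.Basis.mk (linearIndependent_sVec hρ) (span_sVec hρ).ge

theorem sBasis_apply (hρ : IsPAction l ρ) (A : CB l) : sBasis hρ A = sVec hρ A :=
  Module.Basis.mk_apply _ _ _

variable (l) in
/-- The diagonal matrix as a column block diagonal matrix. -/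
def diagCB : CB l := ⟨diagM l, isColumnBlockDiagonal_diagM l, co_diagM l⟩

theorem e_smul_sVec_diagCB (hρ : IsPAction l ρ) (A : CB l) :
    e A.1 • sVec hρ (diagCB l) = sVec hρ A := by
  refine (map_smul _ _ _).symm.trans ?_
  exact congrArg _ ((hρ.e_smul_pGen A.1).1 A.mem_BSet)

theorem e_smul_sVec_diagCB_of_not (hρ : IsPAction l ρ) {A : Mat n r} (hA : ¬ InCB l A) :
    e A • sVec hρ (diagCB l) = 0 := by
  refine (map_smul _ _ _).symm.trans ?_
  rw [Submodule.mkQ_apply, Submodule.Quotient.mk_eq_zero]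
  exact hρ.mem_NSpan.2 ⟨e A, Submodule.subset_span ⟨A, hA, rfl⟩, rfl⟩

/-! ### Weights and simplicity of the quotients. -/

theorem kElt_smul_sVec (hρ : IsPAction l ρ) (m : WComp n r) (A : CB l) :
    kElt m • sVec hρ A = if m = ro A.1 then sVec hρ A else 0 := by
  rw [← e_smul_sVec_diagCB hρ A]
  refine (mul_smul (kElt m) (e A.1) (sVec hρ (diagCB l))).symm.trans ?_
  rw [kElt_mul_e]
  split_ifs
  · rfl
  · exact zero_smul (CSchur n r) (sVec hρ (diagCB l))

/-- If column j is nonzero, so is the preceding one, by the bullet condition. Its entries are in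
rows at least j - 1 by induction, and column block diagonality pushes those of column j strictly
below. -/
theorem le_of_CB_bullet {A : Mat n r} (hA : IsColumnBlockDiagonal A.1) (hl : IsBullet (co A))
    {k j : Fin n} (h : A.1 k j ≠ 0) : j ≤ k := by
  obtain ⟨m, hm⟩ : ∃ m, m = (j : ℕ) := ⟨_, rfl⟩
  induction m generalizing k j with
  | zero => exact Fin.le_def.2 (by omega)
  | succ m ih =>
    obtain ⟨j', hj'⟩ : ∃ j' : Fin n, m = j' := ⟨⟨m, by omega⟩, rfl⟩
    have hjj : j' < j := Fin.lt_def.2 (by omega)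
    have hco : (co A).1 j' ≠ 0 := by
      intro h0
      have h1 : ∑ i, A.1 i j = 0 := hl j' j hjj h0
      exact h (Finset.sum_eq_zero_iff.1 h1 k (Finset.mem_univ k))
    obtain ⟨i, hi⟩ := exists_ne_zero_of_co_ne_zero hco
    have h1 := Fin.le_def.1 (ih hi hj')
    have h2 : i < k := by
      by_contra hc
      exact h (hA i j' (Nat.pos_of_ne_zero hi) k j (not_lt.1 hc) hjj)
    rw [Fin.lt_def] at h2
    exact Fin.le_def.2 (by omega)

/-- Every class of `β^λ` generates the class of the diagonal matrix. -/
theorem exists_mul_e_eq_diagM {A : Mat n r} (hA : IsColumnBlockDiagonal A.1)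
    (hl : IsBullet (co A)) : ∃ a, a * e A = e (diagM (co A)) := by
  classical
  induction hm : offDiag A using Nat.strong_induction_on generalizing A with
  | _ m ih =>
    by_cases hd : ∃ k j : Fin n, k ≠ j ∧ A.1 k j ≠ 0
    -- Take the topmost row with an entry off the diagonal. A row of a column block diagonal matrix
    -- has only one nonzero entry, so raising takes a unit from this one, which is left of the
    -- diagonal and comes closer to it.
    · obtain ⟨k, hk, hmin⟩ := Finset.exists_min_image
        (Finset.univ.filter fun k : Fin n => ∃ j, k ≠ j ∧ A.1 k j ≠ 0) id
        (by obtain ⟨k, hk⟩ := hd; exact ⟨k, by simpa using hk⟩)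
      simp only [Finset.mem_filter, Finset.mem_univ, true_and, id] at hk hmin
      obtain ⟨j, hkj, hAkj⟩ := hk
      have hjk := Fin.le_def.1 (le_of_CB_bullet hA hl hAkj)
      rw [Ne, Fin.ext_iff] at hkj
      obtain ⟨k', hk'⟩ : ∃ k' : Fin n, (k' : ℕ) + 1 = k := ⟨⟨k - 1, by omega⟩, by simp; omega⟩
      obtain ⟨A', hup⟩ := exists_up k' (A := A) (i' := k) (ro_pos_of_pos (Nat.pos_of_ne_zero hAkj))
      have hup' := hup
      obtain ⟨p, hp0, hp, hmv⟩ := hup'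
      have hpj : p = j := by
        rcases lt_trichotomy p j with h | h | h
        · exact absurd (hp j h) hAkj
        · exact h
        · exact absurd (hA k j (Nat.pos_of_ne_zero hAkj) k p le_rfl h) hp0.ne'
      subst hpj
      have hA' : IsColumnBlockDiagonal A'.1 := by
        intro i j1 h1 i' j2 hi hj
        by_contra h2
        rcases move_ne_zero hmv h1.ne' with h3 | ⟨rfl, rfl⟩
        · rcases move_ne_zero hmv h2 with h4 | ⟨rfl, rfl⟩
          · exact h4 (hA i j1 (Nat.pos_of_ne_zero h3) i' j2 hi hj)
          · by_cases hik : k ≤ i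
            · exact hAkj (hA i j1 (Nat.pos_of_ne_zero h3) k j2 hik hj)
            · have h5 : i = i' := by
                apply Fin.ext
                rw [Fin.le_def] at hi hik
                omega
              subst h5
              -- Row k', just above k, has only its diagonal entry. A violation to the right of it
              -- would need the moved unit in a column at least k, but that column is before k.
              have h6 : i = j1 := by
                by_contra h6
                have := hmin i ⟨j1, h6, h3⟩
                exact hik this
              rw [Fin.lt_def] at hj
              rw [Fin.ext_iff] at h6
              omega
        · rcases move_ne_zero hmv h2 with h4 | ⟨-, h4⟩
          · rw [Fin.le_def] at hi
            exact h4 (hA k j1 hp0 i' j2 (Fin.le_def.2 (by omega)) hj)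
          · exact hj.ne' h4
      have hoff := offDiag_move hmv
      obtain ⟨a, ha⟩ := ih (offDiag A') (by omega) hA' (by rw [hup.co_eq]; exact hl) rfl
      refine ⟨a * eiGen n r k' k, ?_⟩
      rw [mul_assoc, hup.eiGen_mul hk', ha, hup.co_eq]
    · push Not at hd
      refine ⟨1, ?_⟩
      have h1 := eq_diagM hd
      have h2 : co A = ro A := by
        conv_lhs => rw [h1]
        rw [co_diagM]
      rw [one_mul, h2, ← h1]

theorem surjective_smul_sVec_diagCB (hρ : IsPAction l ρ) (q : PMod l ρ ⧸ NSub l ρ hρ) :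
    ∃ a : CSchur n r, a • sVec hρ (diagCB l) = q := by
  have hq : q ∈ Submodule.span ℂ (Set.range (sVec hρ)) := by
    rw [span_sVec]; trivial
  induction hq using Submodule.span_induction with
  | mem x hx =>
    obtain ⟨A, rfl⟩ := hx
    exact ⟨e A.1, e_smul_sVec_diagCB hρ A⟩
  | zero => exact ⟨0, zero_smul (CSchur n r) (sVec hρ (diagCB l))⟩
  | add x y _ _ hx hy =>
    obtain ⟨a, rfl⟩ := hx
    obtain ⟨b, rfl⟩ := hy
    exact ⟨a + b, add_smul _ _ _⟩
  | smul c x _ hx =>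
    obtain ⟨a, rfl⟩ := hx
    exact ⟨c • a, smul_assoc _ _ _⟩

theorem smul_smul_quotient (hρ : IsPAction l ρ) (a : CSchur n r) (c : ℂ)
    (q : PMod l ρ ⧸ NSub l ρ hρ) : a • c • q = c • a • q := by
  have h1 : c • q = (c • (1 : CSchur n r)) • q :=
    ((smul_assoc c (1 : CSchur n r) q).trans (congrArg _ (one_smul (CSchur n r) q))).symm
  have h2 : c • a • q = (c • a) • q := (smul_assoc c a q).symm
  rw [h1, h2]
  refine (mul_smul a _ q).symm.trans ?_
  rw [mul_smul_comm, mul_one]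

/-- The basis vectors have distinct weights by `CB_unique`, so some k_μ cuts a nonzero vector down
to a nonzero multiple of one of them. Raising its units leads to the class of the diagonal matrix,
which generates. -/
theorem isSimpleModule_quotient (hρ : IsPAction l ρ) (hl : IsBullet l) :
    IsSimpleModule (CSchur n r) (PMod l ρ ⧸ NSub l ρ hρ) := by
  rw [isSimpleModule_iff_toSpanSingleton_surjective]
  refine ⟨⟨sVec hρ (diagCB l), 0, ?_⟩, fun q hq => ?_⟩
  · rw [← sBasis_apply]
    exact (sBasis hρ).ne_zero _
  · obtain ⟨A, hA⟩ : ∃ A, (sBasis hρ).repr q A ≠ 0 := by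
      by_contra! h
      exact hq ((sBasis hρ).repr.map_eq_zero_iff.1 (Finsupp.ext h))
    have h1 : kElt (ro A.1) • q = (sBasis hρ).repr q A • sVec hρ A := by
      conv_lhs => rw [← (sBasis hρ).linearCombination_repr q, Finsupp.linearCombination_apply,
        Finsupp.sum, Finset.smul_sum]
      simp only [sBasis_apply]
      rw [Finset.sum_eq_single A]
      · rw [smul_smul_quotient, kElt_smul_sVec, if_pos rfl]
      · intro B _ hB
        rw [smul_smul_quotient, kElt_smul_sVec, if_neg, smul_zero]
        intro hro
        exact hB (Subtype.ext (CB_unique B.2.1 A.2.1 hro.symm (B.2.2.trans A.2.2.symm)))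
      · intro h
        exact absurd (by simpa using h) hA
    obtain ⟨a, ha⟩ := exists_mul_e_eq_diagM A.2.1 (by rw [A.2.2]; exact hl)
    intro q'
    obtain ⟨b, rfl⟩ := surjective_smul_sVec_diagCB hρ q'
    refine ⟨b * a * (((sBasis hρ).repr q A)⁻¹ • kElt (ro A.1)), ?_⟩
    have h2 : (((sBasis hρ).repr q A)⁻¹ • kElt (ro A.1)) • q = sVec hρ A := by
      refine (smul_assoc _ _ q).trans ?_
      rw [h1, inv_smul_smul₀ hA]
    have h3 : a • sVec hρ A = sVec hρ (diagCB l) := by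
      rw [← e_smul_sVec_diagCB hρ A]
      refine (mul_smul a (e A.1) (sVec hρ (diagCB l))).symm.trans ?_
      rw [ha, A.2.2]
      exact e_smul_sVec_diagCB hρ (diagCB l)
    refine (mul_smul (b * a) _ q).trans ?_
    rw [h2]
    refine (mul_smul b a (sVec hρ A)).trans ?_
    rw [h3]

end Rho

/-! ### The modules `S_λ` are pairwise nonisomorphic -/

section Classification

variable {n r : ℕ}

theorem exists_of_corner_lt {A : Mat n r} {a : ℕ} (h : corner A.1 a a < psum (ro A).1 a) :
    ∃ k l : Fin n, (k : ℕ) < a ∧ a ≤ l ∧ A.1 k l ≠ 0 := by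
  obtain ⟨k, hk, h1⟩ := exists_lt_of_psum_lt (f := fun k => psum (A.1 k) a) h
  obtain ⟨l, hl, h2⟩ := exists_of_psum_lt (f := A.1 k) (a := a) h1
  exact ⟨k, l, hk, hl, h2⟩

/-- These matrices vanish above the diagonal, so the units of the first a rows lie in the first a
columns. -/
theorem psum_ro_le_of_CB_bullet {A : Mat n r} (hA : IsColumnBlockDiagonal A.1)
    (hl : IsBullet (co A)) (a : ℕ) : psum (ro A).1 a ≤ psum (co A).1 a := by
  by_contra! h
  have h1 := corner_of_CB hA a a
  obtain ⟨k, l, hk, hl', h2⟩ := exists_of_corner_lt (A := A) (a := a) (by omega)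
  have := Fin.le_def.1 (le_of_CB_bullet hA hl h2)
  omega

variable {l m : WComp n r} {ρ : CSchur n r →ₐ[ℂ] Module.End ℂ (PSpace l)}
  {ρ' : CSchur n r →ₐ[ℂ] Module.End ℂ (PSpace m)}

theorem sVec_ne_zero (hρ : IsPAction l ρ) (A : CB l) : sVec hρ A ≠ 0 := by
  rw [← sBasis_apply]
  exact (sBasis hρ).ne_zero _

theorem exists_CB_ro_eq (hρ : IsPAction l ρ) {q : PMod l ρ ⧸ NSub l ρ hρ} {k : WComp n r}
    (h : kElt k • q ≠ 0) : ∃ A : CB l, ro A.1 = k := by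
  by_contra! hk
  refine h ?_
  have hq : q ∈ Submodule.span ℂ (Set.range (sVec hρ)) := by
    rw [span_sVec]; trivial
  induction hq using Submodule.span_induction with
  | mem x hx =>
    obtain ⟨A, rfl⟩ := hx
    rw [kElt_smul_sVec, if_neg fun h1 => hk A h1.symm]
  | zero => exact smul_zero _
  | add x y _ _ hx hy =>
    by_cases hx0 : kElt k • x = 0
    · by_cases hy0 : kElt k • y = 0
      · rw [smul_add, hx0, hy0, add_zero]
      · exact absurd (hy hy0) hy0
    · exact absurd (hx hx0) hx0
  | smul c x _ hx =>
    rw [smul_smul_quotient]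
    by_cases hx0 : kElt k • x = 0
    · rw [hx0, smul_zero]
    · exact absurd (hx hx0) hx0

/-- The weight l of the diagonal class must also occur in the other module, where partial sums of
weights are bounded by those of m. -/
theorem psum_le_of_equiv (hρ : IsPAction l ρ) (hρ' : IsPAction m ρ') (hm : IsBullet m)
    (φ : (PMod l ρ ⧸ NSub l ρ hρ) ≃ₗ[CSchur n r] (PMod m ρ' ⧸ NSub m ρ' hρ')) (a : ℕ) :
    psum l.1 a ≤ psum m.1 a := by
  obtain ⟨A, hA⟩ := exists_CB_ro_eq hρ' (q := φ (sVec hρ (diagCB l))) (k := l) (by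
    rw [← map_smul, (kElt_smul_sVec hρ l (diagCB l)).trans (if_pos (ro_diagM l).symm)]
    exact fun h => sVec_ne_zero hρ _ (φ.map_eq_zero_iff.1 h))
  have h1 := psum_ro_le_of_CB_bullet A.2.1 (by rw [A.2.2]; exact hm) a
  rwa [hA, A.2.2] at h1

theorem eq_of_equiv (hρ : IsPAction l ρ) (hρ' : IsPAction m ρ') (hl : IsBullet l) (hm : IsBullet m)
    (φ : (PMod l ρ ⧸ NSub l ρ hρ) ≃ₗ[CSchur n r] (PMod m ρ' ⧸ NSub m ρ' hρ')) : l = m :=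
  Subtype.ext <| psum_ext fun a => le_antisymm (psum_le_of_equiv hρ hρ' hm φ a)
    (psum_le_of_equiv hρ' hρ hl φ.symm a)

/-! ### Every simple module occurs -/

theorem corner_le_corner_diagM {C : Mat n r} (hro : ro C = l) (hco : co C = l) (a b : ℕ) :
    corner C.1 a b ≤ corner (diagM l).1 a b := by
  have h1 := corner_le_ro C a b
  have h2 := corner_le_co C a b
  rw [hro] at h1
  rw [hco] at h2
  rw [corner_diagM]
  rcases le_total a b with h | h
  · rwa [min_eq_left h]
  · rwa [min_eq_right h]

/-- The diagonal matrix has the largest corners possible: it labels the closed orbit, the least in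
the order. -/
theorem orbitLE_diagM {C : Mat n r} (hro : ro C = l) (hco : co C = l) : OrbitLE (diagM l) C :=
  orbitLE_iff.2 ⟨(ro_diagM l).trans hro.symm, (co_diagM l).trans hco.symm,
    corner_le_corner_diagM hro hco⟩

/-- If all corners with equal indices were full, monotonicity would make every corner full and C
diagonal. A deficient one leaves a unit in the first a rows outside the first a columns, and the
bullet condition carries nonvanishing from its column back to column a. -/
theorem exists_corner_lt_of_ne_diagM {C : Mat n r} (hl : IsBullet l) (hro : ro C = l)
    (hco : co C = l) (hC : C ≠ diagM l) : ∃ i i' : Fin n, (i : ℕ) + 1 = i' ∧ 0 < l.1 i' ∧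
      corner C.1 (i + 1) (i + 1) < psum l.1 (i + 1) := by
  obtain ⟨a, ha⟩ : ∃ a, corner C.1 a a < psum l.1 a := by
    by_contra! h
    refine hC (Subtype.ext (corner_ext fun a b =>
      le_antisymm (corner_le_corner_diagM hro hco a b) ?_))
    rw [corner_diagM]
    rcases le_total a b with hab | hab
    · rw [min_eq_left hab]
      exact (h a).trans (corner_mono_right _ a hab)
    · rw [min_eq_right hab]
      exact (h b).trans (corner_mono_left _ hab b)
  obtain ⟨k, j, hk, hj, hkj⟩ := exists_of_corner_lt (A := C) (a := a) (by rwa [hro])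
  -- Indices start at 0, so i' is the first index outside the first a; its predecessor exists
  -- because k is below a.
  obtain ⟨i', hi'⟩ : ∃ i' : Fin n, (i' : ℕ) = a := ⟨⟨a, by omega⟩, rfl⟩
  obtain ⟨i, hi⟩ : ∃ i : Fin n, (i : ℕ) + 1 = i' := ⟨⟨a - 1, by omega⟩, by simp; omega⟩
  refine ⟨i, i', hi, Nat.pos_of_ne_zero fun h0 => ?_, by rwa [hi, hi']⟩
  have h1 : ∑ k, C.1 k j = 0 := by
    change (co C).1 j = 0
    rw [hco]
    rcases (Fin.le_def.2 (by omega) : i' ≤ j).eq_or_lt with rfl | h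
    · exact h0
    · exact hl i' j h h0
  exact hkj (Finset.sum_eq_zero_iff.1 h1 k (Finset.mem_univ k))

variable {M : Type*} [AddCommGroup M] [Module (CSchur n r) M]

theorem zero_smul_of_module (v : M) : (0 : CSchur n r) • v = 0 := zero_smul (CSchur n r) v

theorem mul_smul_eq_zero_of_mem_span {s : Set (CSchur n r)} {b x : CSchur n r} {v : M}
    (hx : x ∈ Submodule.span ℂ s) (h : ∀ y ∈ s, (b * y) • v = 0) : (b * x) • v = 0 := by
  induction hx using Submodule.span_induction with
  | mem x hx => exact h x hx
  | zero => exact (congrArg (· • v) (mul_zero b)).trans (zero_smul_of_module v)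
  | add x y _ _ hx hy => rw [mul_add, add_smul, hx, hy, add_zero]
  | smul c x _ hx =>
    -- No complex structure is assumed on M, so the scalar is absorbed into the identity of the
    -- algebra.
    rw [mul_smul_comm, ← one_mul (b * x), ← smul_mul_assoc, mul_smul, hx, smul_zero]

/-- Consecutive raising and lowering of a diagonal matrix. -/
theorem exists_down_up_diagM {i i' : Fin n} (hi : (i : ℕ) + 1 = i') (h : 0 < l.1 i') :
    ∃ A G : Mat n r, Up i i' (diagM l) A ∧ Down i i' A G ∧ ro G = l ∧ co G = l ∧
      (∀ a b, corner (diagM l).1 a b ≤ corner G.1 a b + if a = i + 1 ∧ b = i + 1 then 1 else 0) ∧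
      (l.1 i = 0 → G = diagM l) := by
  obtain ⟨A, hA⟩ := exists_up i (A := diagM l) (i' := i') (by rwa [ro_diagM])
  have hA' := hA
  obtain ⟨p, hp0, hp, hmA⟩ := hA'
  have hpi : p = i' := by
    by_contra hne
    rw [diagM_apply_ne l (Ne.symm hne)] at hp0
    exact hp0.ne rfl
  subst hpi
  obtain ⟨G, hG⟩ := exists_down p (A := A) (i := i)
    (ro_pos_of_pos (Nat.pos_of_ne_zero (move_target_ne_zero
      (fun h => by rw [Fin.ext_iff] at h; omega) hmA)))
  have hG' := hG
  obtain ⟨p', hp0', hp', hmG⟩ := hG'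
  have hor : (diagM l).1 i p' ≠ 0 ∨ p' = p := (move_ne_zero hmA hp0'.ne').imp_right And.right
  have hro : ro G = l := by
    refine Subtype.ext (psum_ext fun a => ?_)
    have h1 := hA.psum_ro hi a
    have h2 := hG.psum_ro hi a
    rw [ro_diagM] at h1
    omega
  have hp'' : p' = i ∨ p' = p := by
    refine hor.imp_left fun h1 => ?_
    by_contra hne
    exact h1 (diagM_apply_ne l (Ne.symm hne))
  refine ⟨A, G, hA, hG, hro, hG.co_eq.trans (hA.co_eq.trans (co_diagM l)), fun a b => ?_,
    fun h0 => ?_⟩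
  -- If the second move takes a unit from the diagonal entry of row i, exactly the corner (i + 1, i
  -- + 1) drops by one; otherwise the two moves cancel.
  · have h1 := corner_move hmA a b
    have h2 := corner_move hmG a b
    have h3 : (p' : ℕ) = i ∨ (p' : ℕ) = p := hp''.imp (congrArg _) (congrArg _)
    split_ifs at h1 h2 ⊢ <;> omega
  · have hpp : p' = p := by
      refine hor.resolve_left fun h1 => h1 ?_
      by_cases hne : i = p'
      · rw [← hne, diagM_apply_self, h0]
      · exact diagM_apply_ne l hne
    subst hpp
    refine Subtype.ext (corner_ext fun a b => ?_)
    have h1 := corner_move hmA a b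
    have h2 := corner_move hmG a b
    omega

variable (M) in
/-- A highest weight of a nonzero module. -/
theorem exists_highest_weight [Nontrivial M] : ∃ l : WComp n r, (∃ m : M, kElt l • m ≠ 0) ∧
    ∀ (i i' : Fin n) (A : Mat n r), (i : ℕ) + 1 = i' → Up i i' (diagM l) A →
      ∀ m : M, e A • m = 0 := by
  classical
  have hne : (Finset.univ.filter fun l : WComp n r => ∃ m : M, kElt l • m ≠ 0).Nonempty := by
    obtain ⟨m, hm⟩ := exists_ne (0 : M)
    by_contra h
    rw [Finset.not_nonempty_iff_eq_empty, Finset.filter_eq_empty_iff] at h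
    refine hm ?_
    rw [← one_smul (CSchur n r) m, ← sum_kElt, Finset.sum_smul]
    refine Finset.sum_eq_zero fun l hl => ?_
    by_contra h1
    exact h hl ⟨m, h1⟩
  -- The sum of the partial sums serves as height: a raising move increases only the partial sum at
  -- i + 1, by one.
  obtain ⟨l, hl, hmax⟩ := Finset.exists_max_image _
    (fun l : WComp n r => ∑ a ∈ Finset.range n, psum l.1 a) hne
  simp only [Finset.mem_filter, Finset.mem_univ, true_and] at hl hmax
  refine ⟨l, hl, fun i i' A hi hA m => ?_⟩
  have h1 : kElt (ro A) • e A • m = 0 := by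
    by_contra h
    refine absurd (hmax (ro A) ⟨_, h⟩) (not_le.2 ?_)
    have h2 : ∀ a, psum (ro A).1 a = psum l.1 a + if a = i + 1 then 1 else 0 := fun a => by
      rw [hA.psum_ro hi, ro_diagM]
    refine Finset.sum_lt_sum (fun a _ => by rw [h2]; omega)
      ⟨i + 1, Finset.mem_range.2 (by omega), ?_⟩
    rw [h2, if_pos rfl]
    exact Nat.lt_succ_self _
  rw [← mul_smul, kElt_mul_e, if_pos rfl] at h1
  exact h1

theorem e_mul_e_diagM (A : Mat n r) : e A * e (diagM (co A)) = e A := by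
  conv_rhs => rw [← mul_one (e A), ← sum_kElt, Finset.mul_sum]
  rw [Finset.sum_eq_single (co A), kElt_eq]
  · intro l _ hl
    rw [kElt_eq, e_mul_e_eq_zero (by rw [ro_diagM]; exact hl.symm)]
  · exact fun h => absurd (Finset.mem_univ _) h

/-- On a simple module with highest weight `l`, the nonidentity standard basis elements of the
weight algebra of `l` act by zero. -/
theorem e_smul_eq_zero_of_ne_diagM [IsSimpleModule (CSchur n r) M] (hl : IsBullet l)
    (hw : ∀ (i i' : Fin n) (A : Mat n r), (i : ℕ) + 1 = i' → Up i i' (diagM l) A →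
      ∀ m : M, e A • m = 0) {C : Mat n r} (hro : ro C = l) (hco : co C = l) (hC : C ≠ diagM l)
    (v : M) : e C • v = 0 := by
  classical
  by_contra hv
  -- A counterexample with the most matrices below it is maximal in the orbit order.
  obtain ⟨B, hB, hmax⟩ := Finset.exists_max_image (Finset.univ.filter fun B : Mat n r =>
      ro B = l ∧ co B = l ∧ B ≠ diagM l ∧ ∃ m : M, e B • m ≠ 0)
    (fun B => (Finset.univ.filter fun X => OrbitLE X B).card)
    ⟨C, by simpa using ⟨hro, hco, hC, v, hv⟩⟩
  simp only [Finset.mem_filter, Finset.mem_univ, true_and] at hB hmax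
  obtain ⟨hroB, hcoB, hBD, w, hw0⟩ := hB
  obtain ⟨F, hF, hmono⟩ := exists_mul_map B
  have hFD : F (diagM l) = B := by
    refine e_injective ?_
    rw [← (hF _ (by rw [ro_diagM, hcoB])).1, ← hcoB, e_mul_e_diagM]
  -- With e_G = f_i e_i k_l and G ≼ C, monotonicity gives B = F D_l ≼ F G ≼ F C. If F C = B, then F
  -- G = B as well, and e_B = e_B e_G acts by zero, against the choice of B. Otherwise F C is
  -- strictly above B, so its element acts by zero by maximality.
  have hmul : ∀ C : Mat n r, ro C = l → co C = l → C ≠ diagM l → ∀ m : M, (e B * e C) • m = 0 := by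
    intro C hro hco hC m
    obtain ⟨i, i', hi, hpos, hlt⟩ := exists_corner_lt_of_ne_diagM hl hro hco hC
    obtain ⟨A, G, hA, hG, hroG, hcoG, hcor, -⟩ := exists_down_up_diagM hi hpos
    have hGC : OrbitLE G C := by
      refine orbitLE_iff.2 ⟨hroG.trans hro.symm, hcoG.trans hco.symm, fun a b => ?_⟩
      have h1 := corner_le_corner_diagM hro hco a b
      have h2 := hcor a b
      split_ifs at h2 with h3
      · obtain ⟨rfl, rfl⟩ := h3
        rw [corner_diagM, min_self] at h2
        omega
      · omega
    have hBG : OrbitLE B (F G) := by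
      rw [← hFD]
      exact hmono _ _ (by rw [hroG, hcoB]) (orbitLE_diagM hroG hcoG)
    have hGC' := hmono _ _ (by rw [hro, hcoB]) hGC
    have hC1 := hF C (by rw [hro, hcoB])
    rw [hC1.1]
    by_cases hFC : F C = B
    · refine absurd ?_ hw0
      rw [hFC] at hGC'
      have h1 : F G = B := OrbitLE.antisymm hGC' hBG
      have h2 := (hF G (by rw [hroG, hcoB])).1
      rw [h1] at h2
      rw [← h2, ← hG.fiGen_mul hi, mul_smul, mul_smul, hw i i' A hi hA, smul_zero, smul_zero]
    · by_contra h0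
      have hle := hmax (F C) ⟨hC1.2.1.trans hroB, hC1.2.2.trans hco, fun h => ?_, m, h0⟩
      · have h1 := Finset.eq_of_subset_of_card_le (fun X hX => by
          simp only [Finset.mem_filter, Finset.mem_univ, true_and] at hX ⊢
          exact hX.trans (hBG.trans hGC')) hle
        have h2 : F C ∈ Finset.univ.filter fun X => OrbitLE X B := by
          rw [h1]
          simpa using OrbitLE.refl (F C)
        exact hFC (OrbitLE.antisymm (by simpa using h2) (hBG.trans hGC'))
      · refine hBD (OrbitLE.antisymm ?_ (orbitLE_diagM hroB hcoB))
        rw [← h]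
        exact hBG.trans hGC'
  -- Simplicity gives w = a e_B w, hence e_B w = e_B a e_B w. Expanding a, each e_B e_X e_B kills w
  -- by the claim above or because the weights do not match.
  obtain ⟨a, ha⟩ := IsSimpleModule.toSpanSingleton_surjective (CSchur n r) hw0 w
  rw [LinearMap.toSpanSingleton_apply] at ha
  refine hw0 ?_
  rw [← ha, ← mul_smul]
  have hx : a ∈ Submodule.span ℂ (Set.range (e : Mat n r → CSchur n r)) := by
    rw [span_e]; trivial
  refine mul_smul_eq_zero_of_mem_span hx ?_
  rintro _ ⟨X, rfl⟩
  by_cases h1 : ro X = l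
  · by_cases h2 : co X = l
    · by_cases h3 : X = diagM l
      · have h4 : e (diagM l) * e B = e B := by rw [← hroB]; exact e_diagM_mul_e B
        rw [mul_smul, h3, ← mul_smul (e (diagM l)), h4, ← mul_smul]
        exact hmul B hroB hcoB hBD w
      · exact hmul X h1 h2 h3 _
    · rw [mul_smul, ← mul_smul (e X), e_mul_e_eq_zero (by rwa [hroB]), zero_smul_of_module, smul_zero]
  · rw [e_mul_e_eq_zero (by rw [hcoB]; exact Ne.symm h1), zero_smul_of_module]

/-- Otherwise v = k_l a e_A v for some a, and a e_A stays in the left ideal spanned by labels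
outside CB(l). Among these, k_l retains only row sums l, v sees only column sums l, and what is left
is nondiagonal and acts by zero; so v would vanish. -/
theorem e_smul_eq_zero_of_not_inCB [IsSimpleModule (CSchur n r) M]
    (hC : ∀ C : Mat n r, ro C = l → co C = l → C ≠ diagM l → ∀ m : M, e C • m = 0)
    {v : M} (hv : kElt l • v = v) {A : Mat n r} (hA : ¬ InCB l A) : e A • v = 0 := by
  by_cases hco : co A = l
  · by_contra h0
    obtain ⟨a, ha⟩ := IsSimpleModule.toSpanSingleton_surjective (CSchur n r) h0 v
    rw [LinearMap.toSpanSingleton_apply] at ha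
    have hx := (moveClosed_not_inCB l).mul_mem a (Submodule.subset_span ⟨A, hA, rfl⟩)
    refine h0 ?_
    have hv0 : v = 0 := by
      have h1 : v = (kElt l * (a * e A)) • v := by rw [mul_smul, mul_smul, ha, hv]
      rw [h1]
      refine mul_smul_eq_zero_of_mem_span hx ?_
      rintro _ ⟨X, hX, rfl⟩
      rw [kElt_mul_e]
      split_ifs with hl
      · by_cases hcoX : co X = l
        · refine hC X hl.symm hcoX ?_ v
          rintro rfl
          exact hX ⟨isColumnBlockDiagonal_diagM l, co_diagM l⟩
        · rw [← hv, ← mul_smul, kElt_eq, e_mul_e_eq_zero (by rwa [ro_diagM]), zero_smul_of_module]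
      · exact zero_smul_of_module v
    rw [hv0, smul_zero]
  · rw [← hv, ← mul_smul, kElt_eq, e_mul_e_eq_zero (by rwa [ro_diagM]), zero_smul_of_module]

/-- This identifies the annihilator of the generator of S_λ as the span of the e_A with A outside
CB(λ). -/
theorem repr_smul_sVec_diagCB (hρ : IsPAction l ρ) (a : CSchur n r) (A : CB l) :
    (sBasis hρ).repr (a • sVec hρ (diagCB l)) A = (eBasis n r).repr a A.1 := by
  classical
  have hx : a ∈ Submodule.span ℂ (Set.range (e : Mat n r → CSchur n r)) := by
    rw [span_e]; trivial
  induction hx using Submodule.span_induction with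
  | mem x hx =>
    obtain ⟨X, rfl⟩ := hx
    rw [← eBasis_apply X, Module.Basis.repr_self, eBasis_apply]
    by_cases hX : InCB l X
    · rw [e_smul_sVec_diagCB hρ ⟨X, hX⟩, ← sBasis_apply, Module.Basis.repr_self,
        Finsupp.single_apply, Finsupp.single_apply]
      simp only [Subtype.ext_iff]
    · rw [e_smul_sVec_diagCB_of_not hρ hX, map_zero, Finsupp.single_apply, if_neg]
      · rfl
      · rintro rfl
        exact hX A.2
  | zero =>
    rw [show (0 : CSchur n r) • sVec hρ (diagCB l) = 0 from
      zero_smul (CSchur n r) (sVec hρ (diagCB l)), map_zero, map_zero]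
    rfl
  | add x y _ _ hx hy =>
    rw [show (x + y) • sVec hρ (diagCB l) = x • sVec hρ (diagCB l) + y • sVec hρ (diagCB l) from
      add_smul x y (sVec hρ (diagCB l)), map_add, map_add, Finsupp.add_apply, Finsupp.add_apply,
      hx, hy]
  | smul c x _ hx =>
    have h1 : (sBasis hρ).repr (c • x • sVec hρ (diagCB l)) =
        c • (sBasis hρ).repr (x • sVec hρ (diagCB l)) := map_smul _ c _
    rw [show (c • x) • sVec hρ (diagCB l) = c • x • sVec hρ (diagCB l) from
      smul_assoc c x (sVec hρ (diagCB l)), h1,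
      map_smul (eBasis n r).repr c x, Finsupp.smul_apply,
      Finsupp.smul_apply, hx]

theorem smul_eq_zero_of_smul_sVec_diagCB (hρ : IsPAction l ρ) {v : M}
    (hv : ∀ A : Mat n r, ¬ InCB l A → e A • v = 0) {a : CSchur n r}
    (ha : a • sVec hρ (diagCB l) = 0) : a • v = 0 := by
  rw [← (eBasis n r).sum_repr a, Finset.sum_smul]
  refine Finset.sum_eq_zero fun A _ => ?_
  by_cases hA : InCB l A
  · have h1 := repr_smul_sVec_diagCB hρ a ⟨A, hA⟩
    rw [ha, map_zero] at h1
    rw [← h1]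
    exact (congrArg (· • v) (zero_smul ℂ _)).trans (zero_smul_of_module v)
  · rw [eBasis_apply, ← one_mul (e A), ← smul_mul_assoc, mul_smul, hv A hA, smul_zero]

/-- The inclusion of annihilators makes a • s ↦ a • v a well-defined nonzero map between simple
modules, so Schur's lemma applies. -/
theorem nonempty_equiv_of_forall_smul_eq_zero {R S N : Type*} [Ring R] [AddCommGroup S]
    [Module R S] [AddCommGroup N] [Module R N] [IsSimpleModule R S] [IsSimpleModule R N] {s : S}
    {v : N} (hs : s ≠ 0) (hv : v ≠ 0) (h : ∀ a : R, a • s = 0 → a • v = 0) :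
    Nonempty (N ≃ₗ[R] S) := by
  let f := LinearMap.toSpanSingleton R S s
  have hf : Function.Surjective f := IsSimpleModule.toSpanSingleton_surjective R hs
  let g := (LinearMap.ker f).liftQ (LinearMap.toSpanSingleton R N v) fun a ha =>
    LinearMap.mem_ker.2 (h a (LinearMap.mem_ker.1 ha))
  let φ := g.comp (f.quotKerEquivOfSurjective hf).symm.toLinearMap
  have hφ : φ ≠ 0 := by
    intro h0
    have h1 : g ((LinearMap.ker f).mkQ 1) = 0 := by
      have := LinearMap.congr_fun h0 (f.quotKerEquivOfSurjective hf ((LinearMap.ker f).mkQ 1))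
      simpa [φ] using this
    refine hv ?_
    simpa [g] using h1
  exact ⟨(LinearEquiv.ofBijective φ (LinearMap.bijective_of_ne_zero hφ)).symm⟩

/-- If l_i = 0 < l_{i+1}, the raised unit is alone in row i and is lowered back to its place, so f_i
e_i k_l = k_l. This acts by zero on M although l is a weight. -/
theorem isBullet_of_highest_weight (hne : ∃ m : M, kElt l • m ≠ 0)
    (hw : ∀ (i i' : Fin n) (A : Mat n r), (i : ℕ) + 1 = i' → Up i i' (diagM l) A →
      ∀ m : M, e A • m = 0) : IsBullet l := by
  have hstep : ∀ i i' : Fin n, (i : ℕ) + 1 = i' → l.1 i = 0 → l.1 i' = 0 := by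
    intro i i' hi h0
    by_contra h1
    obtain ⟨A, G, hA, hG, -, -, -, hGD⟩ := exists_down_up_diagM hi (Nat.pos_of_ne_zero h1)
    obtain ⟨m, hm⟩ := hne
    refine hm ?_
    rw [kElt_eq, ← hGD h0, ← hG.fiGen_mul hi, mul_smul, hw i i' A hi hA, smul_zero]
  intro i j hij h0
  obtain ⟨d, hd⟩ : ∃ d, (i : ℕ) + d = j := ⟨j - i, by rw [Fin.lt_def] at hij; omega⟩
  clear hij
  induction d generalizing j with
  | zero => rwa [← Fin.ext (hd : (i : ℕ) = j)]
  | succ d ih => exact hstep ⟨i + d, by omega⟩ j (by simpa [add_assoc] using hd) (ih _ rfl)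

theorem nonempty_equiv_of_isSimpleModule [IsSimpleModule (CSchur n r) M]
    (ρ : (l : BulletComp n r) → CSchur n r →ₐ[ℂ] Module.End ℂ (PSpace l.1))
    (hρ : ∀ l, IsPAction l.1 (ρ l)) :
    ∃ l, Nonempty (M ≃ₗ[CSchur n r] (PMod l.1 (ρ l) ⧸ NSub l.1 (ρ l) (hρ l))) := by
  have := IsSimpleModule.nontrivial (CSchur n r) M
  obtain ⟨l, hne, hw⟩ := exists_highest_weight (n := n) (r := r) M
  have hl := isBullet_of_highest_weight hne hw
  obtain ⟨m, hm⟩ := hne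
  have hv : kElt l • kElt l • m = kElt l • m := by
    have h1 := kElt_mul_e l (diagM l)
    rw [if_pos (ro_diagM l).symm, ← kElt_eq] at h1
    rw [← mul_smul, h1]
  have := isSimpleModule_quotient (hρ ⟨l, hl⟩) hl
  refine ⟨⟨l, hl⟩, nonempty_equiv_of_forall_smul_eq_zero
    (sVec_ne_zero (hρ ⟨l, hl⟩) (diagCB l)) hm fun a ha => ?_⟩
  exact smul_eq_zero_of_smul_sVec_diagCB (hρ ⟨l, hl⟩) (fun A hA => e_smul_eq_zero_of_not_inCB
    (fun C hro hco hC => e_smul_eq_zero_of_ne_diagM hl hw hro hco hC) hv hA) ha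

end Classification

end ZeroSchur

end

open ZeroSchur in
/-- The representations defining the modules `P_λ` exist and are unique; for these, the span `N_λ`
of `B^λ \ β^λ` is a submodule of `P_λ`, and the quotients `S_λ = P_λ / N_λ` (with basis the classes
of `e_A` for `A` column block diagonal) are simple, pairwise nonisomorphic, and exhaust the simple
left modules up to isomorphism. -/
theorem mainTheorem1 (n r : ℕ) :
    (∀ l : BulletComp n r,
      ∃! ρ : CSchur n r →ₐ[ℂ] Module.End ℂ (PSpace l.1), IsPAction l.1 ρ) ∧
    ∀ ρ : (l : BulletComp n r) → (CSchur n r →ₐ[ℂ] Module.End ℂ (PSpace l.1)),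
      (∀ l, IsPAction l.1 (ρ l)) →
      ∃ N : (l : BulletComp n r) → Submodule (CSchur n r) (PMod l.1 (ρ l)),
        (∀ l, (N l).restrictScalars ℂ = NSpan l.1 (ρ l)) ∧
        (∀ l, ∃ h : ∀ A : CB l.1, e A.1 ∈ BSet l.1,
          ∃ b : Module.Basis (CB l.1) ℂ (PMod l.1 (ρ l) ⧸ N l),
            ∀ A : CB l.1, b A = (N l).mkQ (pBasis l.1 (ρ l) ⟨e A.1, h A⟩)) ∧
        (∀ l, IsSimpleModule (CSchur n r) (PMod l.1 (ρ l) ⧸ N l)) ∧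
        (∀ l m, Nonempty ((PMod l.1 (ρ l) ⧸ N l) ≃ₗ[CSchur n r] (PMod m.1 (ρ m) ⧸ N m)) →
          l = m) ∧
        (∀ (M : Type*) [AddCommGroup M] [Module (CSchur n r) M],
          IsSimpleModule (CSchur n r) M →
          ∃ l, Nonempty (M ≃ₗ[CSchur n r] (PMod l.1 (ρ l) ⧸ N l))) := by
  refine ⟨fun l => ⟨rho l.1, isPAction_rho l.1, fun ρ' h => h.unique (isPAction_rho l.1)⟩,
    fun ρ hρ => ⟨fun l => NSub l.1 (ρ l) (hρ l), fun l => restrictScalars_NSub (hρ l),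
      fun l => ⟨CB.mem_BSet, sBasis (hρ l), sBasis_apply (hρ l)⟩,
      fun l => isSimpleModule_quotient (hρ l) l.2, fun l m ⟨φ⟩ =>
        Subtype.ext (eq_of_equiv (hρ l) (hρ m) l.2 m.2 φ), fun M _ _ _ =>
        nonempty_equiv_of_isSimpleModule ρ hρ⟩⟩
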